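/- Let $\mathbf A\in C^2(\mathbb R^2,\mathbb R^2)$ and $B,V\in C^1(\mathbb R^2,\mathbb R)$ with $B=\operatorname{curl}\mathbf A:=\partial_1A_2-\partial_2A_1$, and suppose that $V(\mathbf x)\ge -c|\mathbf x|^2+d$ on $\mathbb R^2$ for some constants $c>0$, $d\in\mathbb R$. Let $H=[\boldsymbol\sigma\cdot(-i\nabla-\mathbf A)]^2+V$ be the Pauli operator in $L^2(\mathbb R^2,\mathbb C^2)$, where $\boldsymbol\sigma=(\sigma_1,\sigma_2)$ are the first two Pauli matrices; that is, $H$ is the closure of this differential operator on $C_0^\infty(\mathbb R^2,\mathbb C^2)$ (it is self-adjoint). A function $f:\mathbb R^2\to\mathbb R$ is said to vary with rate $\nu\in[0,1]$ on a set $X\subset\mathbb R^2$ if there is a constant $C>0$ such that $|f(\mathbf x+\mathbf y)|\le C|f(\mathbf x)|$ for all $\mathbf x\in X$ and all $\mathbf y\in\mathbb R^2$ with $|\mathbf y|\le\frac12|\mathbf x|^\nu$. Assume that there are a continuous path $\gamma:(0,\infty)\to\mathbb R^2$ with $|\gamma(t)|\to\infty$ as $t\to\infty$ and constants $\epsilon>0$,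 $\nu\in[0,1]$ such that $|\nabla V|$ and $|\nabla B|$ vary with rate $\nu$ on $\operatorname{Im}(\gamma)$, and such that, as $t\to\infty$, $$\frac{V(\gamma(t))}{2|B(\gamma(t))|}\longrightarrow-\infty,$$ $$\left(\frac{|\nabla B(\gamma(t))|}{|B(\gamma(t))|}+\frac{|\nabla V(\gamma(t))|}{|V(\gamma(t))|}\right)\left(\frac{|V(\gamma(t))|^3}{B^2(\gamma(t))}\right)^{\frac{1+\epsilon}2}\longrightarrow0,$$ $$\frac1{|\gamma(t)|^{2\nu}}\left(\frac{|V(\gamma(t))|}{B^2(\gamma(t))}\right)^{1+\epsilon}\longrightarrow0.$$ Suppose in addition that there are constants $\alpha,\kappa,B_0>0$ such that for all $t\in(0,\infty)$ $$B_0\le|B(\gamma(t))|\le\alpha\exp\left(\kappa\left|\frac{V(\gamma(t))}{B(\gamma(t))}\right|\right).$$ Then $\sigma_{\rm ess}(H)=\mathbb R$, where the essential spectrum is the spectrum of $H$ without its isolated points that are eigenvalues of finite multiplicity. -/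

import Mathlib

open MeasureTheory Filter Topology
open scoped ContDiff

noncomputable section

/-- The Euclidean plane `ℝ²`. -/
abbrev Plane : Type := EuclideanSpace ℝ (Fin 2)

/-- The spin space `ℂ²` with its Hermitian inner product. -/
abbrev Spinor : Type := EuclideanSpace ℂ (Fin 2)

/-- The Hilbert space `L²(ℝ², ℂ²)`. -/
abbrev PauliHilbert : Type := Lp Spinor 2 (volume : Measure Plane)

/-- The `j`-th standard unit vector of `ℝ²`. -/
def planeUnit (j : Fin 2) : Plane := EuclideanSpace.single j 1

/-- `curl A = ∂₁ A₂ - ∂₂ A₁`. -/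
def curl (A : Plane → Plane) (x : Plane) : ℝ :=
  fderiv ℝ A x (planeUnit 0) 1 - fderiv ℝ A x (planeUnit 1) 0

/-- The Pauli matrix `σ₁`. -/
def pauliSigma₁ : Matrix (Fin 2) (Fin 2) ℂ := !![0, 1; 1, 0]

/-- The Pauli matrix `σ₂`. -/
def pauliSigma₂ : Matrix (Fin 2) (Fin 2) ℂ := !![0, -Complex.I; Complex.I, 0]

/-- The `j`-th component `-i ∂ⱼ - Aⱼ` of the kinetic momentum, acting on spinor-valued functions. -/
def kineticMomentum (A : Plane → Plane) (j : Fin 2) (φ : Plane → Spinor) (x : Plane) : Spinor :=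
  -Complex.I • fderiv ℝ φ x (planeUnit j) - (A x j : ℂ) • φ x

/-- The Dirac expression `σ · (-i ∇ - A) = σ₁ (-i ∂₁ - A₁) + σ₂ (-i ∂₂ - A₂)`. -/
def diracExpr (A : Plane → Plane) (φ : Plane → Spinor) (x : Plane) : Spinor :=
  Matrix.toEuclideanCLM (𝕜 := ℂ) pauliSigma₁ (kineticMomentum A 0 φ x) +
    Matrix.toEuclideanCLM (𝕜 := ℂ) pauliSigma₂ (kineticMomentum A 1 φ x)

/-- The Pauli expression `[σ · (-i ∇ - A)]² + V`. -/
def pauliExpr (A : Plane → Plane) (V : Plane → ℝ) (φ : Plane → Spinor) (x : Plane) : Spinor :=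
  diracExpr A (diracExpr A φ) x + (V x : ℂ) • φ x

/-- The space `C₀^∞(ℝ², ℂ²)` of smooth compactly supported spinor fields. -/
def testSpinors : Submodule ℂ (Plane → Spinor) where
  carrier := {φ | ContDiff ℝ ∞ φ ∧ HasCompactSupport φ}
  add_mem' := fun ha hb => ⟨ha.1.add hb.1, ha.2.add hb.2⟩
  zero_mem' := ⟨contDiff_const, HasCompactSupport.zero⟩
  smul_mem' := fun c _ ha => ⟨contDiff_const.smul ha.1, ha.2.smul_left (f := fun _ => c)⟩

theorem kineticMomentum_contDiff {A : Plane → Plane} {n m : WithTop ℕ∞} (hA : ContDiff ℝ n A)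
    (j : Fin 2) {φ : Plane → Spinor} (hφ : ContDiff ℝ m φ) (hnm : n + 1 ≤ m) :
    ContDiff ℝ n (kineticMomentum A j φ) := by
  have h1 : ContDiff ℝ n (fun x => fderiv ℝ φ x (planeUnit j)) :=
    (hφ.fderiv_right hnm).clm_apply contDiff_const
  have h2 : ContDiff ℝ n (fun x => ((A x j : ℝ) : ℂ)) :=
    Complex.ofRealCLM.contDiff.comp
      ((EuclideanSpace.proj j : Plane →L[ℝ] ℝ).contDiff.comp hA)
  have h3 : ContDiff ℝ n φ := hφ.of_le (le_trans le_self_add hnm)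
  have h4 : ContDiff ℝ n (fun x => -Complex.I • fderiv ℝ φ x (planeUnit j)) :=
    h1.const_smul (-Complex.I)
  exact h4.sub (h2.smul h3)

theorem diracExpr_contDiff {A : Plane → Plane} {n m : WithTop ℕ∞} (hA : ContDiff ℝ n A)
    {φ : Plane → Spinor} (hφ : ContDiff ℝ m φ) (hnm : n + 1 ≤ m) :
    ContDiff ℝ n (diracExpr A φ) :=
  (((Matrix.toEuclideanCLM (𝕜 := ℂ) pauliSigma₁).restrictScalars ℝ).contDiff.comp
      (kineticMomentum_contDiff hA 0 hφ hnm)).add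
    (((Matrix.toEuclideanCLM (𝕜 := ℂ) pauliSigma₂).restrictScalars ℝ).contDiff.comp
      (kineticMomentum_contDiff hA 1 hφ hnm))

theorem diracExpr_hasCompactSupport (A : Plane → Plane) {φ : Plane → Spinor}
    (hφ : HasCompactSupport φ) : HasCompactSupport (diracExpr A φ) := by
  refine hφ.mono' fun x hx => ?_
  by_contra hns
  apply hx
  have h0 : φ x = 0 := image_eq_zero_of_notMem_tsupport hns
  have h1 : fderiv ℝ φ x = 0 :=
    image_eq_zero_of_notMem_tsupport (fun h => hns (tsupport_fderiv_subset ℝ h))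
  simp [diracExpr, kineticMomentum, h0, h1]

theorem diracExpr_add (A : Plane → Plane) {φ χ : Plane → Spinor}
    (hφ : Differentiable ℝ φ) (hχ : Differentiable ℝ χ) :
    diracExpr A (φ + χ) = diracExpr A φ + diracExpr A χ := by
  funext x
  have h : ∀ j, kineticMomentum A j (φ + χ) x
      = kineticMomentum A j φ x + kineticMomentum A j χ x := by
    intro j
    simp only [kineticMomentum, fderiv_add (hφ x) (hχ x), Pi.add_apply,
      _root_.add_apply, smul_add]
    abel
  simp only [diracExpr, h, map_add, Pi.add_apply]
  abel

theorem diracExpr_smul (A : Plane → Plane) (c : ℂ) {φ : Plane → Spinor}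
    (hφ : Differentiable ℝ φ) : diracExpr A (c • φ) = c • diracExpr A φ := by
  funext x
  have h : ∀ j, kineticMomentum A j (c • φ) x = c • kineticMomentum A j φ x := by
    intro j
    have hd : fderiv ℝ (c • φ) x = c • fderiv ℝ φ x := fderiv_const_smul (hφ x) c
    simp only [kineticMomentum, hd, Pi.smul_apply, _root_.smul_apply, smul_sub]
    rw [smul_comm c (-Complex.I), smul_comm c (A x j : ℂ)]
  simp only [diracExpr, h, map_smul, Pi.smul_apply, smul_add]

theorem diracExpr_differentiable {A : Plane → Plane} (hA : ContDiff ℝ 1 A)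
    {φ : Plane → Spinor} (hφ : ContDiff ℝ ∞ φ) : Differentiable ℝ (diracExpr A φ) :=
  (diracExpr_contDiff hA hφ (by norm_cast)).differentiable one_ne_zero

theorem pauliExpr_continuous {A : Plane → Plane} {V : Plane → ℝ} (hA : ContDiff ℝ 1 A)
    (hV : Continuous V) {φ : Plane → Spinor} (hφ : ContDiff ℝ ∞ φ) :
    Continuous (pauliExpr A V φ) := by
  have h1 : ContDiff ℝ 1 (diracExpr A φ) :=
    diracExpr_contDiff hA hφ (by norm_cast)
  have h2 : ContDiff ℝ 0 (diracExpr A (diracExpr A φ)) :=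
    diracExpr_contDiff (hA.of_le zero_le_one) h1 (by simp)
  exact h2.continuous.add ((Complex.continuous_ofReal.comp hV).smul hφ.continuous)

theorem pauliExpr_hasCompactSupport (A : Plane → Plane) (V : Plane → ℝ) {φ : Plane → Spinor}
    (hφ : HasCompactSupport φ) : HasCompactSupport (pauliExpr A V φ) :=
  (diracExpr_hasCompactSupport A (diracExpr_hasCompactSupport A hφ)).add
    (hφ.smul_left (f := fun x => (V x : ℂ)))

theorem testSpinors_memLp (φ : testSpinors) :
    MemLp (φ : Plane → Spinor) 2 (volume : Measure Plane) :=
  φ.2.1.continuous.memLp_of_hasCompactSupport φ.2.2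

theorem pauliExpr_memLp {A : Plane → Plane} {V : Plane → ℝ} (hA : ContDiff ℝ 1 A)
    (hV : Continuous V) (φ : testSpinors) :
    MemLp (pauliExpr A V φ) 2 (volume : Measure Plane) :=
  (pauliExpr_continuous hA hV φ.2.1).memLp_of_hasCompactSupport
    (pauliExpr_hasCompactSupport A V φ.2.2)

/-- The inclusion of `C₀^∞(ℝ², ℂ²)` into `L²(ℝ², ℂ²)`. -/
def testSpinorsToL2 : testSpinors →ₗ[ℂ] PauliHilbert where
  toFun φ := (testSpinors_memLp φ).toLp _
  map_add' φ χ := MemLp.toLp_add (testSpinors_memLp φ) (testSpinors_memLp χ)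
  map_smul' c φ := MemLp.toLp_const_smul c (testSpinors_memLp φ)

theorem testSpinorsToL2_injective : Function.Injective testSpinorsToL2 := by
  intro φ χ h
  have h' := (MemLp.toLp_eq_toLp_iff (testSpinors_memLp φ) (testSpinors_memLp χ)).1 h
  exact Subtype.ext ((Continuous.ae_eq_iff_eq volume φ.2.1.continuous χ.2.1.continuous).1 h')

/-- The map `φ ↦ [σ · (-i ∇ - A)]² φ + V φ` from `C₀^∞(ℝ², ℂ²)` to `L²(ℝ², ℂ²)`. -/
def pauliOnTest (A : Plane → Plane) (V : Plane → ℝ) (hA : ContDiff ℝ 1 A) (hV : Continuous V) :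
    testSpinors →ₗ[ℂ] PauliHilbert where
  toFun φ := (pauliExpr_memLp hA hV φ).toLp _
  map_add' φ χ := by
    rw [← MemLp.toLp_add]
    congr 1
    have hφ := φ.2.1.differentiable (by simp)
    have hχ := χ.2.1.differentiable (by simp)
    funext x
    simp only [pauliExpr, Submodule.coe_add, diracExpr_add A hφ hχ,
      diracExpr_add A (diracExpr_differentiable hA φ.2.1) (diracExpr_differentiable hA χ.2.1),
      Pi.add_apply, smul_add]
    abel
  map_smul' c φ := by
    rw [RingHom.id_apply, ← MemLp.toLp_const_smul]
    congr 1
    have hφ := φ.2.1.differentiable (by simp)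
    funext x
    simp only [pauliExpr, Submodule.coe_smul, diracExpr_smul A c hφ,
      diracExpr_smul A c (diracExpr_differentiable hA φ.2.1), Pi.smul_apply, smul_add]
    rw [smul_comm c (V x : ℂ)]

/-- The Pauli operator with domain `C₀^∞(ℝ², ℂ²)`, as an unbounded operator in `L²(ℝ², ℂ²)`. -/
def pauliMinimal (A : Plane → Plane) (V : Plane → ℝ) (hA : ContDiff ℝ 1 A) (hV : Continuous V) :
    PauliHilbert →ₗ.[ℂ] PauliHilbert where
  domain := LinearMap.range testSpinorsToL2
  toFun := (pauliOnTest A V hA hV).comp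
    (LinearEquiv.ofInjective testSpinorsToL2 testSpinorsToL2_injective).symm.toLinearMap

/-- The Pauli operator `H = [σ · (-i ∇ - A)]² + V`: the closure in `L²(ℝ², ℂ²)` of its restriction
to `C₀^∞(ℝ², ℂ²)`. -/
def pauliOperator (A : Plane → Plane) (V : Plane → ℝ) (hA : ContDiff ℝ 1 A) (hV : Continuous V) :
    PauliHilbert →ₗ.[ℂ] PauliHilbert :=
  (pauliMinimal A V hA hV).closure

section Spectrum

variable {E : Type*} [NormedAddCommGroup E] [InnerProductSpace ℂ E]

/-- The resolvent set of an unbounded operator `T`: all `z` for which `T - z`, on the domain of `T`,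
has a bounded everywhere defined two-sided inverse `R`. -/
def unboundedResolventSet (T : E →ₗ.[ℂ] E) : Set ℂ :=
  {z | ∃ R : E →L[ℂ] E,
    (∀ y : E, ∃ h : R y ∈ T.domain, T ⟨R y, h⟩ - z • R y = y) ∧
    (∀ x : T.domain, R (T x - z • (x : E)) = x)}

/-- The spectrum `σ(T)` of an unbounded operator. -/
def unboundedSpectrum (T : E →ₗ.[ℂ] E) : Set ℂ := (unboundedResolventSet T)ᶜ

/-- The eigenspace `ker (T - z)`, as a subspace of the domain of `T`. -/
def unboundedEigenspace (T : E →ₗ.[ℂ] E) (z : ℂ) : Submodule ℂ T.domain :=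
  LinearMap.ker (T.toFun - z • T.domain.subtype)

/-- The discrete spectrum of a self-adjoint operator: the isolated points of the spectrum which
are eigenvalues of finite multiplicity. -/
def unboundedDiscreteSpectrum (T : E →ₗ.[ℂ] E) : Set ℂ :=
  {z | (∃ U ∈ 𝓝 z, U ∩ unboundedSpectrum T = {z}) ∧ unboundedEigenspace T z ≠ ⊥ ∧
    FiniteDimensional ℂ (unboundedEigenspace T z)}

/-- The essential spectrum of a self-adjoint operator: the complement of the discrete spectrum
in the spectrum. -/
def unboundedEssentialSpectrum (T : E →ₗ.[ℂ] E) : Set ℂ :=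
  unboundedSpectrum T \ unboundedDiscreteSpectrum T

end Spectrum

/-- `f` varies with rate `ν` on the set `X`: there is `C > 0` with `|f (x + y)| ≤ C |f x|` for all
`x ∈ X` and all `y` with `|y| ≤ |x|^ν / 2`. -/
def VariesWithRate (f : Plane → ℝ) (ν : ℝ) (X : Set Plane) : Prop :=
  ∃ C : ℝ, 0 < C ∧ ∀ x ∈ X, ∀ y : Plane, ‖y‖ ≤ (1 / 2) * ‖x‖ ^ ν → |f (x + y)| ≤ C * |f x|

end

/-! The spectrum of `H` is shown to be exactly ℝ. Since ℝ has no isolated points, no part of it is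
discrete, and all of it is essential.

No nonreal spectrum. The Dirac expression exchanges the two spin components, so its square acts on
each of them as `P*P` with `P = π₁ + cπ₂`, `c = ±i`, and the problem becomes scalar. A nonreal `z`
is in the resolvent set once every square integrable weak solution `g` of `(P*P + V - z̄) g = 0`
vanishes (`mem_unboundedResolventSet_closure`, `weakSolution_eq_zero`). Such a `g` is mollified in
the manner of Friedrichs: the commutator of the operator with the mollification is bounded in `L²`
on balls and tends weakly to zero, so one may test with `χ²g` without elliptic regularity. For the
mollified solution the imaginary part of the resulting identity bounds `|Im z| ‖χg‖²` by `‖2(∇χ)g‖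
‖χPg‖` up to a vanishing error, and the real part bounds `‖χPg‖`. For a cutoff at radius `R` the
first factor is of order `1/R` times the mass of `g` outside radius `R/2`, and the quadratic lower
bound on `V` lets the second grow at most like `R`. The product tends to zero.

Every real `l` is in the spectrum. Along the path `(l - V)/(2|B|)` is continuous and tends to
infinity, so it takes arbitrarily large integer values `n`, far out. At such a point `x₀` one has
`2nb + V(x₀) = l` with `b = |B(x₀)|`: a Landau level of the field frozen at `x₀` has energy exactly
`l`. The trial function is the Landau state `(y₁ - cy₂)ⁿ exp(-b|y|²/4)`, `y = x - x₀`, with `c`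
chosen by the sign of `B(x₀)`, cut off at a radius `R` with `R²` a large multiple of `n/b` and
multiplied by the phase that passes to the Poincaré gauge at `x₀` (`exists_trial_function`).

Its error has two sources. The variation of the fields over the ball contributes multiples of
`R|∇V|` and `nR|∇B|`; as `n` is comparable to `|V|/b`, these tend to zero by the second limit, while
the third limit keeps the ball inside the region where the gradients are controlled by their values
at `x₀`. The derivatives of the cutoff act only where the state is exponentially small in `n`; they
cost a factor of order `b`, which is at most exponential in `n` by the last assumption and is beaten
by the choice of the multiple in `R²` (`exists_approximate_eigenfunction`, `mem_spectrum_of_path`).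
-/

section AbstractSpectrum

/-! ### Symmetric operators: resolvent of the closure, approximate eigenvectors -/

variable {E : Type*} [NormedAddCommGroup E] [InnerProductSpace ℂ E]

/-- A symmetric operator satisfies `|Im z| ‖x‖ ≤ ‖(T - z) x‖`. -/
theorem abs_im_mul_norm_le_of_symmetric {T : E →ₗ.[ℂ] E} (hs : T.IsFormalAdjoint T) (z : ℂ)
    (x : T.domain) : |z.im| * ‖(x : E)‖ ≤ ‖T x - z • (x : E)‖ := by
  have h1 : (inner ℂ (x : E) (T x)).im = 0 := by
    have := hs x x
    rw [← inner_conj_symm] at this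
    exact Complex.conj_eq_iff_im.1 this
  have h2 : (inner ℂ (x : E) (T x - z • (x : E))).im = -(z.im * ‖(x : E)‖ ^ 2) := by
    rw [inner_sub_right, inner_smul_right, inner_self_eq_norm_sq_to_K, Complex.sub_im, h1,
      Complex.mul_im]
    simp [← Complex.ofReal_pow]
  have h3 := Complex.abs_im_le_norm (inner ℂ (x : E) (T x - z • (x : E)))
  rw [h2, abs_neg, abs_mul, abs_of_nonneg (sq_nonneg ‖(x : E)‖)] at h3
  have h4 := h3.trans (norm_inner_le_norm _ _)
  rcases (norm_nonneg (x : E)).eq_or_lt with h0 | h0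
  · rw [← h0, mul_zero]; exact norm_nonneg _
  · exact le_of_mul_le_mul_right (by nlinarith) h0

/-- If `T` is symmetric and densely defined and `T - z` has dense range, `z` nonreal, then `z`
belongs to the resolvent set of the closure of `T`. -/
theorem mem_unboundedResolventSet_closure [CompleteSpace E] {T : E →ₗ.[ℂ] E}
    (hd : Dense (T.domain : Set E)) (hs : T.IsFormalAdjoint T) {z : ℂ} (hz : z.im ≠ 0)
    (hr : ∀ g : E, (∀ x : T.domain, inner ℂ (T x - z • (x : E)) g = 0) → g = 0) :
    z ∈ unboundedResolventSet T.closure := by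
  -- By symmetry `T` is contained in its adjoint, which is closed.
  have hcl : T.IsClosable :=
    (LinearPMap.adjoint_isClosed hd).isClosable.leIsClosable (hs.le_adjoint hd)
  have hgr := hcl.graph_closure_eq_closure_graph
  have hzp : 0 < |z.im| := abs_pos.2 hz
  -- The lower bound is a closed condition on pairs, so it passes from the graph of `T` to the graph
  -- of the closure.
  have hbound : ∀ p ∈ T.closure.graph, |z.im| * ‖p.1‖ ≤ ‖p.2 - z • p.1‖ := by
    intro p hp
    rw [← hgr] at hp
    have hclosed : IsClosed {p : E × E | |z.im| * ‖p.1‖ ≤ ‖p.2 - z • p.1‖} :=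
      isClosed_le (by fun_prop) (by fun_prop)
    refine closure_minimal ?_ hclosed (show p ∈ closure (T.graph : Set (E × E)) from hp)
    rintro ⟨a, b⟩ hab
    obtain ⟨x, rfl, rfl⟩ := (LinearPMap.mem_graph_iff T).1 hab
    exact abs_im_mul_norm_le_of_symmetric hs z x
  -- The range of `T - z` is dense, and by the lower bound preimages of a convergent sequence are
  -- Cauchy. Hence the closure minus `z` is onto.
  have hsurj : ∀ y : E, ∃ x : E, (x, y + z • x) ∈ T.closure.graph := by
    let S : Submodule ℂ E := LinearMap.range (T.toFun - z • T.domain.subtype)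
    have hS : Dense (S : Set E) := by
      rw [Submodule.dense_iff_topologicalClosure_eq_top,
        Submodule.topologicalClosure_eq_top_iff, Submodule.eq_bot_iff]
      intro g hg
      refine hr g fun x => ?_
      exact hg _ ⟨x, rfl⟩
    intro y
    obtain ⟨u, huS, huy⟩ := mem_closure_iff_seq_limit.1 (hS y)
    choose x hx using huS
    have hx' : ∀ n, T (x n) - z • (x n : E) = u n := hx
    have hcau : CauchySeq fun n => (x n : E) := by
      rw [Metric.cauchySeq_iff']
      intro ε hε
      obtain ⟨N, hN⟩ := Metric.cauchySeq_iff'.1 huy.cauchySeq (|z.im| * ε) (by positivity)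
      refine ⟨N, fun n hn => ?_⟩
      have h1 := abs_im_mul_norm_le_of_symmetric hs z (x n - x N)
      have h2 : T (x n - x N) - z • ((x n - x N : T.domain) : E) = u n - u N := by
        rw [LinearPMap.map_sub, ← hx' n, ← hx' N, Submodule.coe_sub, smul_sub]; abel
      rw [h2] at h1
      have h3 := hN n hn
      rw [dist_eq_norm] at h3 ⊢
      exact lt_of_mul_lt_mul_left (h1.trans_lt h3) hzp.le
    obtain ⟨a, ha⟩ := cauchySeq_tendsto_of_complete hcau
    refine ⟨a, ?_⟩
    rw [← hgr]
    refine mem_closure_of_tendsto (f := fun n => ((x n : E), T (x n))) (b := atTop) ?_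
      (Eventually.of_forall fun n => T.mem_graph (x n))
    refine ha.prodMk_nhds ?_
    refine (huy.add (ha.const_smul z)).congr fun n => ?_
    rw [← hx' n]; abel
  have huniq : ∀ {a b y : E}, (a, y + z • a) ∈ T.closure.graph → (b, y + z • b) ∈ T.closure.graph →
      a = b := by
    intro a b y ha hb
    have h := hbound _ (sub_mem ha hb)
    have h0 : ((a, y + z • a) - (b, y + z • b)).2 - z • ((a, y + z • a) - (b, y + z • b)).1
        = (0 : E) := by
      simp only [Prod.snd_sub, Prod.fst_sub, smul_sub]; abel
    rw [h0, norm_zero] at h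
    have h5 : ‖a - b‖ ≤ 0 := by
      have : |z.im| * ‖a - b‖ ≤ |z.im| * 0 := by rw [mul_zero]; exact h
      exact le_of_mul_le_mul_left this hzp
    exact sub_eq_zero.1 (norm_le_zero_iff.1 h5)
  choose r hrg using hsurj
  let R₀ : E →ₗ[ℂ] E :=
    { toFun := r
      map_add' := fun y y' => huniq (hrg (y + y')) (by
        have := add_mem (hrg y) (hrg y')
        convert this using 1
        ext <;> simp only [Prod.mk_add_mk, smul_add]
        abel)
      map_smul' := fun c y => huniq (hrg (c • y)) (by
        have := T.closure.graph.smul_mem c (hrg y)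
        convert this using 1
        ext <;> simp [smul_add, smul_comm c z]) }
  let R : E →L[ℂ] E := R₀.mkContinuous |z.im|⁻¹ fun y => by
    have h := hbound _ (hrg y)
    rw [add_sub_cancel_right] at h
    rw [inv_mul_eq_div, le_div_iff₀ hzp, mul_comm]
    exact h
  refine ⟨R, fun y => ?_, fun x => ?_⟩
  · obtain ⟨x, hx1, hx2⟩ := (LinearPMap.mem_graph_iff _).1 (hrg y)
    have hx1' : (x : E) = R y := hx1
    refine ⟨hx1' ▸ x.2, ?_⟩
    have hx3 : (⟨R y, hx1' ▸ x.2⟩ : T.closure.domain) = x := Subtype.ext hx1'.symm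
    rw [hx3, hx2]
    exact add_sub_cancel_right _ _
  · refine huniq (hrg (T.closure x - z • (x : E))) ?_
    rw [sub_add_cancel]
    exact T.closure.mem_graph x

/-- Points at which a bounded inverse is excluded by approximate eigenvectors lie in the
spectrum of the closure. -/
theorem mem_unboundedSpectrum_closure {T : E →ₗ.[ℂ] E} {z : ℂ}
    (h : ∀ δ : ℝ, 0 < δ → ∃ x : T.domain, ‖T x - z • (x : E)‖ < δ * ‖(x : E)‖) :
    z ∈ unboundedSpectrum T.closure := by
  rintro ⟨R, -, hR⟩
  -- The `+ 1` covers `R = 0`.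
  obtain ⟨x, hx⟩ := h (‖R‖ + 1)⁻¹ (by positivity)
  have hle := T.le_closure
  have hTx : T.closure ⟨x, hle.1 x.2⟩ = T x := (hle.2 rfl).symm
  have h1 := hR ⟨x, hle.1 x.2⟩
  rw [hTx] at h1
  have h2 := R.le_opNorm (T x - z • (x : E))
  rw [h1] at h2
  have h3 : ‖(x : E)‖ ≤ (‖R‖ + 1) * ‖T x - z • (x : E)‖ :=
    h2.trans (by gcongr; linarith)
  rw [inv_mul_eq_div, lt_div_iff₀ (by positivity)] at hx
  linarith

/-- A spectrum equal to the whole real line is purely essential. -/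
theorem unboundedEssentialSpectrum_eq_range_ofReal {T : E →ₗ.[ℂ] E}
    (h : unboundedSpectrum T = Set.range ((↑) : ℝ → ℂ)) :
    unboundedEssentialSpectrum T = Set.range ((↑) : ℝ → ℂ) := by
  rw [unboundedEssentialSpectrum, h, sdiff_eq_left, Set.disjoint_left]
  rintro _ ⟨a, rfl⟩ ⟨⟨U, hU, hUT⟩, -⟩
  rw [h] at hUT
  have hpre : ((↑) : ℝ → ℂ) ⁻¹' U ∈ 𝓝 a :=
    Complex.continuous_ofReal.continuousAt.preimage_mem_nhds hU
  obtain ⟨ε, hε, hball⟩ := Metric.mem_nhds_iff.1 hpre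
  have hmem : ((a + ε / 2 : ℝ) : ℂ) ∈ U ∩ Set.range ((↑) : ℝ → ℂ) := by
    refine ⟨hball ?_, _, rfl⟩
    rw [Metric.mem_ball, Real.dist_eq, add_sub_cancel_left, abs_of_pos (by positivity)]
    linarith
  rw [hUT, Set.mem_singleton_iff] at hmem
  have := Complex.ofReal_injective hmem
  linarith

end AbstractSpectrum

/-! ### The operators `∂₁ + c∂₂`, the scalar Pauli components, integration by parts -/

noncomputable section ScalarCalculus

open Complex (I)

/-- The first order operator `∂₁ + c ∂₂` on complex functions on the plane. -/
def wirtinger (c : ℂ) (f : Plane → ℂ) (x : Plane) : ℂ :=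
  fderiv ℝ f x (planeUnit 0) + c * fderiv ℝ f x (planeUnit 1)

/-- The complex combination `A₁ + c A₂` of the components of a vector field. -/
def complexPotential (A : Plane → Plane) (c : ℂ) (x : Plane) : ℂ :=
  (A x 0 : ℂ) + c * (A x 1 : ℂ)

/-- The operator `π₁ + c π₂`, where `π = -i∇ - A`. -/
def momentum (A : Plane → Plane) (c : ℂ) (f : Plane → ℂ) (x : Plane) : ℂ :=
  -I * wirtinger c f x - complexPotential A c x * f x

/-- The component `(π₁ - c π₂) (π₁ + c π₂) + V` of the Pauli operator. -/
def scalarPauli (A : Plane → Plane) (V : Plane → ℝ) (c : ℂ) (f : Plane → ℂ) (x : Plane) : ℂ :=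
  momentum A (-c) (momentum A c f) x + (V x : ℂ) * f x

/-- The zeroth order coefficient of `scalarPauli`. -/
def pauliPotential (A : Plane → Plane) (V : Plane → ℝ) (c : ℂ) (x : Plane) : ℂ :=
  I * wirtinger (-c) (complexPotential A c) x
    + complexPotential A (-c) x * complexPotential A c x + (V x : ℂ)

/-- The unit `c = ± i` for which `scalarPauli A V c` acts on the `j`-th spin component. -/
def spinUnit (j : Fin 2) : ℂ := if j = 0 then I else -I

theorem conj_spinUnit (j : Fin 2) : (starRingEnd ℂ) (spinUnit j) = -spinUnit j := by
  fin_cases j <;> simp [spinUnit]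

theorem spinUnit_mul_self (j : Fin 2) : spinUnit j * spinUnit j = -1 := by
  fin_cases j <;> simp [spinUnit]

theorem norm_spinUnit (j : Fin 2) : ‖spinUnit j‖ = 1 := by
  fin_cases j <;> simp [spinUnit]

theorem norm_planeUnit (j : Fin 2) : ‖planeUnit j‖ = 1 := by
  simp [planeUnit]

section Derivatives

variable {c : ℂ} {f g : Plane → ℂ} {x : Plane}

theorem wirtinger_add (hf : DifferentiableAt ℝ f x) (hg : DifferentiableAt ℝ g x) :
    wirtinger c (fun y => f y + g y) x = wirtinger c f x + wirtinger c g x := by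
  simp only [wirtinger, fderiv_fun_add hf hg, _root_.add_apply]
  ring

theorem wirtinger_sub (hf : DifferentiableAt ℝ f x) (hg : DifferentiableAt ℝ g x) :
    wirtinger c (fun y => f y - g y) x = wirtinger c f x - wirtinger c g x := by
  simp only [wirtinger, fderiv_fun_sub hf hg, _root_.sub_apply]
  ring

theorem wirtinger_mul (hf : DifferentiableAt ℝ f x) (hg : DifferentiableAt ℝ g x) :
    wirtinger c (fun y => f y * g y) x = f x * wirtinger c g x + g x * wirtinger c f x := by
  simp only [wirtinger, fderiv_fun_mul hf hg, _root_.add_apply, _root_.smul_apply, smul_eq_mul]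
  ring

theorem wirtinger_const_mul (a : ℂ) (hf : DifferentiableAt ℝ f x) :
    wirtinger c (fun y => a * f y) x = a * wirtinger c f x := by
  simp only [wirtinger, fderiv_const_mul hf, _root_.smul_apply, smul_eq_mul]
  ring

theorem wirtinger_const (a : ℂ) : wirtinger c (fun _ => a) x = 0 := by
  simp [wirtinger]

theorem fderiv_conj_apply (hf : DifferentiableAt ℝ f x) (v : Plane) :
    fderiv ℝ (fun y => (starRingEnd ℂ) (f y)) x v = (starRingEnd ℂ) (fderiv ℝ f x v) := by
  have h : HasFDerivAt (fun y => (starRingEnd ℂ) (f y))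
      ((Complex.conjCLE : ℂ →L[ℝ] ℂ).comp (fderiv ℝ f x)) x :=
    (Complex.conjCLE : ℂ →L[ℝ] ℂ).hasFDerivAt.comp x hf.hasFDerivAt
  rw [h.fderiv]
  simp

theorem wirtinger_conj (hf : DifferentiableAt ℝ f x) :
    wirtinger c (fun y => (starRingEnd ℂ) (f y)) x
      = (starRingEnd ℂ) (wirtinger ((starRingEnd ℂ) c) f x) := by
  simp only [wirtinger, fderiv_conj_apply hf, map_add, map_mul, Complex.conj_conj]

theorem wirtinger_congr (h : f =ᶠ[𝓝 x] g) : wirtinger c f x = wirtinger c g x := by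
  simp only [wirtinger, h.fderiv_eq]

theorem momentum_congr {A : Plane → Plane} (h : f =ᶠ[𝓝 x] g) :
    momentum A c f x = momentum A c g x := by
  simp only [momentum, wirtinger_congr h, h.eq_of_nhds]

theorem wirtinger_contDiff {n m : WithTop ℕ∞} (hf : ContDiff ℝ m f) (hnm : n + 1 ≤ m) :
    ContDiff ℝ n (wirtinger c f) := by
  have h : ∀ v : Plane, ContDiff ℝ n (fun x => fderiv ℝ f x v) := fun v =>
    (hf.fderiv_right hnm).clm_apply contDiff_const
  exact (h _).add (contDiff_const.mul (h _))

theorem complexPotential_contDiff {A : Plane → Plane} {n : WithTop ℕ∞} (hA : ContDiff ℝ n A) :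
    ContDiff ℝ n (complexPotential A c) := by
  have h : ∀ j : Fin 2, ContDiff ℝ n (fun x => ((A x j : ℝ) : ℂ)) := fun j =>
    Complex.ofRealCLM.contDiff.comp
      ((EuclideanSpace.proj j : Plane →L[ℝ] ℝ).contDiff.comp hA)
  exact (h 0).add (contDiff_const.mul (h 1))

theorem momentum_contDiff {A : Plane → Plane} {n m : WithTop ℕ∞} (hA : ContDiff ℝ n A)
    (hf : ContDiff ℝ m f) (hnm : n + 1 ≤ m) : ContDiff ℝ n (momentum A c f) :=
  (contDiff_const.mul (wirtinger_contDiff hf hnm)).sub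
    ((complexPotential_contDiff hA).mul (hf.of_le (le_trans le_self_add hnm)))

theorem wirtinger_hasCompactSupport (hf : HasCompactSupport f) :
    HasCompactSupport (wirtinger c f) := by
  refine hf.mono' fun x hx => ?_
  by_contra hns
  apply hx
  have h1 : fderiv ℝ f x = 0 :=
    image_eq_zero_of_notMem_tsupport (fun h => hns (tsupport_fderiv_subset ℝ h))
  simp [wirtinger, h1]

theorem momentum_hasCompactSupport {A : Plane → Plane} (hf : HasCompactSupport f) :
    HasCompactSupport (momentum A c f) := by
  refine hf.mono' fun x hx => ?_
  by_contra hns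
  apply hx
  have h0 : f x = 0 := image_eq_zero_of_notMem_tsupport hns
  have h1 : fderiv ℝ f x = 0 :=
    image_eq_zero_of_notMem_tsupport (fun h => hns (tsupport_fderiv_subset ℝ h))
  simp [momentum, wirtinger, h0, h1]

theorem conj_complexPotential (A : Plane → Plane) (x : Plane) :
    (starRingEnd ℂ) (complexPotential A c x) = complexPotential A ((starRingEnd ℂ) c) x := by
  simp [complexPotential]

theorem momentum_mul {A : Plane → Plane} (hf : DifferentiableAt ℝ f x)
    (hg : DifferentiableAt ℝ g x) :
    momentum A c (fun y => f y * g y) x = f x * momentum A c g x + -I * wirtinger c f x * g x := by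
  simp only [momentum, wirtinger_mul hf hg]
  ring

theorem norm_wirtinger_le (hc : ‖c‖ = 1) : ‖wirtinger c f x‖ ≤ 2 * ‖fderiv ℝ f x‖ := by
  have h : ∀ j, ‖fderiv ℝ f x (planeUnit j)‖ ≤ ‖fderiv ℝ f x‖ := fun j => by
    simpa [norm_planeUnit] using (fderiv ℝ f x).le_opNorm (planeUnit j)
  calc ‖wirtinger c f x‖ ≤ ‖fderiv ℝ f x (planeUnit 0)‖ + ‖c * fderiv ℝ f x (planeUnit 1)‖ :=
        norm_add_le _ _
    _ ≤ _ := by rw [norm_mul, hc]; linarith [h 0, h 1]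

end Derivatives

/-- Symmetry of second derivatives. For imaginary `c` it makes `(∂₁ - c∂₂)(∂₁ + c∂₂)k` real whenever
`k` is real, which `residual_smoothing` needs. -/
theorem wirtinger_comm {f : Plane → ℂ} (hf : ContDiff ℝ 2 f) (a c : ℂ) (x : Plane) :
    wirtinger a (wirtinger c f) x = wirtinger c (wirtinger a f) x := by
  have hd : DifferentiableAt ℝ (fderiv ℝ f) x :=
    ((hf.fderiv_right (m := 1) (by norm_num)).differentiable one_ne_zero) x
  have h1 : ∀ v w : Plane, fderiv ℝ (fun y => fderiv ℝ f y v) x w =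
      fderiv ℝ (fderiv ℝ f) x w v := by
    intro v w
    rw [fderiv_clm_apply hd (differentiableAt_const v)]
    simp
  have hdv : ∀ v : Plane, DifferentiableAt ℝ (fun y => fderiv ℝ f y v) x := fun v =>
    hd.clm_apply (differentiableAt_const v)
  have h2 : ∀ (c : ℂ) (w : Plane), fderiv ℝ (wirtinger c f) x w
      = fderiv ℝ (fderiv ℝ f) x w (planeUnit 0) + c * fderiv ℝ (fderiv ℝ f) x w (planeUnit 1) := by
    intro c w
    have : wirtinger c f = fun y => fderiv ℝ f y (planeUnit 0) + c * fderiv ℝ f y (planeUnit 1) :=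
      rfl
    rw [this, fderiv_fun_add (hdv _) ((hdv _).const_mul c), fderiv_const_mul (hdv _)]
    simp [h1]
  have hsymm : IsSymmSndFDerivAt ℝ f x :=
    hf.contDiffAt.isSymmSndFDerivAt (by simp)
  have e1 : ∀ c, wirtinger a (wirtinger c f) x = fderiv ℝ (wirtinger c f) x (planeUnit 0)
    + a * fderiv ℝ (wirtinger c f) x (planeUnit 1) := fun _ => rfl
  have e2 : wirtinger c (wirtinger a f) x = fderiv ℝ (wirtinger a f) x (planeUnit 0)
    + c * fderiv ℝ (wirtinger a f) x (planeUnit 1) := rfl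
  rw [e1, e2]
  simp only [h2]
  rw [hsymm (planeUnit 0) (planeUnit 1)]
  ring

/-- The Pauli component written out as a second order operator. -/
theorem scalarPauli_eq {A : Plane → Plane} (V : Plane → ℝ) (hA : ContDiff ℝ 1 A) (c : ℂ)
    {f : Plane → ℂ} (hf : ContDiff ℝ 2 f) (x : Plane) :
    scalarPauli A V c f x = -wirtinger (-c) (wirtinger c f) x
      + I * complexPotential A c x * wirtinger (-c) f x
      + I * complexPotential A (-c) x * wirtinger c f x + pauliPotential A V c x * f x := by
  have h1 : DifferentiableAt ℝ (wirtinger c f) x :=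
    (wirtinger_contDiff (n := 1) hf (by norm_num)).differentiable one_ne_zero x
  have h2 : DifferentiableAt ℝ (complexPotential A c) x :=
    (complexPotential_contDiff hA).differentiable one_ne_zero x
  have h3 : DifferentiableAt ℝ f x := hf.differentiable two_ne_zero x
  have h4 : wirtinger (-c) (momentum A c f) x = -I * wirtinger (-c) (wirtinger c f) x
      - (complexPotential A c x * wirtinger (-c) f x
        + f x * wirtinger (-c) (complexPotential A c) x) := by
    rw [← wirtinger_mul h2 h3, ← wirtinger_const_mul _ h1]
    exact wirtinger_sub (h1.const_mul _) (h2.mul h3)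
  rw [scalarPauli, momentum, h4, momentum, pauliPotential]
  linear_combination (wirtinger (-c) (wirtinger c f) x) * Complex.I_mul_I

theorem pauliPotential_continuous {A : Plane → Plane} {V : Plane → ℝ} (hA : ContDiff ℝ 1 A)
    (hV : Continuous V) (c : ℂ) : Continuous (pauliPotential A V c) :=
  ((continuous_const.mul
    (wirtinger_contDiff (n := 0) (complexPotential_contDiff hA) (by simp)).continuous).add
      ((complexPotential_contDiff hA).continuous.mul
        (complexPotential_contDiff hA).continuous)).add
    (Complex.continuous_ofReal.comp hV)

theorem scalarPauli_continuous {A : Plane → Plane} {V : Plane → ℝ} (hA : ContDiff ℝ 1 A)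
    (hV : Continuous V) (c : ℂ) {f : Plane → ℂ} (hf : ContDiff ℝ 2 f) :
    Continuous (scalarPauli A V c f) := by
  have h1 : ContDiff ℝ 1 (momentum A c f) := momentum_contDiff hA hf (by norm_num)
  exact (momentum_contDiff (n := 0) (hA.of_le zero_le_one) h1 (by simp)).continuous.add
    ((Complex.continuous_ofReal.comp hV).mul hf.continuous)

theorem scalarPauli_hasCompactSupport {A : Plane → Plane} {V : Plane → ℝ} {c : ℂ}
    {f : Plane → ℂ} (hf : HasCompactSupport f) : HasCompactSupport (scalarPauli A V c f) :=
  (momentum_hasCompactSupport (momentum_hasCompactSupport hf)).add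
    (hf.mul_left (f := fun x => (V x : ℂ)))

section IntegrationByParts

/-- Compact support of one factor removes the boundary terms. The other factor stays unrestricted at
infinity, since mollified `L²` functions will take its place. -/
theorem integral_mul_wirtinger {c : ℂ} {f g : Plane → ℂ} (hf : ContDiff ℝ 1 f)
    (hg : ContDiff ℝ 1 g) (hfc : HasCompactSupport f) :
    ∫ x, f x * wirtinger c g x = -∫ x, wirtinger c f x * g x := by
  have hcf : ∀ v : Plane, Continuous (fun x => fderiv ℝ f x v) := fun v =>
    (hf.continuous_fderiv one_ne_zero).clm_apply continuous_const
  have hcg : ∀ v : Plane, Continuous (fun x => fderiv ℝ g x v) := fun v =>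
    (hg.continuous_fderiv one_ne_zero).clm_apply continuous_const
  have hsf : ∀ v : Plane, HasCompactSupport (fun x => fderiv ℝ f x v) := fun v =>
    hfc.fderiv_apply ℝ v
  have i1 : ∀ v, Integrable (fun x => fderiv ℝ f x v * g x) := fun v =>
    ((hcf v).mul hg.continuous).integrable_of_hasCompactSupport (hsf v).mul_right
  have i2 : ∀ v, Integrable (fun x => f x * fderiv ℝ g x v) := fun v =>
    (hf.continuous.mul (hcg v)).integrable_of_hasCompactSupport hfc.mul_right
  have i3 : Integrable (fun x => f x * g x) :=
    (hf.continuous.mul hg.continuous).integrable_of_hasCompactSupport hfc.mul_right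
  have key : ∀ v, ∫ x, f x * fderiv ℝ g x v = -∫ x, fderiv ℝ f x v * g x := fun v =>
    integral_mul_fderiv_eq_neg_fderiv_mul_of_integrable (i1 v) (i2 v) i3
      (fun x _ => hf.differentiable one_ne_zero x) (fun x _ => hg.differentiable one_ne_zero x)
  have e1 : ∫ x, f x * wirtinger c g x
      = (∫ x, f x * fderiv ℝ g x (planeUnit 0)) + c * ∫ x, f x * fderiv ℝ g x (planeUnit 1) := by
    rw [← integral_const_mul, ← integral_add (i2 _) ((i2 _).const_mul c)]
    refine integral_congr_ae (Eventually.of_forall fun x => ?_)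
    simp only [wirtinger]; ring
  have e2 : ∫ x, wirtinger c f x * g x
      = (∫ x, fderiv ℝ f x (planeUnit 0) * g x) + c * ∫ x, fderiv ℝ f x (planeUnit 1) * g x := by
    rw [← integral_const_mul, ← integral_add (i1 _) ((i1 _).const_mul c)]
    refine integral_congr_ae (Eventually.of_forall fun x => ?_)
    simp only [wirtinger]; ring
  rw [e1, e2, key, key]
  ring

/-- `π₁ - c π₂` is the formal adjoint of `π₁ + c π₂`. -/
theorem integral_conj_mul_momentum {A : Plane → Plane} (hA : Continuous A) {c : ℂ}
    (hc : (starRingEnd ℂ) c = -c) {f g : Plane → ℂ} (hf : ContDiff ℝ 1 f) (hg : ContDiff ℝ 1 g)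
    (hfc : HasCompactSupport f) :
    ∫ x, (starRingEnd ℂ) (f x) * momentum A (-c) g x
      = ∫ x, (starRingEnd ℂ) (momentum A c f x) * g x := by
  have hα : ∀ c, Continuous (complexPotential A c) := fun c =>
    (complexPotential_contDiff (n := 0) (contDiff_zero.2 hA)).continuous
  have hfs : ContDiff ℝ 1 (fun x => (starRingEnd ℂ) (f x)) :=
    (Complex.conjCLE : ℂ →L[ℝ] ℂ).contDiff.comp hf
  have hfsc : HasCompactSupport (fun x => (starRingEnd ℂ) (f x)) :=
    hfc.comp_left (g := starRingEnd ℂ) (map_zero _)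
  have key := integral_mul_wirtinger (c := -c) hfs hg hfsc
  have hwf : Continuous (wirtinger (-c) (fun x => (starRingEnd ℂ) (f x))) :=
    (wirtinger_contDiff (n := 0) hfs (by simp)).continuous
  have hwg : Continuous (wirtinger (-c) g) :=
    (wirtinger_contDiff (n := 0) hg (by simp)).continuous
  have i0 : Integrable (fun x => complexPotential A (-c) x * ((starRingEnd ℂ) (f x) * g x)) :=
    ((hα _).mul (hfs.continuous.mul hg.continuous)).integrable_of_hasCompactSupport
      (hfsc.mul_right.mul_left)
  have i1 : Integrable (fun x => (starRingEnd ℂ) (f x) * wirtinger (-c) g x) :=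
    (hfs.continuous.mul hwg).integrable_of_hasCompactSupport hfsc.mul_right
  have i2 : Integrable (fun x => wirtinger (-c) (fun x => (starRingEnd ℂ) (f x)) x * g x) :=
    (hwf.mul hg.continuous).integrable_of_hasCompactSupport
      (wirtinger_hasCompactSupport hfsc).mul_right
  calc ∫ x, (starRingEnd ℂ) (f x) * momentum A (-c) g x
      = ∫ x, (-I * ((starRingEnd ℂ) (f x) * wirtinger (-c) g x)
          - complexPotential A (-c) x * ((starRingEnd ℂ) (f x) * g x)) := by
        refine integral_congr_ae (Eventually.of_forall fun x => ?_)
        simp only [momentum]; ring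
    _ = ∫ x, (I * (wirtinger (-c) (fun x => (starRingEnd ℂ) (f x)) x * g x)
          - complexPotential A (-c) x * ((starRingEnd ℂ) (f x) * g x)) := by
        rw [integral_sub (i1.const_mul _) i0, integral_sub (i2.const_mul _) i0,
          integral_const_mul, integral_const_mul, key]
        ring
    _ = _ := by
        refine integral_congr_ae (Eventually.of_forall fun x => ?_)
        simp only [momentum, wirtinger_conj (hf.differentiable one_ne_zero x), map_sub, map_mul,
          map_neg, Complex.conj_I, hc, neg_neg, conj_complexPotential]
        ring

/-- For imaginary `c` the operator has the form `P*P + V` with `V` real, so the adjointness of the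
two first order factors is used twice. -/
theorem integral_conj_mul_scalarPauli {A : Plane → Plane} {V : Plane → ℝ} (hA : ContDiff ℝ 1 A)
    (hV : Continuous V) {c : ℂ} (hc : (starRingEnd ℂ) c = -c) {f g : Plane → ℂ}
    (hf : ContDiff ℝ 2 f) (hg : ContDiff ℝ 2 g) (hfc : HasCompactSupport f) :
    ∫ x, (starRingEnd ℂ) (f x) * scalarPauli A V c g x
      = ∫ x, (starRingEnd ℂ) (scalarPauli A V c f x) * g x := by
  have hf1 : ContDiff ℝ 1 f := hf.of_le one_le_two
  have hPg : ContDiff ℝ 1 (momentum A c g) := momentum_contDiff hA hg (by norm_num)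
  have hPf : ContDiff ℝ 1 (momentum A c f) := momentum_contDiff hA hf (by norm_num)
  have hPPg : Continuous (momentum A (-c) (momentum A c g)) :=
    (momentum_contDiff (n := 0) (hA.of_le zero_le_one) hPg (by simp)).continuous
  have hPPf : Continuous (momentum A (-c) (momentum A c f)) :=
    (momentum_contDiff (n := 0) (hA.of_le zero_le_one) hPf (by simp)).continuous
  have hVc : Continuous (fun x => (V x : ℂ)) := Complex.continuous_ofReal.comp hV
  have hs : Continuous (starRingEnd ℂ : ℂ → ℂ) := Complex.continuous_conj
  have hfsc : HasCompactSupport (fun x => (starRingEnd ℂ) (f x)) :=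
    hfc.comp_left (g := starRingEnd ℂ) (map_zero _)
  have hPfc : HasCompactSupport (momentum A c f) := momentum_hasCompactSupport hfc
  have hPPfc : HasCompactSupport (fun x => (starRingEnd ℂ) (momentum A (-c) (momentum A c f) x)) :=
    (momentum_hasCompactSupport hPfc).comp_left (g := starRingEnd ℂ) (map_zero _)
  have iV : Integrable (fun x => (starRingEnd ℂ) (f x) * ((V x : ℂ) * g x)) :=
    ((hs.comp hf.continuous).mul (hVc.mul hg.continuous)).integrable_of_hasCompactSupport
      hfsc.mul_right
  have i1 : Integrable (fun x => (starRingEnd ℂ) (f x) * momentum A (-c) (momentum A c g) x) :=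
    ((hs.comp hf.continuous).mul hPPg).integrable_of_hasCompactSupport hfsc.mul_right
  have i2 : Integrable (fun x => (starRingEnd ℂ) (momentum A (-c) (momentum A c f) x) * g x) :=
    ((hs.comp hPPf).mul hg.continuous).integrable_of_hasCompactSupport hPPfc.mul_right
  have k1 := integral_conj_mul_momentum hA.continuous hc hf1 hPg hfc
  have k2 := integral_conj_mul_momentum hA.continuous (c := -c) (by simp [hc]) hPf
    (hg.of_le one_le_two) hPfc
  rw [neg_neg] at k2
  calc ∫ x, (starRingEnd ℂ) (f x) * scalarPauli A V c g x
      = ∫ x, ((starRingEnd ℂ) (f x) * momentum A (-c) (momentum A c g) x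
          + (starRingEnd ℂ) (f x) * ((V x : ℂ) * g x)) := by
        refine integral_congr_ae (Eventually.of_forall fun x => ?_)
        simp only [scalarPauli]; ring
    _ = ∫ x, ((starRingEnd ℂ) (momentum A (-c) (momentum A c f) x) * g x
          + (starRingEnd ℂ) (f x) * ((V x : ℂ) * g x)) := by
        rw [integral_add i1 iV, integral_add i2 iV, k1, k2]
    _ = _ := by
        refine integral_congr_ae (Eventually.of_forall fun x => ?_)
        simp only [scalarPauli, map_add, map_mul, Complex.conj_ofReal]
        ring

end IntegrationByParts

section Components

theorem fderiv_spinor_apply {φ : Plane → Spinor} {x : Plane} (hφ : DifferentiableAt ℝ φ x)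
    (v : Plane) (j : Fin 2) : (fderiv ℝ φ x v) j = fderiv ℝ (fun y => φ y j) x v := by
  have h : HasFDerivAt (fun y => φ y j)
      (((EuclideanSpace.proj j : Spinor →L[ℂ] ℂ).restrictScalars ℝ).comp (fderiv ℝ φ x)) x :=
    ((EuclideanSpace.proj j : Spinor →L[ℂ] ℂ).restrictScalars ℝ).hasFDerivAt.comp x
      hφ.hasFDerivAt
  rw [h.fderiv]
  rfl

theorem toEuclideanCLM_apply (M : Matrix (Fin 2) (Fin 2) ℂ) (v : Spinor) (j : Fin 2) :
    Matrix.toEuclideanCLM (𝕜 := ℂ) M v j = M j 0 * v 0 + M j 1 * v 1 := by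
  rw [Matrix.ofLp_toEuclideanCLM]
  simp [Matrix.mulVec, dotProduct, Fin.sum_univ_two]

theorem diracExpr_apply_zero {A : Plane → Plane} {φ : Plane → Spinor} {x : Plane}
    (hφ : DifferentiableAt ℝ φ x) :
    diracExpr A φ x 0 = momentum A (-I) (fun y => φ y 1) x := by
  simp [diracExpr, pauliSigma₁, pauliSigma₂, kineticMomentum, toEuclideanCLM_apply, momentum,
    wirtinger, complexPotential, fderiv_spinor_apply hφ]
  ring

theorem diracExpr_apply_one {A : Plane → Plane} {φ : Plane → Spinor} {x : Plane}
    (hφ : DifferentiableAt ℝ φ x) :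
    diracExpr A φ x 1 = momentum A I (fun y => φ y 0) x := by
  simp [diracExpr, pauliSigma₁, pauliSigma₂, kineticMomentum, toEuclideanCLM_apply, momentum,
    wirtinger, complexPotential, fderiv_spinor_apply hφ]
  ring

/-- Both Pauli matrices are off-diagonal, so the Dirac expression swaps the spin components and its
square is diagonal. This reduces everything to scalar operators. -/
theorem pauliExpr_apply {A : Plane → Plane} {V : Plane → ℝ} (hA : ContDiff ℝ 1 A)
    {φ : Plane → Spinor} (hφ : ContDiff ℝ 2 φ) (x : Plane) (j : Fin 2) :
    pauliExpr A V φ x j = scalarPauli A V (spinUnit j) (fun y => φ y j) x := by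
  have h1 : ∀ y, DifferentiableAt ℝ φ y := fun y => hφ.differentiable two_ne_zero y
  have h2 : DifferentiableAt ℝ (diracExpr A φ) x :=
    (diracExpr_contDiff (n := 1) hA hφ (by norm_num)).differentiable one_ne_zero x
  fin_cases j
  · have : (fun y => diracExpr A φ y 1) = momentum A I (fun y => φ y 0) :=
      funext fun y => diracExpr_apply_one (h1 y)
    simp [pauliExpr, diracExpr_apply_zero h2, this, scalarPauli, spinUnit]
  · have : (fun y => diracExpr A φ y 0) = momentum A (-I) (fun y => φ y 1) :=
      funext fun y => diracExpr_apply_zero (h1 y)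
    simp [pauliExpr, diracExpr_apply_one h2, this, scalarPauli, spinUnit]

end Components

end ScalarCalculus

/-! ### `L²` norms and Young's inequality -/

noncomputable section L2Estimates

open Complex (I)
open scoped ENNReal

/-- The `L²` norm of a function on the plane. -/
def l2norm {F : Type*} [NormedAddCommGroup F] (f : Plane → F) : ℝ :=
  (eLpNorm f 2 (volume : Measure Plane)).toReal

section Norm

variable {F : Type*} [NormedAddCommGroup F] {f g : Plane → F}

theorem l2norm_nonneg (f : Plane → F) : 0 ≤ l2norm f := ENNReal.toReal_nonneg

theorem l2norm_add_le (hf : MemLp f 2 volume) (hg : MemLp g 2 volume) :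
    l2norm (fun x => f x + g x) ≤ l2norm f + l2norm g := by
  rw [l2norm, l2norm, l2norm, ← ENNReal.toReal_add hf.eLpNorm_ne_top hg.eLpNorm_ne_top]
  exact ENNReal.toReal_mono (ENNReal.add_ne_top.2 ⟨hf.eLpNorm_ne_top, hg.eLpNorm_ne_top⟩)
    (eLpNorm_add_le hf.1 hg.1 one_le_two)

theorem l2norm_sub_le (hf : MemLp f 2 volume) (hg : MemLp g 2 volume) :
    l2norm (fun x => f x - g x) ≤ l2norm f + l2norm g := by
  rw [l2norm, l2norm, l2norm, ← ENNReal.toReal_add hf.eLpNorm_ne_top hg.eLpNorm_ne_top]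
  exact ENNReal.toReal_mono (ENNReal.add_ne_top.2 ⟨hf.eLpNorm_ne_top, hg.eLpNorm_ne_top⟩)
    (eLpNorm_sub_le hf.1 hg.1 one_le_two)

theorem l2norm_mono {F' : Type*} [NormedAddCommGroup F'] {h : Plane → F'} (hf : MemLp h 2 volume)
    (hle : ∀ x, ‖f x‖ ≤ ‖h x‖) : l2norm f ≤ l2norm h :=
  ENNReal.toReal_mono hf.eLpNorm_ne_top (eLpNorm_mono hle)

theorem l2norm_norm (f : Plane → F) : l2norm (fun x => ‖f x‖) = l2norm f := by
  rw [l2norm, l2norm, eLpNorm_norm]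

theorem l2norm_const_mul (a : ℝ) (f : Plane → ℝ) :
    l2norm (fun x => a * f x) = |a| * l2norm f := by
  have := eLpNorm_const_smul a f 2 (volume : Measure Plane)
  rw [l2norm, l2norm]
  have h2 : (fun x => a * f x) = a • f := rfl
  rw [h2, this, ENNReal.toReal_mul]
  simp

theorem l2norm_le_mul {F' : Type*} [NormedAddCommGroup F'] {h : Plane → F'} {a : ℝ} (ha : 0 ≤ a)
    (hf : MemLp h 2 volume) (hle : ∀ x, ‖f x‖ ≤ a * ‖h x‖) : l2norm f ≤ a * l2norm h := by
  have h1 : l2norm f ≤ l2norm (fun x => a * ‖h x‖) := by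
    refine l2norm_mono (hf.norm.const_mul a) fun x => ?_
    rw [Real.norm_of_nonneg (by positivity)]
    exact hle x
  rwa [l2norm_const_mul, abs_of_nonneg ha, l2norm_norm] at h1

theorem l2norm_sq (hf : MemLp f 2 volume) : l2norm f ^ 2 = ∫ x, ‖f x‖ ^ 2 := by
  have h := hf.eLpNorm_eq_integral_rpow_norm two_ne_zero ENNReal.ofNat_ne_top
  have h0 : 0 ≤ ∫ x, ‖f x‖ ^ 2 := integral_nonneg fun x => by positivity
  have h3 : l2norm f = (∫ x, ‖f x‖ ^ 2) ^ (1 / 2 : ℝ) := by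
    rw [l2norm, h]
    simp only [ENNReal.toReal_ofNat, Real.rpow_ofNat]
    rw [ENNReal.toReal_ofReal (by positivity)]
    norm_num
  rw [h3, ← Real.sqrt_eq_rpow, Real.sq_sqrt h0]

theorem l2norm_toLp (hf : MemLp f 2 volume) : ‖hf.toLp f‖ = l2norm f := Lp.norm_toLp f hf

theorem norm_integral_conj_mul_le {f g : Plane → ℂ} (hf : MemLp f 2 volume)
    (hg : MemLp g 2 volume) :
    ‖∫ x, (starRingEnd ℂ) (f x) * g x‖ ≤ l2norm f * l2norm g := by
  have h := norm_inner_le_norm (𝕜 := ℂ) (hf.toLp f) (hg.toLp g)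
  rw [l2norm_toLp, l2norm_toLp, L2.inner_def] at h
  have e : ∫ x, (starRingEnd ℂ) (f x) * g x = ∫ x, inner ℂ (hf.toLp f x) (hg.toLp g x) := by
    refine integral_congr_ae ?_
    filter_upwards [hf.coeFn_toLp, hg.coeFn_toLp] with x h1 h2
    rw [h1, h2]
    simp [mul_comm]
  rwa [e]

theorem integrable_conj_mul {f g : Plane → ℂ} (hf : MemLp f 2 volume) (hg : MemLp g 2 volume) :
    Integrable (fun x => (starRingEnd ℂ) (f x) * g x) := by
  have hfs : MemLp (fun x => (starRingEnd ℂ) (f x)) 2 volume :=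
    hf.of_le (Complex.continuous_conj.comp_aestronglyMeasurable hf.1)
      (Eventually.of_forall fun x => by simp)
  exact MemLp.integrable_mul (p := 2) (q := 2) hfs hg

/-- Dominated convergence for `‖f‖²`, as every point eventually leaves the sets. -/
theorem tendsto_l2norm_indicator {s : ℕ → Set Plane} (hm : ∀ n, MeasurableSet (s n))
    (hs : ∀ x, ∀ᶠ n in atTop, x ∉ s n) (hf : MemLp f 2 volume) :
    Tendsto (fun n => l2norm ((s n).indicator f)) atTop (𝓝 0) := by
  have h2 : Integrable (fun x => ‖f x‖ ^ 2) := hf.norm.integrable_sq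
  have h3 : Tendsto (fun n => ∫ x, ‖(s n).indicator f x‖ ^ 2) atTop (𝓝 0) := by
    rw [← integral_zero Plane ℝ (μ := volume)]
    refine tendsto_integral_of_dominated_convergence (fun x => ‖f x‖ ^ 2) (fun n => ?_) h2
      (fun n => Eventually.of_forall fun x => ?_) (Eventually.of_forall fun x => ?_)
    · exact (hf.1.indicator (hm n)).norm.pow 2
    · rw [Real.norm_of_nonneg (by positivity)]
      exact pow_le_pow_left₀ (norm_nonneg _) (norm_indicator_le_norm_self _ _) 2
    · refine tendsto_const_nhds.congr' ?_
      filter_upwards [hs x] with n hn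
      rw [Set.indicator_of_notMem hn]
      simp
  have h5 : (fun n => l2norm ((s n).indicator f))
      = fun n => Real.sqrt (∫ x, ‖(s n).indicator f x‖ ^ 2) := by
    funext n
    have hi : MemLp ((s n).indicator f) 2 volume := MemLp.indicator (hm n) hf
    have h6 := l2norm_sq (f := (s n).indicator f) hi
    exact ((congrArg Real.sqrt h6).symm.trans (Real.sqrt_sq (l2norm_nonneg _))).symm
  rw [h5, ← Real.sqrt_zero]
  refine (Real.continuous_sqrt.tendsto 0).comp h3

end Norm

section Young

theorem lintegral_mul_sq_le {X : Type*} [MeasurableSpace X] {μ : Measure X} {a b : X → ℝ≥0∞}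
    (ha : AEMeasurable a μ) (hb : AEMeasurable b μ) :
    (∫⁻ x, a x * b x ∂μ) ^ 2 ≤ (∫⁻ x, a x ^ 2 ∂μ) * ∫⁻ x, b x ^ 2 ∂μ := by
  have h := ENNReal.lintegral_mul_le_Lp_mul_Lq μ Real.HolderConjugate.two_two ha hb
  simp only [ENNReal.rpow_two, Pi.mul_apply] at h
  calc (∫⁻ x, a x * b x ∂μ) ^ 2
      ≤ ((∫⁻ x, a x ^ 2 ∂μ) ^ (1 / 2 : ℝ) * (∫⁻ x, b x ^ 2 ∂μ) ^ (1 / 2 : ℝ)) ^ 2 := by gcongr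
    _ = _ := by
      rw [mul_pow, ← ENNReal.rpow_two, ← ENNReal.rpow_two, ← ENNReal.rpow_mul, ← ENNReal.rpow_mul]
      norm_num

/-- Young's inequality `L¹ * L² → L²`: Cauchy–Schwarz for the splitting `k = √k · √k`, then Tonelli
and translation invariance. With extended nonnegative integrals no integrability has to be
discussed. -/
theorem lintegral_convolution_sq_le {k h : Plane → ℝ≥0∞} (hk : Measurable k)
    (hh : AEMeasurable h volume) :
    ∫⁻ x, (∫⁻ y, k (x - y) * h y) ^ 2 ≤ (∫⁻ x, k x) ^ 2 * ∫⁻ x, h x ^ 2 := by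
  have hk' : ∀ x : Plane, Measurable fun y => k (x - y) := fun x =>
    hk.comp (measurable_const.sub measurable_id)
  have h1 : ∀ x : Plane, (∫⁻ y, k (x - y) * h y) ^ 2
      ≤ (∫⁻ x, k x) * ∫⁻ y, k (x - y) * h y ^ 2 := by
    intro x
    have hs : ∀ t : ℝ≥0∞, (t ^ (1 / 2 : ℝ)) ^ 2 = t := fun t => by
      rw [← ENNReal.rpow_two, ← ENNReal.rpow_mul]; norm_num
    have e1 : ∫⁻ y, k (x - y) * h y
        = ∫⁻ y, (k (x - y)) ^ (1 / 2 : ℝ) * ((k (x - y)) ^ (1 / 2 : ℝ) * h y) := by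
      refine lintegral_congr fun y => ?_
      rw [← mul_assoc, ← sq, hs]
    have h2 := lintegral_mul_sq_le (μ := (volume : Measure Plane))
      ((hk' x).pow_const (1 / 2 : ℝ)).aemeasurable
      (((hk' x).pow_const (1 / 2 : ℝ)).aemeasurable.mul hh)
    rw [e1]
    refine h2.trans (le_of_eq ?_)
    simp only [hs, mul_pow, Pi.mul_apply]
    rw [lintegral_sub_left_eq_self (fun y => k y) x]
  have hm : AEMeasurable (Function.uncurry fun x y : Plane => k (x - y) * h y ^ 2)
      (volume.prod volume) := by
    refine AEMeasurable.mul ?_ ?_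
    · exact (hk.comp (measurable_fst.sub measurable_snd)).aemeasurable
    · exact (hh.pow_const 2).comp_quasiMeasurePreserving Measure.quasiMeasurePreserving_snd
  calc ∫⁻ x, (∫⁻ y, k (x - y) * h y) ^ 2
      ≤ ∫⁻ x, (∫⁻ x, k x) * ∫⁻ y, k (x - y) * h y ^ 2 := lintegral_mono h1
    _ = (∫⁻ x, k x) * ∫⁻ x, ∫⁻ y, k (x - y) * h y ^ 2 := by
      exact lintegral_const_mul'' _ hm.lintegral_prod_right'
    _ = (∫⁻ x, k x) * ∫⁻ y, ∫⁻ x, k (x - y) * h y ^ 2 := by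
      rw [lintegral_lintegral_swap hm]
    _ = (∫⁻ x, k x) * ∫⁻ y, (∫⁻ x, k x) * h y ^ 2 := by
      congr 1
      refine lintegral_congr fun y => ?_
      have hky : Measurable fun x => k (x - y) := hk.comp (measurable_id.sub measurable_const)
      rw [lintegral_mul_const _ hky,
        lintegral_sub_right_eq_self (fun x => k x) y]
    _ = _ := by
      rw [lintegral_const_mul'' _ (hh.pow_const 2)]
      ring

/-- A function dominated by the convolution of `k` with `|f|` has `L²` norm at most
`‖k‖₁ ‖f‖₂`. -/
theorem l2norm_le_of_le_convolution {F F' : Type*} [NormedAddCommGroup F] [NormedAddCommGroup F']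
    {k : Plane → ℝ} (hk : Integrable k) (hkm : Measurable k) (hk0 : ∀ x, 0 ≤ k x)
    {f : Plane → F} (hf : MemLp f 2 volume) {g : Plane → F'}
    (hg : ∀ x, ‖g x‖ₑ ≤ ∫⁻ y, ENNReal.ofReal (k (x - y)) * ‖f y‖ₑ) :
    eLpNorm g 2 volume ≤ ENNReal.ofReal (∫ x, k x) * eLpNorm f 2 volume := by
  have hform : ∀ {G : Type _} [NormedAddCommGroup G] (u : Plane → G),
      eLpNorm u 2 volume = (∫⁻ x, ‖u x‖ₑ ^ 2) ^ (1 / 2 : ℝ) := by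
    intro G _ u
    rw [eLpNorm_eq_lintegral_rpow_enorm_toReal two_ne_zero ENNReal.ofNat_ne_top]
    simp
  have h1 := lintegral_convolution_sq_le (h := fun x => ‖f x‖ₑ) hkm.ennreal_ofReal hf.1.enorm
  rw [hform g, eLpNorm_eq_lintegral_rpow_enorm_toReal two_ne_zero ENNReal.ofNat_ne_top,
    ofReal_integral_eq_lintegral_ofReal hk (Eventually.of_forall hk0)]
  simp only [ENNReal.toReal_ofNat, ENNReal.rpow_two]
  calc (∫⁻ x, ‖g x‖ₑ ^ 2) ^ (1 / 2 : ℝ)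
      ≤ ((∫⁻ x, ENNReal.ofReal (k x)) ^ 2 * ∫⁻ x, ‖f x‖ₑ ^ 2) ^ (1 / 2 : ℝ) := by
        gcongr
        refine (lintegral_mono fun x => ?_).trans h1
        gcongr
        exact hg x
    _ = _ := by
      rw [ENNReal.mul_rpow_of_nonneg _ _ (by norm_num), ← ENNReal.rpow_two, ← ENNReal.rpow_mul]
      norm_num

end Young

end L2Estimates

/-! ### Convolution with mollifiers -/

noncomputable section Mollification

open Complex (I)
open scoped ENNReal

/-- The convolution of complex functions on the plane. -/
def smoothing (k f : Plane → ℂ) : Plane → ℂ :=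
  convolution k f (ContinuousLinearMap.mul ℝ ℂ) volume

section Smoothing

variable {k f : Plane → ℂ}

theorem smoothing_eq (k f : Plane → ℂ) (x : Plane) : smoothing k f x = ∫ y, k (x - y) * f y := by
  rw [smoothing, convolution_eq_swap]
  rfl

theorem smoothing_contDiff (hk : ContDiff ℝ ∞ k) (hkc : HasCompactSupport k)
    (hf : LocallyIntegrable f volume) : ContDiff ℝ ∞ (smoothing k f) :=
  hkc.contDiff_convolution_left (n := ⊤) _ hk hf

theorem smoothing_integrable (hk : Continuous k) (hkc : HasCompactSupport k)
    (hf : LocallyIntegrable f volume) (x : Plane) : Integrable fun y => k (x - y) * f y :=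
  (hkc.convolutionExists_left (ContinuousLinearMap.mul ℝ ℂ) hk hf x).integrable_swap

theorem fderiv_smoothing_left (hk : ContDiff ℝ 1 k) (hkc : HasCompactSupport k)
    (hf : LocallyIntegrable f volume) (x v : Plane) :
    fderiv ℝ (smoothing k f) x v = smoothing (fun y => fderiv ℝ k y v) f x := by
  have h := hkc.hasFDerivAt_convolution_left (ContinuousLinearMap.mul ℝ ℂ) hk hf x
  have h2 : fderiv ℝ (smoothing k f) x
      = convolution (fderiv ℝ k) f ((ContinuousLinearMap.mul ℝ ℂ).precompL Plane) volume x :=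
    h.fderiv
  rw [h2]
  have hi := (((hkc.fderiv ℝ).convolutionExists_left
    ((ContinuousLinearMap.mul ℝ ℂ).precompL Plane) (hk.continuous_fderiv one_ne_zero) hf x))
  rw [convolution_def, smoothing, convolution_def, ContinuousLinearMap.integral_apply hi]
  rfl

theorem wirtinger_smoothing_left {c : ℂ} (hk : ContDiff ℝ 1 k) (hkc : HasCompactSupport k)
    (hf : LocallyIntegrable f volume) :
    wirtinger c (smoothing k f) = smoothing (wirtinger c k) f := by
  funext x
  have hc : ∀ v : Plane, Continuous (fun y => fderiv ℝ k y v) := fun v =>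
    (hk.continuous_fderiv one_ne_zero).clm_apply continuous_const
  have hi : ∀ v, Integrable fun y => fderiv ℝ k (x - y) v * f y := fun v =>
    smoothing_integrable (hc v) (hkc.fderiv_apply ℝ v) hf x
  rw [wirtinger, fderiv_smoothing_left hk hkc hf, fderiv_smoothing_left hk hkc hf, smoothing_eq,
    smoothing_eq, smoothing_eq, ← integral_const_mul, ← integral_add (hi _) ((hi _).const_mul c)]
  refine integral_congr_ae (Eventually.of_forall fun y => ?_)
  simp only [wirtinger]; ring

theorem smoothing_comm (k f : Plane → ℂ) : smoothing k f = smoothing f k := by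
  funext x
  rw [smoothing_eq, smoothing, convolution_def]
  exact integral_congr_ae (Eventually.of_forall fun y => mul_comm _ _)

/-- Convolution is commutative, so a derivative may be placed on either factor that is `C¹` with
compact support. -/
theorem wirtinger_smoothing_right {c : ℂ} (hf : ContDiff ℝ 1 f) (hfc : HasCompactSupport f)
    (hk : Continuous k) : wirtinger c (smoothing k f) = smoothing k (wirtinger c f) := by
  rw [smoothing_comm, wirtinger_smoothing_left hf hfc hk.locallyIntegrable, smoothing_comm]

theorem smoothing_hasCompactSupport (hk : HasCompactSupport k) (hf : HasCompactSupport f) :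
    HasCompactSupport (smoothing k f) := hk.convolution _ hf

theorem enorm_smoothing_le (k f : Plane → ℂ) (x : Plane) :
    ‖smoothing k f x‖ₑ ≤ ∫⁻ y, ENNReal.ofReal ‖k (x - y)‖ * ‖f y‖ₑ := by
  rw [smoothing_eq]
  refine (enorm_integral_le_lintegral_enorm _).trans (le_of_eq ?_)
  refine lintegral_congr fun y => ?_
  rw [enorm_mul, ofReal_norm]

end Smoothing

section Mollifier

/-- A fixed smooth bump function, supported in the unit ball. -/
def planeBump : ContDiffBump (0 : Plane) := ⟨1 / 2, 1, by norm_num, by norm_num⟩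

/-- The bump function normalised to integral one, as a complex function. -/
def unitMollifier (x : Plane) : ℂ := (planeBump.normed volume x : ℂ)

/-- Mollifiers with support in the ball of radius `1 / (n + 1)`. -/
def mollifier (n : ℕ) (x : Plane) : ℂ := ((n : ℂ) + 1) ^ 2 * unitMollifier (((n : ℝ) + 1) • x)

theorem unitMollifier_contDiff : ContDiff ℝ ∞ unitMollifier :=
  Complex.ofRealCLM.contDiff.comp planeBump.contDiff_normed

theorem unitMollifier_hasCompactSupport : HasCompactSupport unitMollifier :=
  planeBump.hasCompactSupport_normed.comp_left (g := ((↑) : ℝ → ℂ)) Complex.ofReal_zero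

theorem mollifier_contDiff (n : ℕ) : ContDiff ℝ ∞ (mollifier n) :=
  contDiff_const.mul (unitMollifier_contDiff.comp (contDiff_id.const_smul ((n : ℝ) + 1)))

theorem mollifier_hasCompactSupport (n : ℕ) : HasCompactSupport (mollifier n) :=
  (unitMollifier_hasCompactSupport.comp_smul (by positivity : (n : ℝ) + 1 ≠ 0)).mul_left
    (f := fun _ => ((n : ℂ) + 1) ^ 2)

theorem conj_mollifier (n : ℕ) (x : Plane) : (starRingEnd ℂ) (mollifier n x) = mollifier n x := by
  simp [mollifier, unitMollifier]

theorem mollifier_eq_zero {n : ℕ} {x : Plane} (hx : 1 / ((n : ℝ) + 1) ≤ ‖x‖) :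
    mollifier n x = 0 := by
  have h1 : ((n : ℝ) + 1) • x ∉ Function.support (planeBump.normed volume) := by
    rw [planeBump.support_normed_eq]
    simp only [Metric.mem_ball, dist_zero_right, norm_smul, not_lt, planeBump]
    rw [Real.norm_of_nonneg (by positivity)]
    rwa [div_le_iff₀' (by positivity)] at hx
  rw [Function.notMem_support] at h1
  rw [mollifier, unitMollifier, h1]
  simp

theorem norm_mollifier (n : ℕ) (x : Plane) :
    ‖mollifier n x‖ = ((n : ℝ) + 1) ^ 2 * planeBump.normed volume (((n : ℝ) + 1) • x) := by
  rw [mollifier, unitMollifier, norm_mul, Complex.norm_real,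
    Real.norm_of_nonneg (planeBump.nonneg_normed _), norm_pow]
  congr 2
  exact_mod_cast Complex.norm_natCast (n + 1)

theorem mollifier_eq_norm (n : ℕ) (x : Plane) : mollifier n x = (‖mollifier n x‖ : ℂ) := by
  rw [norm_mollifier, mollifier, unitMollifier]
  push_cast
  rfl

theorem integral_comp_scale (n : ℕ) (f : Plane → ℝ) :
    ∫ x, ((n : ℝ) + 1) ^ 2 * f (((n : ℝ) + 1) • x) = ∫ x, f x := by
  rw [integral_const_mul, Measure.integral_comp_smul, finrank_euclideanSpace, Fintype.card_fin,
    smul_eq_mul, ← mul_assoc, abs_of_nonneg (by positivity), mul_inv_cancel₀ (by positivity),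
    one_mul]

theorem integral_norm_mollifier (n : ℕ) : ∫ x, ‖mollifier n x‖ = 1 := by
  simp only [norm_mollifier]
  rw [integral_comp_scale, planeBump.integral_normed]

theorem integral_mollifier (n : ℕ) : ∫ x, mollifier n x = 1 := by
  have : ∫ x, mollifier n x = ∫ x, ((‖mollifier n x‖ : ℝ) : ℂ) :=
    integral_congr_ae (Eventually.of_forall fun x => mollifier_eq_norm n x)
  rw [this, integral_complex_ofReal, integral_norm_mollifier]
  simp

/-- The first moment of the gradient of the unit mollifier. -/
def mollifierMoment : ℝ := ∫ x : Plane, ‖x‖ * ‖fderiv ℝ unitMollifier x‖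

theorem fderiv_mollifier (n : ℕ) (x : Plane) :
    ‖x‖ * ‖fderiv ℝ (mollifier n) x‖ = ((n : ℝ) + 1) ^ 2 *
      (‖((n : ℝ) + 1) • x‖ * ‖fderiv ℝ unitMollifier (((n : ℝ) + 1) • x)‖) := by
  have h1 : HasFDerivAt (fun x : Plane => ((n : ℝ) + 1) • x)
      (((n : ℝ) + 1) • ContinuousLinearMap.id ℝ Plane) x :=
    (((n : ℝ) + 1) • ContinuousLinearMap.id ℝ Plane).hasFDerivAt
  have h2 := (unitMollifier_contDiff.differentiable (by simp)
    (((n : ℝ) + 1) • x)).hasFDerivAt.comp x h1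
  have h3 := h2.const_mul (((n : ℂ) + 1) ^ 2)
  have h4 : fderiv ℝ (mollifier n) x = _ := h3.fderiv
  rw [h4, norm_smul, ContinuousLinearMap.comp_smul, ContinuousLinearMap.comp_id, norm_smul,
    norm_smul, norm_pow]
  have : ‖(n : ℂ) + 1‖ = (n : ℝ) + 1 := by exact_mod_cast Complex.norm_natCast (n + 1)
  rw [this, Real.norm_of_nonneg (by positivity)]
  ring

/-- The gradient gains a factor `n + 1` and the weight `‖x‖` loses it, so the moment does not depend
on `n`. This is what keeps commutators of mollification with Lipschitz first order coefficients
bounded. -/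
theorem integral_norm_mul_fderiv_mollifier (n : ℕ) :
    ∫ x, ‖x‖ * ‖fderiv ℝ (mollifier n) x‖ = mollifierMoment := by
  simp only [fderiv_mollifier]
  exact integral_comp_scale n fun x => ‖x‖ * ‖fderiv ℝ unitMollifier x‖

theorem eLpNorm_smoothing_mollifier_le (n : ℕ) {f : Plane → ℂ} (hf : MemLp f 2 volume) :
    eLpNorm (smoothing (mollifier n) f) 2 volume ≤ eLpNorm f 2 volume := by
  have hk : Continuous (mollifier n) := (mollifier_contDiff n).continuous
  have h := l2norm_le_of_le_convolution (k := fun x => ‖mollifier n x‖)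
    (hk.norm.integrable_of_hasCompactSupport (mollifier_hasCompactSupport n).norm)
    hk.norm.measurable (fun x => norm_nonneg _) hf (enorm_smoothing_le (mollifier n) f)
  rwa [integral_norm_mollifier, ENNReal.ofReal_one, one_mul] at h

theorem memLp_smoothing_mollifier (n : ℕ) {f : Plane → ℂ} (hf : MemLp f 2 volume) :
    MemLp (smoothing (mollifier n) f) 2 volume :=
  ⟨(smoothing_contDiff (mollifier_contDiff n) (mollifier_hasCompactSupport n)
    (hf.locallyIntegrable one_le_two)).continuous.aestronglyMeasurable,
    (eLpNorm_smoothing_mollifier_le n hf).trans_lt hf.2⟩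

theorem l2norm_smoothing_mollifier_le (n : ℕ) {f : Plane → ℂ} (hf : MemLp f 2 volume) :
    l2norm (smoothing (mollifier n) f) ≤ l2norm f :=
  ENNReal.toReal_mono hf.eLpNorm_ne_top (eLpNorm_smoothing_mollifier_le n hf)

theorem smoothing_sub {k f g : Plane → ℂ} (hk : Continuous k) (hkc : HasCompactSupport k)
    (hf : LocallyIntegrable f volume) (hg : LocallyIntegrable g volume) :
    smoothing k (fun x => f x - g x) = fun x => smoothing k f x - smoothing k g x := by
  funext x
  rw [smoothing_eq, smoothing_eq, smoothing_eq,
    ← integral_sub (smoothing_integrable hk hkc hf x) (smoothing_integrable hk hkc hg x)]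
  exact integral_congr_ae (Eventually.of_forall fun y => mul_sub _ _ _)

/-- Uniform approximation of uniformly continuous functions. -/
theorem norm_smoothing_mollifier_sub_le {f : Plane → ℂ} (hf : Continuous f) {n : ℕ} {δ : ℝ}
    {x : Plane} (h : ∀ y, ‖x - y‖ < 1 / ((n : ℝ) + 1) → ‖f y - f x‖ ≤ δ) :
    ‖smoothing (mollifier n) f x - f x‖ ≤ δ := by
  have hk : Continuous (mollifier n) := (mollifier_contDiff n).continuous
  have hkc := mollifier_hasCompactSupport n
  have hki : Integrable fun y => mollifier n (x - y) :=
    (hk.integrable_of_hasCompactSupport hkc).comp_sub_left x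
  have e : smoothing (mollifier n) f x - f x = ∫ y, mollifier n (x - y) * (f y - f x) := by
    have e1 : f x = ∫ y, mollifier n (x - y) * f x := by
      rw [integral_mul_const, integral_sub_left_eq_self (mollifier n) volume x,
        integral_mollifier, one_mul]
    conv_lhs => rw [smoothing_eq, e1]
    rw [← integral_sub (smoothing_integrable hk hkc hf.locallyIntegrable x) (hki.mul_const _)]
    exact integral_congr_ae (Eventually.of_forall fun y => (mul_sub _ _ _).symm)
  have e2 : ∫ y, ‖mollifier n (x - y)‖ * δ = δ := by
    rw [integral_mul_const, integral_sub_left_eq_self (fun y => ‖mollifier n y‖) volume x,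
      integral_norm_mollifier, one_mul]
  rw [e, ← e2]
  refine norm_integral_le_of_norm_le (hki.norm.mul_const _) (Eventually.of_forall fun y => ?_)
  rw [norm_mul]
  by_cases hy : ‖x - y‖ < 1 / ((n : ℝ) + 1)
  · gcongr
    exact h y hy
  · rw [mollifier_eq_zero (not_lt.1 hy), norm_zero, zero_mul, zero_mul]

theorem tendsto_smoothing_of_continuous {f : Plane → ℂ} (hf : Continuous f)
    (hfc : HasCompactSupport f) :
    Tendsto (fun n => l2norm fun x => smoothing (mollifier n) f x - f x) atTop (𝓝 0) := by
  obtain ⟨R, hR⟩ := hfc.isCompact.isBounded.subset_closedBall (0 : Plane)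
  have huc : UniformContinuous f := hfc.uniformContinuous_of_continuous hf
  -- The mollifiers have radius at most `1`, so all mollifications of `f` vanish off this ball, and
  -- uniform convergence gives `L²` convergence.
  set K := Metric.closedBall (0 : Plane) (R + 1) with hK
  have hKm : MeasurableSet K := Metric.isClosed_closedBall.measurableSet
  have hKfin : volume K ≠ ⊤ := (isCompact_closedBall (0 : Plane) (R + 1)).measure_lt_top.ne
  have hind : MemLp (K.indicator fun _ => (1 : ℝ)) 2 volume :=
    memLp_indicator_const 2 hKm 1 (Or.inr hKfin)
  set m := l2norm (K.indicator fun _ => (1 : ℝ)) with hm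
  have hm0 : 0 ≤ m := l2norm_nonneg _
  rw [Metric.tendsto_atTop]
  intro ε hε
  obtain ⟨δ, hδ, hδf⟩ := Metric.uniformContinuous_iff.1 huc (ε / (2 * (m + 1))) (by positivity)
  obtain ⟨N, hN⟩ := exists_nat_one_div_lt hδ
  refine ⟨N, fun n hn => ?_⟩
  have hnδ : 1 / ((n : ℝ) + 1) < δ := lt_of_le_of_lt (by gcongr) hN
  have h1n : 1 / ((n : ℝ) + 1) ≤ 1 := by
    rw [div_le_one (by positivity)]
    have : (0 : ℝ) ≤ n := Nat.cast_nonneg n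
    linarith
  have hzero : ∀ y : Plane, R < ‖y‖ → f y = 0 := fun y hy => by
    refine image_eq_zero_of_notMem_tsupport fun h => ?_
    have := hR h
    rw [mem_closedBall_zero_iff] at this
    linarith
  have hpt : ∀ x, ‖smoothing (mollifier n) f x - f x‖
      ≤ ε / (2 * (m + 1)) * ‖K.indicator (fun _ => (1 : ℝ)) x‖ := by
    intro x
    by_cases hx : x ∈ K
    · rw [Set.indicator_of_mem hx, norm_one, mul_one]
      refine norm_smoothing_mollifier_sub_le hf fun y hy => ?_
      have := hδf (a := y) (b := x) (by
        rw [dist_eq_norm, norm_sub_rev]; exact hy.trans hnδ)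
      rw [dist_eq_norm] at this
      exact this.le
    · rw [Set.indicator_of_notMem hx, norm_zero, mul_zero]
      rw [hK, mem_closedBall_zero_iff, not_le] at hx
      refine norm_smoothing_mollifier_sub_le hf fun y hy => ?_
      have hy' : R < ‖y‖ := by
        have := norm_sub_norm_le x y
        linarith
      rw [hzero y hy', hzero x (by linarith)]
      simp
  have h2 := l2norm_le_mul (by positivity) hind hpt
  rw [Real.dist_eq, sub_zero, abs_of_nonneg (l2norm_nonneg _)]
  refine h2.trans_lt ?_
  rw [← hm, div_mul_eq_mul_div, div_lt_iff₀ (by positivity)]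
  nlinarith

/-- Mollification converges in `L²`. -/
theorem tendsto_smoothing {f : Plane → ℂ} (hf : MemLp f 2 volume) :
    Tendsto (fun n => l2norm fun x => smoothing (mollifier n) f x - f x) atTop (𝓝 0) := by
  rw [Metric.tendsto_atTop]
  intro ε hε
  obtain ⟨h, hhc, hh, hle⟩ := hf.exist_eLpNorm_sub_le ENNReal.ofNat_ne_top one_le_two
    (by positivity : 0 < ε / 4)
  have hhm : MemLp h 2 volume := hh.continuous.memLp_of_hasCompactSupport hhc
  have hfh : MemLp (fun x => f x - h x) 2 volume := hf.sub hhm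
  have hle' : l2norm (fun x => f x - h x) ≤ ε / 4 := by
    rw [l2norm]
    exact ENNReal.toReal_le_of_le_ofReal (by positivity) hle
  obtain ⟨N, hN⟩ := Metric.tendsto_atTop.1 (tendsto_smoothing_of_continuous hh.continuous hhc)
    (ε / 4) (by positivity)
  refine ⟨N, fun n hn => ?_⟩
  have h1 := hN n hn
  rw [Real.dist_eq, sub_zero, abs_of_nonneg (l2norm_nonneg _)] at h1 ⊢
  have hk : Continuous (mollifier n) := (mollifier_contDiff n).continuous
  have e : (fun x => smoothing (mollifier n) f x - f x) = fun x =>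
      (smoothing (mollifier n) (fun x => f x - h x) x + (smoothing (mollifier n) h x - h x))
        - (f x - h x) := by
    rw [smoothing_sub hk (mollifier_hasCompactSupport n) (hf.locallyIntegrable one_le_two)
      (hhm.locallyIntegrable one_le_two)]
    funext x
    ring
  have m1 := memLp_smoothing_mollifier n hfh
  have m2 : MemLp (fun x => smoothing (mollifier n) h x - h x) 2 volume :=
    (memLp_smoothing_mollifier n hhm).sub hhm
  have b1 := l2norm_sub_le (m1.add m2) hfh
  have b2 := l2norm_add_le m1 m2
  have b3 := l2norm_smoothing_mollifier_le n hfh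
  rw [e]
  refine b1.trans_lt ?_
  have b2' : l2norm (smoothing (mollifier n) (fun x => f x - h x)
      + fun x => smoothing (mollifier n) h x - h x) ≤ _ := b2
  linarith

end Mollifier

end Mollification

/-! ### Mollified weak solutions: Friedrichs' commutator argument -/

noncomputable section Friedrichs

open Complex (I)
open scoped ENNReal

theorem wirtinger_comp_sub_left {c : ℂ} {f : Plane → ℂ} (hf : Differentiable ℝ f) (x y : Plane) :
    wirtinger c (fun y => f (x - y)) y = -wirtinger c f (x - y) := by
  have h : HasFDerivAt (fun y => f (x - y)) ((fderiv ℝ f (x - y)).comp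
      (-ContinuousLinearMap.id ℝ Plane)) y :=
    (hf (x - y)).hasFDerivAt.comp y ((hasFDerivAt_id y).const_sub x)
  simp only [wirtinger, h.fderiv]
  simp
  ring

theorem fderiv_mollifier_eq_zero {n : ℕ} {v : Plane} (hv : 1 < ‖v‖) :
    fderiv ℝ (mollifier n) v = 0 := by
  have h : mollifier n =ᶠ[𝓝 v] fun _ => 0 := by
    filter_upwards [(isOpen_lt continuous_const continuous_norm).mem_nhds hv] with w hw
    refine mollifier_eq_zero (le_trans ?_ (le_of_lt hw))
    rw [div_le_one (by positivity)]
    have : (0 : ℝ) ≤ n := Nat.cast_nonneg n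
    linarith
  rw [h.fderiv_eq]
  simp

variable {A : Plane → Plane} {V : Plane → ℝ} {c z : ℂ} {g : Plane → ℂ}

/-- `g` solves `((π₁ - c π₂) (π₁ + c π₂) + V - z̄) g = 0` in the sense of distributions. -/
def IsWeakSolution (A : Plane → Plane) (V : Plane → ℝ) (c z : ℂ) (g : Plane → ℂ) : Prop :=
  ∀ φ : Plane → ℂ, ContDiff ℝ ∞ φ → HasCompactSupport φ →
    ∫ x, (starRingEnd ℂ) (scalarPauli A V c φ x - z * φ x) * g x = 0

/-- The residual of a mollified weak solution. -/
def pauliResidual (A : Plane → Plane) (V : Plane → ℝ) (c z : ℂ) (f : Plane → ℂ) (x : Plane) : ℂ :=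
  scalarPauli A V c f x - (starRingEnd ℂ) z * f x

/-- The integral kernel of the commutator of `scalarPauli` with a convolution operator. -/
def commutatorKernel (A : Plane → Plane) (V : Plane → ℝ) (c : ℂ) (k : Plane → ℂ) (x y : Plane) :
    ℂ :=
  I * (complexPotential A c x - complexPotential A c y) * wirtinger (-c) k (x - y)
    + I * (complexPotential A (-c) x - complexPotential A (-c) y) * wirtinger c k (x - y)
    + (pauliPotential A V c x - (starRingEnd ℂ) (pauliPotential A V c y)) * k (x - y)

/-- The function `y ↦ k (x - y)` is a test function, so the weak equation can be subtracted at no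
cost. The second order terms have constant coefficients and cancel, as do the terms in `z`;
differences of coefficients at `x` and `y` remain. The conjugate at `y` is there because the zeroth
order coefficient need not be real. -/
theorem residual_smoothing (hA : ContDiff ℝ 1 A) (hV : Continuous V)
    (hc : (starRingEnd ℂ) c = -c) (hg : MemLp g 2 volume) (hw : IsWeakSolution A V c z g)
    {k : Plane → ℂ} (hk : ContDiff ℝ ∞ k) (hkc : HasCompactSupport k)
    (hkr : ∀ x, (starRingEnd ℂ) (k x) = k x) (x : Plane) :
    pauliResidual A V c z (smoothing k g) x = ∫ y, commutatorKernel A V c k x y * g y := by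
  have hgl : LocallyIntegrable g volume := hg.locallyIntegrable one_le_two
  have hk1 : ContDiff ℝ 1 k := hk.of_le (by norm_cast)
  have hk2 : ContDiff ℝ 2 k := hk.of_le (by norm_cast)
  have hwk : ∀ a, ContDiff ℝ 1 (wirtinger a k) := fun a => wirtinger_contDiff hk2 (by norm_num)
  have hwkc : ∀ a, HasCompactSupport (wirtinger a k) := fun a => wirtinger_hasCompactSupport hkc
  have hf2 : ContDiff ℝ 2 (smoothing k g) :=
    (smoothing_contDiff hk hkc hgl).of_le (by norm_cast)
  set φ : Plane → ℂ := fun y => k (x - y) with hφ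
  have hφs : ContDiff ℝ ∞ φ := hk.comp (contDiff_const.sub contDiff_id)
  have hφc : HasCompactSupport φ := hkc.comp_homeomorph (Homeomorph.subLeft x)
  have hφ2 : ContDiff ℝ 2 φ := hφs.of_le (by norm_cast)
  have i1 := smoothing_integrable
    (wirtinger_contDiff (n := 0) (c := -c) (hwk c) (by simp)).continuous
    (wirtinger_hasCompactSupport (hwkc c)) hgl x
  have i2 := fun a => smoothing_integrable (hwk a).continuous (hwkc a) hgl x
  have i3 := smoothing_integrable hk.continuous hkc hgl x
  have hb : Integrable fun y => (starRingEnd ℂ) (scalarPauli A V c φ y - z * φ y) * g y :=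
    integrable_conj_mul (((scalarPauli_continuous hA hV c hφ2).sub
      (continuous_const.mul hφs.continuous)).memLp_of_hasCompactSupport
      ((scalarPauli_hasCompactSupport hφc).sub (hφc.mul_left (f := fun _ => z)))) hg
  have e1 : pauliResidual A V c z (smoothing k g) x = ∫ y,
      (-(wirtinger (-c) (wirtinger c k) (x - y) * g y)
        + I * complexPotential A c x * (wirtinger (-c) k (x - y) * g y)
        + I * complexPotential A (-c) x * (wirtinger c k (x - y) * g y)
        + (pauliPotential A V c x - (starRingEnd ℂ) z) * (k (x - y) * g y)) := by
    have j1 : Integrable fun y => -(wirtinger (-c) (wirtinger c k) (x - y) * g y) := i1.neg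
    have j2 : Integrable fun y => -(wirtinger (-c) (wirtinger c k) (x - y) * g y)
        + I * complexPotential A c x * (wirtinger (-c) k (x - y) * g y) :=
      j1.add ((i2 (-c)).const_mul _)
    have j3 : Integrable fun y => -(wirtinger (-c) (wirtinger c k) (x - y) * g y)
        + I * complexPotential A c x * (wirtinger (-c) k (x - y) * g y)
        + I * complexPotential A (-c) x * (wirtinger c k (x - y) * g y) :=
      j2.add ((i2 c).const_mul _)
    rw [integral_add j3 (i3.const_mul _), integral_add j2 ((i2 c).const_mul _),
      integral_add j1 ((i2 (-c)).const_mul _), integral_neg, integral_const_mul,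
      integral_const_mul, integral_const_mul, ← smoothing_eq, ← smoothing_eq, ← smoothing_eq,
      ← smoothing_eq, pauliResidual, scalarPauli_eq V hA c hf2,
      wirtinger_smoothing_left hk1 hkc hgl,
      wirtinger_smoothing_left (hwk c) (hwkc c) hgl, wirtinger_smoothing_left hk1 hkc hgl]
    ring
  have e2 : ∀ y, (starRingEnd ℂ) (scalarPauli A V c φ y - z * φ y)
      = -(wirtinger (-c) (wirtinger c k) (x - y))
        + I * complexPotential A c y * wirtinger (-c) k (x - y)
        + I * complexPotential A (-c) y * wirtinger c k (x - y)
        + ((starRingEnd ℂ) (pauliPotential A V c y) - (starRingEnd ℂ) z) * k (x - y) := by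
    intro y
    have d1 : ∀ a, wirtinger a φ = fun y => -wirtinger a k (x - y) := fun a =>
      funext fun y => wirtinger_comp_sub_left (hk1.differentiable one_ne_zero) x y
    have d2 : wirtinger (-c) (wirtinger c φ) y = wirtinger (-c) (wirtinger c k) (x - y) := by
      rw [d1]
      have h3 := wirtinger_comp_sub_left (c := -c) ((hwk c).differentiable one_ne_zero) x y
      have h4 : Differentiable ℝ fun y => wirtinger c k (x - y) :=
        ((hwk c).differentiable one_ne_zero).comp (differentiable_const x |>.sub differentiable_id)
      have h5 := wirtinger_const_mul (c := -c) (-1) (h4 y)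
      simp only [neg_mul, one_mul] at h5
      rw [h5, h3, neg_neg]
    have hkfun : (fun y => (starRingEnd ℂ) (k y)) = k := funext hkr
    have hkd : ∀ v, DifferentiableAt ℝ k v := fun v => hk1.differentiable one_ne_zero v
    have d3 : ∀ a v, (starRingEnd ℂ) (wirtinger a k v) = wirtinger ((starRingEnd ℂ) a) k v := by
      intro a v
      have := wirtinger_conj (c := (starRingEnd ℂ) a) (hkd v)
      rw [hkfun, Complex.conj_conj] at this
      exact this.symm
    -- Conjugation replaces `c` by `-c` in both factors, and the factors commute.
    have d4 : (starRingEnd ℂ) (wirtinger (-c) (wirtinger c k) (x - y))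
        = wirtinger (-c) (wirtinger c k) (x - y) := by
      have h3 := wirtinger_conj (c := c) ((hwk c).differentiable one_ne_zero (x - y))
      have h4 : (fun y => (starRingEnd ℂ) (wirtinger c k y)) = wirtinger (-c) k := by
        funext v; rw [d3, hc]
      rw [h4, hc] at h3
      rw [← h3, wirtinger_comm hk2]
    rw [scalarPauli_eq V hA c hφ2, d2, d1, d1]
    simp only [map_sub, map_add, map_mul, map_neg, d4, d3, hc, neg_neg, Complex.conj_I,
      conj_complexPotential, hφ, hkr]
    ring
  have h0 := hw φ hφs hφc
  have ha : Integrable fun y => (-(wirtinger (-c) (wirtinger c k) (x - y) * g y)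
        + I * complexPotential A c x * (wirtinger (-c) k (x - y) * g y)
        + I * complexPotential A (-c) x * (wirtinger c k (x - y) * g y)
        + (pauliPotential A V c x - (starRingEnd ℂ) z) * (k (x - y) * g y)) :=
    ((i1.neg.add ((i2 (-c)).const_mul _)).add ((i2 c).const_mul _)).add (i3.const_mul _)
  rw [e1, ← sub_zero (∫ y, _), ← h0, ← integral_sub ha hb]
  refine integral_congr_ae (Eventually.of_forall fun y => ?_)
  simp only [e2, commutatorKernel]
  ring

theorem exists_lipschitz_bound {f : Plane → ℂ} (hf : ContDiff ℝ 1 f) (S : ℝ) :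
    ∃ C : ℝ, 0 ≤ C ∧ ∀ x ∈ Metric.closedBall (0 : Plane) S, ∀ y ∈ Metric.closedBall (0 : Plane) S,
      ‖f x - f y‖ ≤ C * ‖x - y‖ := by
  obtain ⟨C, hC⟩ := (isCompact_closedBall (0 : Plane) S).exists_bound_of_continuousOn
    (hf.continuous_fderiv one_ne_zero).continuousOn
  refine ⟨max C 0, le_max_right _ _, fun x hx y hy => ?_⟩
  exact (convex_closedBall (0 : Plane) S).norm_image_sub_le_of_norm_fderiv_le
    (fun w _ => hf.differentiable one_ne_zero w)
    (fun w hw => (hC w hw).trans (le_max_left _ _)) hy hx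

/-- Friedrichs' lemma. On a ball the first order coefficients are Lipschitz, so that part of the
kernel is dominated by `‖v‖ ‖∇k(v)‖` with `v = x - y`, whose integral does not depend on `n`. The
zeroth order part is merely bounded, and this suffices. Young's inequality concludes. -/
theorem l2norm_indicator_residual_le (hA : ContDiff ℝ 1 A) (hV : Continuous V)
    (hc : (starRingEnd ℂ) c = -c) (hc1 : ‖c‖ = 1) (hg : MemLp g 2 volume)
    (hw : IsWeakSolution A V c z g) (S : ℝ) :
    ∃ C : ℝ, ∀ n, l2norm ((Metric.closedBall (0 : Plane) S).indicator
      (pauliResidual A V c z (smoothing (mollifier n) g))) ≤ C := by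
  obtain ⟨L₁, hL₁0, hL₁⟩ := exists_lipschitz_bound (complexPotential_contDiff (c := c) hA) (S + 1)
  obtain ⟨L₂, hL₂0, hL₂⟩ := exists_lipschitz_bound (complexPotential_contDiff (c := -c) hA) (S + 1)
  obtain ⟨W, hW⟩ := (isCompact_closedBall (0 : Plane) (S + 1)).exists_bound_of_continuousOn
    (pauliPotential_continuous hA hV c).continuousOn
  set W' := max W 0
  have hW'0 : 0 ≤ W' := le_max_right _ _
  have hW' : ∀ x ∈ Metric.closedBall (0 : Plane) (S + 1), ‖pauliPotential A V c x‖ ≤ W' :=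
    fun x hx => (hW x hx).trans (le_max_left _ _)
  set C := 2 * (L₁ + L₂) * mollifierMoment + 2 * W' * 1 with hC
  have hC0 : 0 ≤ mollifierMoment := integral_nonneg fun x => by positivity
  refine ⟨(ENNReal.ofReal C * eLpNorm g 2 volume).toReal, fun n => ?_⟩
  refine ENNReal.toReal_mono (ENNReal.mul_ne_top ENNReal.ofReal_ne_top hg.eLpNorm_ne_top) ?_
  have hk := mollifier_contDiff n
  have hkc := mollifier_hasCompactSupport n
  have hdk : Continuous (fderiv ℝ (mollifier n)) := hk.continuous_fderiv (by simp)
  have c1 : Continuous fun v : Plane => ‖v‖ * ‖fderiv ℝ (mollifier n) v‖ :=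
    continuous_norm.mul hdk.norm
  have i1 : Integrable fun v : Plane => ‖v‖ * ‖fderiv ℝ (mollifier n) v‖ :=
    c1.integrable_of_hasCompactSupport ((hkc.fderiv ℝ).norm.mul_left)
  have i2 : Integrable fun v : Plane => ‖mollifier n v‖ :=
    hk.continuous.norm.integrable_of_hasCompactSupport hkc.norm
  have hint : ∫ v, (2 * (L₁ + L₂) * (‖v‖ * ‖fderiv ℝ (mollifier n) v‖)
      + 2 * W' * ‖mollifier n v‖) = C := by
    rw [integral_add (i1.const_mul _) (i2.const_mul _), integral_const_mul, integral_const_mul,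
      integral_norm_mul_fderiv_mollifier, integral_norm_mollifier]
  rw [← hint]
  refine l2norm_le_of_le_convolution
    (k := fun v => 2 * (L₁ + L₂) * (‖v‖ * ‖fderiv ℝ (mollifier n) v‖) + 2 * W' * ‖mollifier n v‖)
    ((i1.const_mul _).add (i2.const_mul _))
    ((c1.const_mul _).add (hk.continuous.norm.const_mul _)).measurable
    (fun v => by positivity) hg fun x => ?_
  by_cases hx : x ∈ Metric.closedBall (0 : Plane) S
  swap
  · rw [Set.indicator_of_notMem hx, enorm_zero]; exact zero_le
  rw [Set.indicator_of_mem hx, residual_smoothing hA hV hc hg hw hk hkc (conj_mollifier n)]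
  refine (enorm_integral_le_lintegral_enorm _).trans (lintegral_mono fun y => ?_)
  rw [enorm_mul]
  gcongr
  rw [← ofReal_norm]
  refine ENNReal.ofReal_le_ofReal ?_
  -- The mollifier vanishes beyond distance `1`, which is why the coefficients were bounded on the
  -- ball of radius `S + 1`.
  by_cases hxy : 1 < ‖x - y‖
  · have h1 : commutatorKernel A V c (mollifier n) x y = 0 := by
      have h2 : mollifier n (x - y) = 0 := mollifier_eq_zero (by
        refine le_trans ?_ hxy.le
        rw [div_le_one (by positivity)]
        have : (0 : ℝ) ≤ n := Nat.cast_nonneg n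
        linarith)
      simp [commutatorKernel, wirtinger, fderiv_mollifier_eq_zero hxy, h2]
    rw [h1, norm_zero]
    positivity
  · rw [not_lt] at hxy
    have hxS := mem_closedBall_zero_iff.1 hx
    have hx1 : x ∈ Metric.closedBall (0 : Plane) (S + 1) :=
      mem_closedBall_zero_iff.2 (by linarith)
    have hy1 : y ∈ Metric.closedBall (0 : Plane) (S + 1) := by
      rw [mem_closedBall_zero_iff]
      have := norm_sub_norm_le y x
      rw [norm_sub_rev] at this
      linarith
    have b1 := hL₁ x hx1 y hy1
    have b2 := hL₂ x hx1 y hy1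
    have b3 : ‖pauliPotential A V c x - (starRingEnd ℂ) (pauliPotential A V c y)‖ ≤ 2 * W' := by
      refine (norm_sub_le _ _).trans ?_
      rw [RCLike.norm_conj]
      linarith [hW' x hx1, hW' y hy1]
    have b4 := norm_wirtinger_le (f := mollifier n) (x := x - y) hc1
    have b5 := norm_wirtinger_le (c := -c) (f := mollifier n) (x := x - y) (by simpa using hc1)
    rw [commutatorKernel]
    refine (norm_add₃_le).trans ?_
    simp only [norm_mul, Complex.norm_I, one_mul]
    calc _ ≤ L₁ * ‖x - y‖ * (2 * ‖fderiv ℝ (mollifier n) (x - y)‖)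
          + L₂ * ‖x - y‖ * (2 * ‖fderiv ℝ (mollifier n) (x - y)‖)
          + 2 * W' * ‖mollifier n (x - y)‖ := by gcongr
      _ = _ := by ring

theorem memLp_of_continuous_mul_indicator {f : Plane → ℂ} (hf : Continuous f) (S : ℝ) :
    MemLp ((Metric.closedBall (0 : Plane) S).indicator f) 2 volume := by
  obtain ⟨C, hC⟩ :=
    (isCompact_closedBall (0 : Plane) S).exists_bound_of_continuousOn hf.continuousOn
  have hm : MeasurableSet (Metric.closedBall (0 : Plane) S) :=
    Metric.isClosed_closedBall.measurableSet
  have h1 : MemLp ((Metric.closedBall (0 : Plane) S).indicator fun _ => C) 2 volume :=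
    memLp_indicator_const 2 hm C (Or.inr (isCompact_closedBall (0 : Plane) S).measure_lt_top.ne)
  refine h1.of_le (hf.aestronglyMeasurable.indicator hm) (Eventually.of_forall fun x => ?_)
  by_cases hx : x ∈ Metric.closedBall (0 : Plane) S
  · rw [Set.indicator_of_mem hx, Set.indicator_of_mem hx]
    exact (hC x hx).trans (le_abs_self C)
  · rw [Set.indicator_of_notMem hx, Set.indicator_of_notMem hx]; simp

theorem residual_continuous (hA : ContDiff ℝ 1 A) (hV : Continuous V) {f : Plane → ℂ}
    (hf : ContDiff ℝ 2 f) : Continuous (pauliResidual A V c z f) :=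
  (scalarPauli_continuous hA hV c hf).sub (continuous_const.mul hf.continuous)

/-- Moving the operator onto `h` and subtracting the weak equation leaves only the mollification
error of `g`. For fixed `h` the residuals therefore tend weakly to zero. -/
theorem norm_integral_conj_mul_residual_le (hA : ContDiff ℝ 1 A) (hV : Continuous V)
    (hc : (starRingEnd ℂ) c = -c) (hg : MemLp g 2 volume) (hw : IsWeakSolution A V c z g)
    {h : Plane → ℂ} (hh : ContDiff ℝ ∞ h) (hhc : HasCompactSupport h) (n : ℕ) :
    ‖∫ x, (starRingEnd ℂ) (h x) * pauliResidual A V c z (smoothing (mollifier n) g) x‖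
      ≤ l2norm (fun x => scalarPauli A V c h x - z * h x)
        * l2norm (fun x => smoothing (mollifier n) g x - g x) := by
  have hgl : LocallyIntegrable g volume := hg.locallyIntegrable one_le_two
  set f := smoothing (mollifier n) g with hf
  have hfs : ContDiff ℝ ∞ f :=
    smoothing_contDiff (mollifier_contDiff n) (mollifier_hasCompactSupport n) hgl
  have hf2 : ContDiff ℝ 2 f := hfs.of_le (by norm_cast)
  have hh2 : ContDiff ℝ 2 h := hh.of_le (by norm_cast)
  have hfm : MemLp f 2 volume := memLp_smoothing_mollifier n hg
  have hLm : MemLp (fun x => scalarPauli A V c h x - z * h x) 2 volume :=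
    (((scalarPauli_continuous hA hV c hh2).sub
      (continuous_const.mul hh.continuous)).memLp_of_hasCompactSupport
      ((scalarPauli_hasCompactSupport hhc).sub (hhc.mul_left (f := fun _ => z))))
  have hhm : MemLp h 2 volume := hh.continuous.memLp_of_hasCompactSupport hhc
  have hSm : MemLp (scalarPauli A V c h) 2 volume :=
    (scalarPauli_continuous hA hV c hh2).memLp_of_hasCompactSupport
      (scalarPauli_hasCompactSupport hhc)
  have hcs : HasCompactSupport (fun x => (starRingEnd ℂ) (h x)) :=
    hhc.comp_left (g := starRingEnd ℂ) (map_zero _)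
  have i1 : Integrable fun x => (starRingEnd ℂ) (h x) * scalarPauli A V c f x :=
    ((Complex.continuous_conj.comp hh.continuous).mul
      (scalarPauli_continuous hA hV c hf2)).integrable_of_hasCompactSupport hcs.mul_right
  have e1 : ∫ x, (starRingEnd ℂ) (h x) * pauliResidual A V c z f x
      = ∫ x, (starRingEnd ℂ) (scalarPauli A V c h x - z * h x) * f x := by
    have e2 : ∫ x, (starRingEnd ℂ) (h x) * pauliResidual A V c z f x
        = (∫ x, (starRingEnd ℂ) (h x) * scalarPauli A V c f x)
          - (starRingEnd ℂ) z * ∫ x, (starRingEnd ℂ) (h x) * f x := by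
      rw [← integral_const_mul, ← integral_sub i1 ((integrable_conj_mul hhm hfm).const_mul _)]
      refine integral_congr_ae (Eventually.of_forall fun y => ?_)
      simp only [pauliResidual]; ring
    rw [e2, integral_conj_mul_scalarPauli hA hV hc hh2 hf2 hhc, ← integral_const_mul,
      ← integral_sub (integrable_conj_mul hSm hfm) ((integrable_conj_mul hhm hfm).const_mul _)]
    refine integral_congr_ae (Eventually.of_forall fun y => ?_)
    simp only [map_sub, map_mul]; ring
  have e3 : ∫ x, (starRingEnd ℂ) (h x) * pauliResidual A V c z f x
      = ∫ x, (starRingEnd ℂ) (scalarPauli A V c h x - z * h x) * (f x - g x) := by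
    rw [e1, ← sub_zero (∫ x, _), ← hw h hh hhc,
      ← integral_sub (integrable_conj_mul hLm hfm) (integrable_conj_mul hLm hg)]
    refine integral_congr_ae (Eventually.of_forall fun y => ?_)
    simp only; ring
  rw [e3]
  exact norm_integral_conj_mul_le hLm (hfm.sub hg)

/-- The residual of the mollified weak solution tends to zero against the mollified solution. -/
theorem tendsto_integral_conj_mul_residual (hA : ContDiff ℝ 1 A) (hV : Continuous V)
    (hc : (starRingEnd ℂ) c = -c) (hc1 : ‖c‖ = 1) (hg : MemLp g 2 volume)
    (hw : IsWeakSolution A V c z g) {η : Plane → ℂ} (hη : ContDiff ℝ ∞ η)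
    (hηc : HasCompactSupport η) (hη1 : ∀ x, ‖η x‖ ≤ 1) :
    Tendsto (fun n => ∫ x, (starRingEnd ℂ) (η x * smoothing (mollifier n) g x)
      * pauliResidual A V c z (smoothing (mollifier n) g) x) atTop (𝓝 0) := by
  have hgl : LocallyIntegrable g volume := hg.locallyIntegrable one_le_two
  obtain ⟨S, hS⟩ := hηc.isCompact.isBounded.subset_closedBall (0 : Plane)
  obtain ⟨C, hC⟩ := l2norm_indicator_residual_le hA hV hc hc1 hg hw S
  have hC0 : 0 ≤ C := (l2norm_nonneg _).trans (hC 0)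
  have hfs : ∀ n, ContDiff ℝ ∞ (smoothing (mollifier n) g) := fun n =>
    smoothing_contDiff (mollifier_contDiff n) (mollifier_hasCompactSupport n) hgl
  have hfm : ∀ n, MemLp (smoothing (mollifier n) g) 2 volume := fun n =>
    memLp_smoothing_mollifier n hg
  have hrc : ∀ n, Continuous (pauliResidual A V c z (smoothing (mollifier n) g)) := fun n =>
    residual_continuous hA hV ((hfs n).of_le (by norm_cast))
  have hconv := tendsto_smoothing hg
  set d : ℕ → ℝ := fun n => l2norm fun x => smoothing (mollifier n) g x - g x with hd
  have hd0 : ∀ n, 0 ≤ d n := fun n => l2norm_nonneg _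
  have hηf : ∀ m, ContDiff ℝ ∞ (fun x => η x * smoothing (mollifier m) g x) := fun m =>
    hη.mul (hfs m)
  have hηfc : ∀ m, HasCompactSupport (fun x => η x * smoothing (mollifier m) g x) := fun m =>
    hηc.mul_right
  -- One copy of the mollified solution is frozen at index `m`. The frozen part is a fixed test
  -- function and is handled by weak convergence; the difference is small in `L²` and meets the
  -- uniform bound on the residuals.
  have hsplit : ∀ m n, ‖∫ x, (starRingEnd ℂ) (η x * smoothing (mollifier n) g x)
      * pauliResidual A V c z (smoothing (mollifier n) g) x‖
      ≤ l2norm (fun x => scalarPauli A V c (fun x => η x * smoothing (mollifier m) g x) x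
          - z * (η x * smoothing (mollifier m) g x)) * d n + (d n + d m) * C := by
    intro m n
    set fm := smoothing (mollifier m) g
    set fn := smoothing (mollifier n) g
    set r := pauliResidual A V c z fn with hr
    have hi : ∀ m, Integrable fun x => (starRingEnd ℂ) (η x * smoothing (mollifier m) g x) * r x :=
      fun m => ((Complex.continuous_conj.comp (hηf m).continuous).mul
        (hrc n)).integrable_of_hasCompactSupport
        ((hηfc m).comp_left (g := starRingEnd ℂ) (map_zero _)).mul_right
    have e : ∫ x, (starRingEnd ℂ) (η x * fn x) * r x
        = (∫ x, (starRingEnd ℂ) (η x * fm x) * r x)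
          + ∫ x, (starRingEnd ℂ) (η x * (fn x - fm x))
            * (Metric.closedBall (0 : Plane) S).indicator r x := by
      have e' : ∫ x, (starRingEnd ℂ) (η x * (fn x - fm x))
            * (Metric.closedBall (0 : Plane) S).indicator r x
          = ∫ x, ((starRingEnd ℂ) (η x * fn x) * r x - (starRingEnd ℂ) (η x * fm x) * r x) := by
        refine integral_congr_ae (Eventually.of_forall fun x => ?_)
        by_cases hx : x ∈ Metric.closedBall (0 : Plane) S
        · simp only [Set.indicator_of_mem hx, map_mul, map_sub]; ring
        · have : η x = 0 := image_eq_zero_of_notMem_tsupport fun h => hx (hS h)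
          simp [this]
      rw [e', integral_sub (hi n) (hi m)]
      ring
    have hdm : MemLp (fun x => fn x - fm x) 2 volume := (hfm n).sub (hfm m)
    have hηm : MemLp (fun x => η x * (fn x - fm x)) 2 volume := by
      refine hdm.of_le (hη.continuous.aestronglyMeasurable.mul hdm.1)
        (Eventually.of_forall fun x => ?_)
      rw [norm_mul]
      exact mul_le_of_le_one_left (norm_nonneg _) (hη1 x)
    have b1 := norm_integral_conj_mul_residual_le hA hV hc hg hw (hηf m) (hηfc m) n
    have b2 := norm_integral_conj_mul_le hηm (memLp_of_continuous_mul_indicator (hrc n) S)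
    have b3 : l2norm (fun x => η x * (fn x - fm x)) ≤ d n + d m := by
      have h1 : l2norm (fun x => η x * (fn x - fm x)) ≤ l2norm (fun x => fn x - fm x) := by
        refine l2norm_mono hdm fun x => ?_
        rw [norm_mul]
        exact mul_le_of_le_one_left (norm_nonneg _) (hη1 x)
      have h2 := l2norm_sub_le ((hfm n).sub hg) ((hfm m).sub hg)
      simp only [Pi.sub_apply, sub_sub_sub_cancel_right] at h2
      exact h1.trans h2
    rw [e]
    refine (norm_add_le _ _).trans (add_le_add b1 (b2.trans ?_))
    exact mul_le_mul b3 (hC n) (l2norm_nonneg _) (add_nonneg (hd0 _) (hd0 _))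
  rw [Metric.tendsto_atTop]
  intro ε hε
  -- The index `m` is fixed first, because the constant `P` below depends on it and may be large.
  obtain ⟨m, hm⟩ := ((Metric.tendsto_atTop.1 hconv) (ε / (4 * (C + 1))) (by positivity))
  have hm' := hm m le_rfl
  rw [Real.dist_eq, sub_zero, abs_of_nonneg (hd0 m)] at hm'
  set P := l2norm (fun x => scalarPauli A V c (fun x => η x * smoothing (mollifier m) g x) x
          - z * (η x * smoothing (mollifier m) g x)) with hP
  have hP0 : 0 ≤ P := l2norm_nonneg _
  obtain ⟨N, hN⟩ := (Metric.tendsto_atTop.1 hconv) (ε / (4 * (P + C + 1))) (by positivity)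
  refine ⟨N, fun n hn => ?_⟩
  have h1 := hN n hn
  rw [Real.dist_eq, sub_zero, abs_of_nonneg (hd0 n)] at h1
  rw [dist_zero_right]
  refine (hsplit m n).trans_lt ?_
  rw [lt_div_iff₀ (by positivity)] at h1 hm'
  nlinarith [hd0 n, hd0 m]

end Friedrichs

/-! ### Cutoffs, the energy estimate, and vanishing of weak solutions -/

noncomputable section EnergyEstimate

open Complex (I)
open scoped ENNReal

section Cutoff

/-- A smooth cutoff, equal to `1` on the ball of radius `R / 2` around `x₀` and to `0` outside the
ball of radius `R`. -/
def cutoff (x₀ : Plane) (R : ℝ) (x : Plane) : ℂ := (planeBump (R⁻¹ • (x - x₀)) : ℂ)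

theorem planeBump_ofReal_contDiff : ContDiff ℝ ∞ fun x : Plane => (planeBump x : ℂ) :=
  Complex.ofRealCLM.contDiff.comp planeBump.contDiff

theorem planeBump_ofReal_hasCompactSupport : HasCompactSupport fun x : Plane => (planeBump x : ℂ) :=
  planeBump.hasCompactSupport.comp_left (g := ((↑) : ℝ → ℂ)) Complex.ofReal_zero

theorem cutoff_contDiff (x₀ : Plane) (R : ℝ) : ContDiff ℝ ∞ (cutoff x₀ R) :=
  planeBump_ofReal_contDiff.comp ((contDiff_id.sub contDiff_const).const_smul _)

theorem conj_cutoff (x₀ : Plane) (R : ℝ) (x : Plane) :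
    (starRingEnd ℂ) (cutoff x₀ R x) = cutoff x₀ R x := Complex.conj_ofReal _

theorem norm_cutoff_le (x₀ : Plane) (R : ℝ) (x : Plane) : ‖cutoff x₀ R x‖ ≤ 1 := by
  rw [cutoff, Complex.norm_real, Real.norm_of_nonneg planeBump.nonneg]
  exact planeBump.le_one

theorem norm_scale {R : ℝ} (hR : 0 < R) (v : Plane) : ‖R⁻¹ • v‖ = ‖v‖ / R := by
  rw [norm_smul, norm_inv, Real.norm_of_nonneg hR.le, inv_mul_eq_div]

theorem cutoff_eq_one {x₀ : Plane} {R : ℝ} (hR : 0 < R) {x : Plane} (hx : ‖x - x₀‖ ≤ R / 2) :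
    cutoff x₀ R x = 1 := by
  rw [cutoff, planeBump.one_of_mem_closedBall, Complex.ofReal_one]
  rw [mem_closedBall_zero_iff, norm_scale hR, div_le_iff₀ hR]
  change ‖x - x₀‖ ≤ 1 / 2 * R
  linarith

theorem cutoff_eq_zero {x₀ : Plane} {R : ℝ} (hR : 0 < R) {x : Plane} (hx : R ≤ ‖x - x₀‖) :
    cutoff x₀ R x = 0 := by
  rw [cutoff, planeBump.zero_of_le_dist, Complex.ofReal_zero]
  rw [dist_zero_right, norm_scale hR, le_div_iff₀ hR]
  change 1 * R ≤ _
  linarith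

theorem cutoff_hasCompactSupport (x₀ : Plane) {R : ℝ} (hR : 0 < R) :
    HasCompactSupport (cutoff x₀ R) := by
  refine HasCompactSupport.intro (isCompact_closedBall x₀ R) fun x hx => cutoff_eq_zero hR ?_
  rw [mem_closedBall_iff_norm, not_le] at hx
  exact hx.le

theorem wirtinger_comp_scale {c : ℂ} {f : Plane → ℂ} (hf : Differentiable ℝ f)
    (x₀ : Plane) (R : ℝ) :
    wirtinger c (fun x => f (R⁻¹ • (x - x₀)))
      = fun x => (R⁻¹ : ℂ) * wirtinger c f (R⁻¹ • (x - x₀)) := by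
  funext x
  have h : HasFDerivAt (fun x => f (R⁻¹ • (x - x₀))) ((fderiv ℝ f (R⁻¹ • (x - x₀))).comp
      (R⁻¹ • ContinuousLinearMap.id ℝ Plane)) x :=
    (hf _).hasFDerivAt.comp x (((hasFDerivAt_id x).sub_const x₀).const_smul R⁻¹)
  simp only [wirtinger, h.fderiv]
  simp
  ring

theorem wirtinger_cutoff (c : ℂ) (x₀ : Plane) (R : ℝ) :
    wirtinger c (cutoff x₀ R) = fun x => (R⁻¹ : ℂ) *
      wirtinger c (fun x : Plane => (planeBump x : ℂ)) (R⁻¹ • (x - x₀)) :=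
  wirtinger_comp_scale (planeBump_ofReal_contDiff.differentiable (by simp)) x₀ R

/-- All cutoffs are translates and dilates of one bump, so one constant serves every centre and
radius, and each derivative costs a factor `1/R`. -/
theorem exists_cutoff_bound (c : ℂ) : ∃ C : ℝ, 0 < C ∧ ∀ (x₀ : Plane) (R : ℝ), 0 < R → ∀ x,
    ‖wirtinger c (cutoff x₀ R) x‖ ≤ C / R ∧ ‖wirtinger (-c) (cutoff x₀ R) x‖ ≤ C / R ∧
    ‖wirtinger (-c) (wirtinger c (cutoff x₀ R)) x‖ ≤ C / R ^ 2 := by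
  set b : Plane → ℂ := fun x => (planeBump x : ℂ) with hb
  have hbs : ContDiff ℝ ∞ b := planeBump_ofReal_contDiff
  have hbc : HasCompactSupport b := planeBump_ofReal_hasCompactSupport
  have h1 : ∀ a, ContDiff ℝ 1 (wirtinger a b) := fun a =>
    wirtinger_contDiff hbs (by norm_cast)
  have h2 : Continuous (wirtinger (-c) (wirtinger c b)) :=
    (wirtinger_contDiff (n := 0) (h1 c) (by simp)).continuous
  have hw : ∀ a, HasCompactSupport (wirtinger a b) := fun a => wirtinger_hasCompactSupport hbc
  obtain ⟨C₁, hC₁⟩ := (hw c).exists_bound_of_continuous (h1 c).continuous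
  obtain ⟨C₂, hC₂⟩ := (hw (-c)).exists_bound_of_continuous (h1 (-c)).continuous
  obtain ⟨C₃, hC₃⟩ := (wirtinger_hasCompactSupport (c := -c) (hw c)).exists_bound_of_continuous h2
  refine ⟨max (max C₁ C₂) (max C₃ 1), by positivity, fun x₀ R hR x => ⟨?_, ?_, ?_⟩⟩
  · rw [wirtinger_cutoff, norm_mul, div_eq_inv_mul]
    have : ‖(R⁻¹ : ℂ)‖ = R⁻¹ := by rw [norm_inv, Complex.norm_real, Real.norm_of_nonneg hR.le]
    rw [this]
    gcongr
    exact (hC₁ _).trans ((le_max_left _ _).trans (le_max_left _ _))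
  · rw [wirtinger_cutoff, norm_mul, div_eq_inv_mul]
    have : ‖(R⁻¹ : ℂ)‖ = R⁻¹ := by rw [norm_inv, Complex.norm_real, Real.norm_of_nonneg hR.le]
    rw [this]
    gcongr
    exact (hC₂ _).trans ((le_max_right _ _).trans (le_max_left _ _))
  · have hd : Differentiable ℝ fun x => wirtinger c b (R⁻¹ • (x - x₀)) :=
      ((h1 c).differentiable one_ne_zero).comp
        ((differentiable_id.sub (differentiable_const x₀)).const_smul R⁻¹)
    rw [wirtinger_cutoff, wirtinger_const_mul _ (hd x),
      wirtinger_comp_scale ((h1 c).differentiable one_ne_zero), ← mul_assoc, norm_mul,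
      div_eq_inv_mul]
    have : ‖(R⁻¹ : ℂ) * (R⁻¹ : ℂ)‖ = (R ^ 2)⁻¹ := by
      rw [norm_mul, norm_inv, Complex.norm_real, Real.norm_of_nonneg hR.le, sq, mul_inv]
    rw [this]
    gcongr
    exact (hC₃ _).trans ((le_max_left _ _).trans (le_max_right _ _))

theorem wirtinger_cutoff_eq_zero {c : ℂ} {x₀ : Plane} {R : ℝ} (hR : 0 < R) {x : Plane}
    (hx : ‖x - x₀‖ < R / 2) : wirtinger c (cutoff x₀ R) x = 0 := by
  have h : cutoff x₀ R =ᶠ[𝓝 x] fun _ => 1 := by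
    have ho : IsOpen {y : Plane | ‖y - x₀‖ < R / 2} :=
      isOpen_lt (continuous_id.sub continuous_const).norm continuous_const
    filter_upwards [ho.mem_nhds hx] with y hy
    exact cutoff_eq_one hR (le_of_lt hy)
  rw [wirtinger_congr h, wirtinger_const]

theorem wirtinger_wirtinger_cutoff_eq_zero {a c : ℂ} {x₀ : Plane} {R : ℝ} (hR : 0 < R) {x : Plane}
    (hx : ‖x - x₀‖ < R / 2) : wirtinger a (wirtinger c (cutoff x₀ R)) x = 0 := by
  have h : wirtinger c (cutoff x₀ R) =ᶠ[𝓝 x] fun _ => 0 := by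
    have ho : IsOpen {y : Plane | ‖y - x₀‖ < R / 2} :=
      isOpen_lt (continuous_id.sub continuous_const).norm continuous_const
    filter_upwards [ho.mem_nhds hx] with y hy
    exact wirtinger_cutoff_eq_zero hR hy
  rw [wirtinger_congr h, wirtinger_const]

end Cutoff

variable {A : Plane → Plane} {V : Plane → ℝ} {c z : ℂ} {g : Plane → ℂ}

/-- The localised energy identity. -/
theorem energy_identity (hA : ContDiff ℝ 1 A) (hV : Continuous V) (hc : (starRingEnd ℂ) c = -c)
    {χ f : Plane → ℂ} (hχ : ContDiff ℝ 2 χ) (hχc : HasCompactSupport χ)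
    (hχr : ∀ x, (starRingEnd ℂ) (χ x) = χ x) (hf : ContDiff ℝ 2 f) :
    ∫ x, (starRingEnd ℂ) (χ x ^ 2 * f x) * pauliResidual A V c z f x
      = ((l2norm fun x => χ x * momentum A c f x) ^ 2 : ℝ)
        + (∫ x, (starRingEnd ℂ) (-(2 * I) * wirtinger c χ x * f x) * (χ x * momentum A c f x))
        + (∫ x, V x * ‖χ x * f x‖ ^ 2 : ℝ)
        - (starRingEnd ℂ) z * ((l2norm fun x => χ x * f x) ^ 2 : ℝ) := by
  have hmc : Continuous (momentum A c f) :=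
    (momentum_contDiff (n := 1) hA hf (by norm_num)).continuous
  have hwc : Continuous (wirtinger c χ) :=
    (wirtinger_contDiff (n := 1) hχ (by norm_num)).continuous
  have hφ : ContDiff ℝ 1 fun x => χ x ^ 2 * f x := ((hχ.pow 2).mul hf).of_le one_le_two
  have hφc : HasCompactSupport fun x => χ x ^ 2 * f x := by
    have : HasCompactSupport fun x => χ x ^ 2 :=
      hχc.comp_left (g := fun t : ℂ => t ^ 2) (by simp)
    exact this.mul_right
  have cconj : Continuous (starRingEnd ℂ : ℂ → ℂ) := Complex.continuous_conj
  have hφcc : HasCompactSupport fun x => (starRingEnd ℂ) (χ x ^ 2 * f x) :=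
    hφc.comp_left (g := starRingEnd ℂ) (map_zero _)
  have mp : MemLp (fun x => χ x * momentum A c f x) 2 volume :=
    (hχ.continuous.mul hmc).memLp_of_hasCompactSupport hχc.mul_right
  have mf : MemLp (fun x => χ x * f x) 2 volume :=
    (hχ.continuous.mul hf.continuous).memLp_of_hasCompactSupport hχc.mul_right
  have mq : MemLp (fun x => -(2 * I) * wirtinger c χ x * f x) 2 volume :=
    ((continuous_const.mul hwc).mul hf.continuous).memLp_of_hasCompactSupport
      ((wirtinger_hasCompactSupport hχc).mul_left (f := fun _ => -(2 * I))).mul_right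
  have key := integral_conj_mul_momentum hA.continuous hc hφ
    (momentum_contDiff (n := 1) (c := c) hA hf (by norm_num)) hφc
  have hns : ∀ w : ℂ, (starRingEnd ℂ) w * w = ((‖w‖ ^ 2 : ℝ) : ℂ) := fun w => by
    rw [mul_comm, Complex.mul_conj, Complex.normSq_eq_norm_sq]
  have i1 : Integrable fun x => (starRingEnd ℂ) (χ x ^ 2 * f x)
      * momentum A (-c) (momentum A c f) x :=
    ((cconj.comp hφ.continuous).mul (momentum_contDiff (n := 0) (hA.of_le zero_le_one)
      (momentum_contDiff (n := 1) hA hf (by norm_num)) (by simp)).continuous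
      ).integrable_of_hasCompactSupport hφcc.mul_right
  have i2 : Integrable fun x => ((V x * ‖χ x * f x‖ ^ 2 : ℝ) : ℂ) := by
    have : Integrable fun x => V x * ‖χ x * f x‖ ^ 2 := by
      refine (hV.mul ((hχ.continuous.mul hf.continuous).norm.pow 2)).integrable_of_hasCompactSupport
        ?_
      have h2 : HasCompactSupport fun x => ‖χ x * f x‖ ^ 2 :=
        (hχc.mul_right (f' := f)).comp_left (g := fun t : ℂ => ‖t‖ ^ 2) (by simp)
      exact h2.mul_left
    exact this.ofReal
  have i3 : Integrable fun x => ((‖χ x * f x‖ ^ 2 : ℝ) : ℂ) := (mf.norm.integrable_sq).ofReal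
  have e1 : ∫ x, (starRingEnd ℂ) (χ x ^ 2 * f x) * pauliResidual A V c z f x
      = (∫ x, (starRingEnd ℂ) (χ x ^ 2 * f x) * momentum A (-c) (momentum A c f) x)
        + (∫ x, ((V x * ‖χ x * f x‖ ^ 2 : ℝ) : ℂ))
        - (starRingEnd ℂ) z * ∫ x, ((‖χ x * f x‖ ^ 2 : ℝ) : ℂ) := by
    have i12 : Integrable fun x => (starRingEnd ℂ) (χ x ^ 2 * f x)
      * momentum A (-c) (momentum A c f) x + ((V x * ‖χ x * f x‖ ^ 2 : ℝ) : ℂ) := i1.add i2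
    rw [← integral_add i1 i2, ← integral_const_mul, ← integral_sub i12 (i3.const_mul _)]
    refine integral_congr_ae (Eventually.of_forall fun x => ?_)
    simp only [pauliResidual, scalarPauli, Complex.ofReal_mul, ← hns, map_mul, map_pow, hχr]
    ring
  have e2 : ∫ x, (starRingEnd ℂ) (momentum A c (fun x => χ x ^ 2 * f x) x) * momentum A c f x
      = (∫ x, ((‖χ x * momentum A c f x‖ ^ 2 : ℝ) : ℂ))
        + ∫ x, (starRingEnd ℂ) (-(2 * I) * wirtinger c χ x * f x) * (χ x * momentum A c f x) := by
    have ip : Integrable fun x => ((‖χ x * momentum A c f x‖ ^ 2 : ℝ) : ℂ) :=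
      mp.norm.integrable_sq.ofReal
    rw [← integral_add ip (integrable_conj_mul mq mp)]
    refine integral_congr_ae (Eventually.of_forall fun x => ?_)
    have d1 : DifferentiableAt ℝ χ x := hχ.differentiable two_ne_zero x
    have d2 : DifferentiableAt ℝ (fun x => χ x ^ 2) x := d1.pow 2
    have d3 : wirtinger c (fun x => χ x ^ 2) x = 2 * χ x * wirtinger c χ x := by
      simp only [sq]
      rw [wirtinger_mul d1 d1]; ring
    simp only
    rw [momentum_mul d2 (hf.differentiable two_ne_zero x), d3, ← hns]
    simp only [map_add, map_mul, map_pow, map_neg, hχr]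
    simp only [map_ofNat]
    ring
  rw [e1, key, e2, integral_complex_ofReal, integral_complex_ofReal, integral_complex_ofReal,
    l2norm_sq mp,
    l2norm_sq mf]

/-- The localised energy estimate. -/
theorem energy_estimate (hA : ContDiff ℝ 1 A) (hV : Continuous V) (hc : (starRingEnd ℂ) c = -c)
    {χ f : Plane → ℂ} (hχ : ContDiff ℝ 2 χ) (hχc : HasCompactSupport χ)
    (hχr : ∀ x, (starRingEnd ℂ) (χ x) = χ x) (hf : ContDiff ℝ 2 f) {K : ℝ}
    (hK : ∀ x, χ x ≠ 0 → -K ≤ V x) :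
    |z.im| * (l2norm fun x => χ x * f x) ^ 2
      ≤ ‖∫ x, (starRingEnd ℂ) (χ x ^ 2 * f x) * pauliResidual A V c z f x‖
        + (l2norm fun x => -(2 * I) * wirtinger c χ x * f x)
          * √(2 * ‖∫ x, (starRingEnd ℂ) (χ x ^ 2 * f x) * pauliResidual A V c z f x‖
            + (l2norm fun x => -(2 * I) * wirtinger c χ x * f x) ^ 2
            + 2 * (K + |z.re|) * (l2norm fun x => χ x * f x) ^ 2) := by
  have hmc : Continuous (momentum A c f) :=
    (momentum_contDiff (n := 1) hA hf (by norm_num)).continuous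
  have hwc : Continuous (wirtinger c χ) :=
    (wirtinger_contDiff (n := 1) hχ (by norm_num)).continuous
  have mp : MemLp (fun x => χ x * momentum A c f x) 2 volume :=
    (hχ.continuous.mul hmc).memLp_of_hasCompactSupport hχc.mul_right
  have mf : MemLp (fun x => χ x * f x) 2 volume :=
    (hχ.continuous.mul hf.continuous).memLp_of_hasCompactSupport hχc.mul_right
  have mq : MemLp (fun x => -(2 * I) * wirtinger c χ x * f x) 2 volume :=
    ((continuous_const.mul hwc).mul hf.continuous).memLp_of_hasCompactSupport
      ((wirtinger_hasCompactSupport hχc).mul_left (f := fun _ => -(2 * I))).mul_right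
  have hid := energy_identity (z := z) hA hV hc hχ hχc hχr hf
  have hcs := norm_integral_conj_mul_le mq mp
  have hVint : -K * (l2norm fun x => χ x * f x) ^ 2 ≤ ∫ x, V x * ‖χ x * f x‖ ^ 2 := by
    rw [l2norm_sq mf, ← integral_const_mul]
    refine integral_mono (mf.norm.integrable_sq.const_mul _) ?_ fun x => ?_
    · refine (hV.mul ((hχ.continuous.mul hf.continuous).norm.pow 2)).integrable_of_hasCompactSupport
        ?_
      have h2 : HasCompactSupport fun x => ‖χ x * f x‖ ^ 2 :=
        (hχc.mul_right (f' := f)).comp_left (g := fun t : ℂ => ‖t‖ ^ 2) (by simp)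
      exact h2.mul_left
    · by_cases h : χ x = 0
      · simp [h]
      · simp only
        gcongr
        exact hK x h
  set e := ∫ x, (starRingEnd ℂ) (χ x ^ 2 * f x) * pauliResidual A V c z f x
  set J := ∫ x, (starRingEnd ℂ) (-(2 * I) * wirtinger c χ x * f x) * (χ x * momentum A c f x)
  set P := l2norm fun x => χ x * momentum A c f x
  set Q := l2norm fun x => -(2 * I) * wirtinger c χ x * f x
  set N := l2norm fun x => χ x * f x
  set U := ∫ x, V x * ‖χ x * f x‖ ^ 2
  have hP0 : 0 ≤ P := l2norm_nonneg _
  have hQ0 : 0 ≤ Q := l2norm_nonneg _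
  have him := congrArg Complex.im hid
  have hre := congrArg Complex.re hid
  simp only [Complex.sub_im, Complex.add_im, Complex.ofReal_im, Complex.mul_im, Complex.ofReal_re,
    Complex.conj_im, Complex.conj_re, Complex.sub_re, Complex.add_re, Complex.mul_re] at him hre
  have b1 := abs_le.1 (Complex.abs_im_le_norm e)
  have b2 := abs_le.1 (Complex.abs_re_le_norm e)
  have b3 := abs_le.1 (Complex.abs_im_le_norm J)
  have b4 := abs_le.1 (Complex.abs_re_le_norm J)
  have hN2 : 0 ≤ N ^ 2 := sq_nonneg N
  have b5 : z.re * N ^ 2 ≤ |z.re| * N ^ 2 := by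
    gcongr
    exact le_abs_self _
  -- The real part of the identity bounds `P²` by `‖e‖ + QP + (K + |Re z|) N²`, and `2QP ≤ P² + Q²`
  -- absorbs the cross term.
  have hP : P ≤ √(2 * ‖e‖ + Q ^ 2 + 2 * (K + |z.re|) * N ^ 2) := by
    refine Real.le_sqrt_of_sq_le ?_
    nlinarith [sq_nonneg (P - Q)]
  -- In the imaginary part the kinetic and potential terms drop out, being real.
  have h1 : |z.im| * N ^ 2 ≤ ‖e‖ + Q * P := by
    rcases abs_cases z.im with ⟨h, -⟩ | ⟨h, -⟩ <;> rw [h] <;> nlinarith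
  refine h1.trans ?_
  gcongr

theorem tendsto_l2norm_of_sub {u : ℕ → Plane → ℂ} {v : Plane → ℂ} (hu : ∀ n, MemLp (u n) 2 volume)
    (hv : MemLp v 2 volume)
    (h : Tendsto (fun n => l2norm fun x => u n x - v x) atTop (𝓝 0)) :
    Tendsto (fun n => l2norm (u n)) atTop (𝓝 (l2norm v)) := by
  rw [tendsto_iff_dist_tendsto_zero]
  refine squeeze_zero (fun n => dist_nonneg) (fun n => ?_) h
  rw [Real.dist_eq, abs_le]
  have h1 := l2norm_add_le ((hu n).sub hv) hv
  have h2 := l2norm_sub_le (hu n) ((hu n).sub hv)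
  simp only [Pi.sub_apply, sub_add_cancel, sub_sub_cancel] at h1 h2
  have e1 : l2norm (u n - v) = l2norm fun x => u n x - v x := rfl
  rw [e1] at h1 h2
  constructor <;> linarith

theorem tendsto_l2norm_mul_smoothing {a : Plane → ℂ} (ha : Continuous a)
    (hac : HasCompactSupport a) (hg : MemLp g 2 volume) :
    Tendsto (fun n => l2norm fun x => a x * smoothing (mollifier n) g x) atTop
      (𝓝 (l2norm fun x => a x * g x)) := by
  obtain ⟨M, hM⟩ := hac.exists_bound_of_continuous ha
  have hM0 : 0 ≤ M := (norm_nonneg _).trans (hM 0)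
  have hmem : ∀ {f : Plane → ℂ}, MemLp f 2 volume → MemLp (fun x => a x * f x) 2 volume := by
    intro f hf
    refine (hf.const_mul (M : ℂ)).of_le (ha.aestronglyMeasurable.mul hf.1)
      (Eventually.of_forall fun x => ?_)
    rw [norm_mul, norm_mul, Complex.norm_real, Real.norm_of_nonneg hM0]
    gcongr
    exact hM x
  refine tendsto_l2norm_of_sub (fun n => hmem (memLp_smoothing_mollifier n hg)) (hmem hg) ?_
  have h0 := (tendsto_smoothing hg).const_mul M
  rw [mul_zero] at h0
  refine squeeze_zero (fun n => l2norm_nonneg _) (fun n => ?_) h0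
  refine l2norm_le_mul hM0 ((memLp_smoothing_mollifier n hg).sub hg) fun x => ?_
  rw [← mul_sub, norm_mul]
  gcongr
  exact hM x

/-- The energy estimate for weak solutions. -/
theorem weakSolution_energy_estimate (hA : ContDiff ℝ 1 A) (hV : Continuous V)
    (hc : (starRingEnd ℂ) c = -c) (hc1 : ‖c‖ = 1) (hg : MemLp g 2 volume)
    (hw : IsWeakSolution A V c z g)
    {χ : Plane → ℂ} (hχ : ContDiff ℝ ∞ χ) (hχc : HasCompactSupport χ)
    (hχr : ∀ x, (starRingEnd ℂ) (χ x) = χ x) (hχ1 : ∀ x, ‖χ x‖ ≤ 1) {K : ℝ}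
    (hK : ∀ x, χ x ≠ 0 → -K ≤ V x) :
    |z.im| * (l2norm fun x => χ x * g x) ^ 2
      ≤ (l2norm fun x => -(2 * I) * wirtinger c χ x * g x)
          * √((l2norm fun x => -(2 * I) * wirtinger c χ x * g x) ^ 2
            + 2 * (K + |z.re|) * (l2norm fun x => χ x * g x) ^ 2) := by
  have hχ2 : ContDiff ℝ 2 χ := hχ.of_le (by norm_cast)
  have hgl : LocallyIntegrable g volume := hg.locallyIntegrable one_le_two
  have hfs : ∀ n, ContDiff ℝ 2 (smoothing (mollifier n) g) := fun n =>
    (smoothing_contDiff (mollifier_contDiff n) (mollifier_hasCompactSupport n) hgl).of_le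
      (by norm_cast)
  have hwc : Continuous (wirtinger c χ) :=
    (wirtinger_contDiff (n := 1) hχ2 (by norm_num)).continuous
  -- The estimate contains no derivative of the mollified solution, so it survives the limit.
  have hest := fun n => energy_estimate (z := z) hA hV hc hχ2 hχc hχr (hfs n) hK
  have t0 := (tendsto_integral_conj_mul_residual hA hV hc hc1 hg hw (η := fun x => χ x ^ 2)
    (hχ.pow 2) (hχc.comp_left (g := fun t : ℂ => t ^ 2) (by simp)) (fun x => by
      rw [norm_pow]; exact pow_le_one₀ (norm_nonneg _) (hχ1 x))).norm
  rw [norm_zero] at t0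
  have t1 := tendsto_l2norm_mul_smoothing hχ.continuous hχc hg
  have t2 := tendsto_l2norm_mul_smoothing (a := fun x => -(2 * I) * wirtinger c χ x)
    (continuous_const.mul hwc)
    ((wirtinger_hasCompactSupport hχc).mul_left (f := fun _ => -(2 * I))) hg
  have hR := t0.add (t2.mul (((t0.const_mul 2).add (t2.pow 2)).add
    ((t1.pow 2).const_mul (2 * (K + |z.re|)))).sqrt)
  simp only [mul_zero, zero_add] at hR
  exact le_of_tendsto_of_tendsto ((t1.pow 2).const_mul |z.im|) hR (Eventually.of_forall hest)

/-- Square integrable weak solutions at nonreal spectral parameters vanish, if the potential is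
bounded below by a quadratic function. -/
theorem weakSolution_eq_zero (hA : ContDiff ℝ 1 A) (hV : Continuous V)
    (hgrowth : ∃ a d : ℝ, 0 < a ∧ ∀ x : Plane, -a * ‖x‖ ^ 2 + d ≤ V x)
    (hc : (starRingEnd ℂ) c = -c) (hc1 : ‖c‖ = 1) (hz : z.im ≠ 0) (hg : MemLp g 2 volume)
    (hw : IsWeakSolution A V c z g) : g =ᵐ[volume] 0 := by
  obtain ⟨a, d, ha, hVd⟩ := hgrowth
  obtain ⟨C, hC0, hC⟩ := exists_cutoff_bound c
  have hzp : 0 < |z.im| := abs_pos.2 hz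
  set G := l2norm g with hG
  have hG0 : 0 ≤ G := l2norm_nonneg _
  set s : ℕ → Set Plane := fun n => {x | ((n : ℝ) + 1) / 2 ≤ ‖x‖} with hs
  have hsm : ∀ n, MeasurableSet (s n) := fun n =>
    (isClosed_le continuous_const continuous_norm).measurableSet
  have hst : ∀ x, ∀ᶠ n in atTop, x ∉ s n := fun x => by
    filter_upwards [eventually_ge_atTop ⌈2 * ‖x‖⌉₊] with n hn
    have h1 : 2 * ‖x‖ ≤ n := (Nat.le_ceil _).trans (by exact_mod_cast hn)
    simp only [hs, Set.mem_ofPred_eq, not_le]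
    linarith
  -- The mass of `g` in the region where the cutoff of radius `n + 1` can differ from `1`.
  set T : ℕ → ℝ := fun n => l2norm ((s n).indicator g) with hT
  have hT0 : Tendsto T atTop (𝓝 0) := tendsto_l2norm_indicator hsm hst hg
  have hTG : ∀ n, T n ≤ G := fun n => l2norm_mono hg fun x => norm_indicator_le_norm_self _ _
  have hTn : ∀ n, 0 ≤ T n := fun n => l2norm_nonneg _
  have hTm : ∀ n, MemLp ((s n).indicator g) 2 volume := fun n => MemLp.indicator (hsm n) hg
  -- Chosen so that the square root in the energy estimate is at most `R D` for every radius `R ≥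
  -- 1`.
  set D := √((2 * C * G) ^ 2 + 2 * (a + |d| + |z.re|) * G ^ 2) with hD
  -- The gradient of the cutoff gives `T n / R` and the quadratic lower bound on `V` gives `R`; the
  -- powers of `R` cancel exactly and `T n` remains.
  have hmain : ∀ n : ℕ, |z.im| * (l2norm fun x => cutoff 0 (n + 1) x * g x) ^ 2
      ≤ 2 * C * D * T n := by
    intro n
    set R : ℝ := (n : ℝ) + 1 with hR
    have hR1 : 1 ≤ R := by
      have : (0 : ℝ) ≤ n := Nat.cast_nonneg n
      linarith
    have hR0 : 0 < R := by linarith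
    have hχ := cutoff_contDiff 0 R
    have h1 := weakSolution_energy_estimate hA hV hc hc1 hg hw hχ
      (cutoff_hasCompactSupport 0 hR0) (conj_cutoff 0 R) (norm_cutoff_le 0 R)
      (K := a * R ^ 2 + |d|) (fun x hx => by
        have h2 : ‖x‖ < R := by
          by_contra h
          exact hx (cutoff_eq_zero hR0 (by simpa using h))
        have h3 : ‖x‖ ^ 2 ≤ R ^ 2 := by gcongr
        have h4 := hVd x
        have h5 := neg_abs_le d
        nlinarith)
    set N := l2norm fun x => cutoff 0 R x * g x
    set Q := l2norm fun x => -(2 * I) * wirtinger c (cutoff 0 R) x * g x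
    have hN : N ≤ G := l2norm_mono hg fun x => by
      rw [norm_mul]
      exact mul_le_of_le_one_left (norm_nonneg _) (norm_cutoff_le 0 R x)
    have hN0 : 0 ≤ N := l2norm_nonneg _
    have hQ0 : 0 ≤ Q := l2norm_nonneg _
    have hQ : Q ≤ 2 * C / R * T n := by
      refine l2norm_le_mul (by positivity) (hTm n) fun x => ?_
      by_cases hx : x ∈ s n
      · rw [Set.indicator_of_mem hx, norm_mul, norm_mul, norm_neg, norm_mul, Complex.norm_I,
          mul_one, Complex.norm_ofNat]
        have := (hC 0 R hR0 x).1
        rw [mul_div_assoc]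
        gcongr
      · have hx' : ‖x - 0‖ < R / 2 := by
          rw [sub_zero]
          simpa [hs] using hx
        rw [wirtinger_cutoff_eq_zero hR0 hx', Set.indicator_of_notMem hx]
        simp
    have hsq : √(Q ^ 2 + 2 * (a * R ^ 2 + |d| + |z.re|) * N ^ 2) ≤ R * D := by
      rw [hD, ← Real.sqrt_sq hR0.le, ← Real.sqrt_mul (sq_nonneg R), Real.sqrt_sq hR0.le]
      refine Real.sqrt_le_sqrt ?_
      have hQ2 : Q ≤ R * (2 * C * G) := by
        refine hQ.trans ?_
        have h6 : 2 * C / R ≤ R * (2 * C) := by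
          rw [div_le_iff₀ hR0]
          nlinarith [mul_nonneg hC0.le (by nlinarith : 0 ≤ R * R - 1)]
        calc 2 * C / R * T n ≤ R * (2 * C) * G := mul_le_mul h6 (hTG n) (hTn n) (by positivity)
          _ = _ := by ring
      have h7 : Q ^ 2 ≤ R ^ 2 * (2 * C * G) ^ 2 := by
        rw [← mul_pow]
        gcongr
      have h8 : a * R ^ 2 + |d| + |z.re| ≤ R ^ 2 * (a + |d| + |z.re|) := by
        nlinarith [abs_nonneg d, abs_nonneg z.re, mul_nonneg (sub_nonneg.2 hR1) (sub_nonneg.2 hR1)]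
      have h9 : N ^ 2 ≤ G ^ 2 := by gcongr
      have h10 : (a * R ^ 2 + |d| + |z.re|) * N ^ 2 ≤ R ^ 2 * (a + |d| + |z.re|) * G ^ 2 :=
        mul_le_mul h8 h9 (sq_nonneg _) (by positivity)
      nlinarith
    refine h1.trans ?_
    calc _ ≤ (2 * C / R * T n) * (R * D) := mul_le_mul hQ hsq (Real.sqrt_nonneg _)
          (mul_nonneg (by positivity) (hTn n))
      _ = _ := by field_simp
  -- Split `g` into its cut off part, controlled by the previous bound, and the remainder,
  -- controlled by the tail.
  have hGle : ∀ n, G ≤ √(2 * C * D * T n / |z.im|) + T n := by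
    intro n
    have hR0 : (0 : ℝ) < (n : ℝ) + 1 := by positivity
    set N := l2norm fun x => cutoff 0 ((n : ℝ) + 1) x * g x with hN
    have h1 : N ≤ √(2 * C * D * T n / |z.im|) := by
      refine Real.le_sqrt_of_sq_le ?_
      rw [le_div_iff₀ hzp, mul_comm]
      exact hmain n
    have mχ : MemLp (fun x => cutoff 0 ((n : ℝ) + 1) x * g x) 2 volume := by
      refine hg.of_le ((cutoff_contDiff 0 _).continuous.aestronglyMeasurable.mul hg.1)
        (Eventually.of_forall fun x => ?_)
      rw [norm_mul]
      exact mul_le_of_le_one_left (norm_nonneg _) (norm_cutoff_le 0 _ x)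
    have h2 := l2norm_add_le mχ (hg.sub mχ)
    simp only [Pi.sub_apply, add_sub_cancel] at h2
    have h3 : l2norm (g - fun x => cutoff 0 ((n : ℝ) + 1) x * g x) ≤ T n := by
      refine l2norm_mono (hTm n) fun x => ?_
      simp only [Pi.sub_apply]
      by_cases hx : x ∈ s n
      · rw [Set.indicator_of_mem hx, ← one_sub_mul, norm_mul]
        refine mul_le_of_le_one_left (norm_nonneg _) ?_
        rw [cutoff, ← Complex.ofReal_one, ← Complex.ofReal_sub, Complex.norm_real,
          Real.norm_of_nonneg (sub_nonneg.2 planeBump.le_one)]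
        linarith [planeBump.nonneg (x := ((n : ℝ) + 1)⁻¹ • (x - 0))]
      · have hx' : ‖x - 0‖ ≤ ((n : ℝ) + 1) / 2 := by
          rw [sub_zero]
          simp only [hs, Set.mem_ofPred_eq, not_le] at hx
          exact hx.le
        rw [cutoff_eq_one hR0 hx', Set.indicator_of_notMem hx]
        simp
    linarith
  have hlim : Tendsto (fun n => √(2 * C * D * T n / |z.im|) + T n) atTop (𝓝 0) := by
    have h := ((((hT0.const_mul (2 * C * D)).div_const |z.im|)).sqrt).add hT0
    simpa using h
  have hG00 : G = 0 := le_antisymm (ge_of_tendsto' hlim hGle) hG0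
  have h0 : eLpNorm g 2 volume = 0 := by
    rw [hG, l2norm, ENNReal.toReal_eq_zero_iff] at hG00
    exact hG00.resolve_right hg.eLpNorm_ne_top
  exact (eLpNorm_eq_zero_iff hg.1 two_ne_zero).1 h0

end EnergyEstimate

/-! ### From scalar components to the Pauli operator -/

noncomputable section PauliRealization

open Complex (I)
open scoped ENNReal

theorem memLp_spinor_apply {u : Plane → Spinor} (hu : MemLp u 2 volume) (j : Fin 2) :
    MemLp (fun x => u x j) 2 volume := by
  refine hu.of_le ((EuclideanSpace.proj j : Spinor →L[ℂ] ℂ).continuous.comp_aestronglyMeasurable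
    hu.1) (Eventually.of_forall fun x => PiLp.norm_apply_le (u x) j)

theorem inner_toLp_spinor {u : Plane → Spinor} (hu : MemLp u 2 volume) (G : PauliHilbert) :
    inner ℂ (hu.toLp u) G = ∑ j : Fin 2, ∫ x, (starRingEnd ℂ) (u x j) * G x j := by
  rw [L2.inner_def, ← integral_finsetSum _ fun j _ =>
    integrable_conj_mul (memLp_spinor_apply hu j) (memLp_spinor_apply (Lp.memLp G) j)]
  refine integral_congr_ae ?_
  filter_upwards [hu.coeFn_toLp] with x hx
  rw [hx, PiLp.inner_apply]
  simp [mul_comm]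

variable {A : Plane → Plane} {V : Plane → ℝ}

/-- A test spinor as a vector in the domain of the minimal Pauli operator. -/
def domainVector (hA : ContDiff ℝ 1 A) (hV : Continuous V) (φ : testSpinors) :
    (pauliMinimal A V hA hV).domain := ⟨testSpinorsToL2 φ, φ, rfl⟩

theorem coe_domainVector (hA : ContDiff ℝ 1 A) (hV : Continuous V) (φ : testSpinors) :
    (domainVector hA hV φ : PauliHilbert) = testSpinorsToL2 φ := rfl

theorem exists_domainVector (hA : ContDiff ℝ 1 A) (hV : Continuous V)
    (x : (pauliMinimal A V hA hV).domain) : ∃ φ, x = domainVector hA hV φ := by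
  obtain ⟨_, φ, rfl⟩ := x
  exact ⟨φ, rfl⟩

theorem pauliMinimal_apply (hA : ContDiff ℝ 1 A) (hV : Continuous V) (φ : testSpinors) :
    pauliMinimal A V hA hV (domainVector hA hV φ) = pauliOnTest A V hA hV φ := by
  change pauliOnTest A V hA hV ((LinearEquiv.ofInjective testSpinorsToL2
    testSpinorsToL2_injective).symm ⟨testSpinorsToL2 φ, φ, rfl⟩) = _
  congr 1
  rw [LinearEquiv.symm_apply_eq]
  rfl

theorem testSpinors_contDiff_two (φ : testSpinors) : ContDiff ℝ 2 (φ : Plane → Spinor) :=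
  φ.2.1.of_le (by norm_cast)

theorem spinor_apply_contDiff {n : WithTop ℕ∞} {φ : Plane → Spinor} (hφ : ContDiff ℝ n φ)
    (j : Fin 2) : ContDiff ℝ n (fun x => φ x j) :=
  ((EuclideanSpace.proj j : Spinor →L[ℂ] ℂ).restrictScalars ℝ).contDiff.comp hφ

theorem spinor_apply_hasCompactSupport {φ : Plane → Spinor} (hφ : HasCompactSupport φ)
    (j : Fin 2) : HasCompactSupport (fun x => φ x j) :=
  hφ.comp_left (g := fun v : Spinor => v j) rfl

theorem inner_testSpinors (hA : ContDiff ℝ 1 A) (hV : Continuous V) (φ χ : testSpinors) :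
    inner ℂ (pauliOnTest A V hA hV φ) (testSpinorsToL2 χ)
      = inner ℂ (testSpinorsToL2 φ) (pauliOnTest A V hA hV χ) := by
  have e1 : inner ℂ (pauliOnTest A V hA hV φ) (testSpinorsToL2 χ) = ∑ j : Fin 2,
      ∫ x, (starRingEnd ℂ) (scalarPauli A V (spinUnit j) (fun y => φ.1 y j) x) * χ.1 x j := by
    refine (inner_toLp_spinor (pauliExpr_memLp hA hV φ) _).trans
      (Finset.sum_congr rfl fun j _ => ?_)
    refine integral_congr_ae ?_
    filter_upwards [(testSpinors_memLp χ).coeFn_toLp] with x hx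
    have hx' : (testSpinorsToL2 χ) x = χ.1 x := hx
    rw [hx', pauliExpr_apply hA (testSpinors_contDiff_two φ)]
  have e2 : inner ℂ (testSpinorsToL2 φ) (pauliOnTest A V hA hV χ) = ∑ j : Fin 2,
      ∫ x, (starRingEnd ℂ) (φ.1 x j) * scalarPauli A V (spinUnit j) (fun y => χ.1 y j) x := by
    refine (inner_toLp_spinor (testSpinors_memLp φ) _).trans (Finset.sum_congr rfl fun j _ => ?_)
    refine integral_congr_ae ?_
    filter_upwards [(pauliExpr_memLp hA hV χ).coeFn_toLp] with x hx
    have hx' : (pauliOnTest A V hA hV χ) x = pauliExpr A V χ x := hx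
    rw [hx', pauliExpr_apply hA (testSpinors_contDiff_two χ)]
  rw [e1, e2]
  refine Finset.sum_congr rfl fun j _ => ?_
  exact (integral_conj_mul_scalarPauli hA hV (conj_spinUnit j)
    (spinor_apply_contDiff (testSpinors_contDiff_two φ) j)
    (spinor_apply_contDiff (testSpinors_contDiff_two χ) j)
    (spinor_apply_hasCompactSupport φ.2.2 j)).symm

theorem pauliMinimal_symmetric (hA : ContDiff ℝ 1 A) (hV : Continuous V) :
    (pauliMinimal A V hA hV).IsFormalAdjoint (pauliMinimal A V hA hV) := by
  intro x y
  obtain ⟨φ, rfl⟩ := exists_domainVector hA hV x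
  obtain ⟨χ, rfl⟩ := exists_domainVector hA hV y
  rw [pauliMinimal_apply, pauliMinimal_apply]
  exact inner_testSpinors hA hV φ χ

theorem pauliMinimal_dense (hA : ContDiff ℝ 1 A) (hV : Continuous V) :
    Dense ((pauliMinimal A V hA hV).domain : Set PauliHilbert) := by
  refine (Lp.dense_hasCompactSupport_contDiff (E := Plane) (F := Spinor) (μ := volume) (p := 2)
    ENNReal.ofNat_ne_top).mono ?_
  rintro f ⟨g, hfg, hgc, hg⟩
  refine ⟨⟨g, hg, hgc⟩, ?_⟩
  refine Lp.ext ?_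
  exact (testSpinors_memLp ⟨g, hg, hgc⟩).coeFn_toLp.trans hfg.symm

/-- The spinor field whose only nonzero component is `f`, in position `j`. -/
def spinorSingle (j : Fin 2) (f : Plane → ℂ) (x : Plane) : Spinor := EuclideanSpace.single j (f x)

theorem spinorSingle_apply (j i : Fin 2) (f : Plane → ℂ) (x : Plane) :
    spinorSingle j f x i = if i = j then f x else 0 := by
  simp [spinorSingle]

theorem spinorSingle_contDiff {n : WithTop ℕ∞} {f : Plane → ℂ} (hf : ContDiff ℝ n f) (j : Fin 2) :
    ContDiff ℝ n (spinorSingle j f) := by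
  have h : spinorSingle j f = fun x => f x • (EuclideanSpace.single j 1 : Spinor) := by
    funext x
    ext i
    simp [spinorSingle]
  rw [h]
  exact hf.smul contDiff_const

theorem spinorSingle_hasCompactSupport {f : Plane → ℂ} (hf : HasCompactSupport f) (j : Fin 2) :
    HasCompactSupport (spinorSingle j f) :=
  hf.comp_left (g := fun a : ℂ => (EuclideanSpace.single j a : Spinor)) (by simp)

/-- A scalar test function as a test spinor with one nonzero component. -/
def testSingle (j : Fin 2) (f : Plane → ℂ) (hf : ContDiff ℝ ∞ f) (hfc : HasCompactSupport f) :
    testSpinors :=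
  ⟨spinorSingle j f, spinorSingle_contDiff hf j, spinorSingle_hasCompactSupport hfc j⟩

theorem scalarPauli_zero (c : ℂ) (x : Plane) : scalarPauli A V c (fun _ => 0) x = 0 := by
  have h : momentum A c (fun _ => 0) = fun _ => 0 := by
    funext y; simp [momentum, wirtinger_const]
  simp [scalarPauli, h, momentum, wirtinger_const]

theorem pauliExpr_spinorSingle (hA : ContDiff ℝ 1 A) {f : Plane → ℂ} (hf : ContDiff ℝ 2 f)
    (j : Fin 2) :
    pauliExpr A V (spinorSingle j f) = spinorSingle j (scalarPauli A V (spinUnit j) f) := by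
  funext x
  ext i
  rw [pauliExpr_apply hA (spinorSingle_contDiff hf j), spinorSingle_apply]
  simp only [spinorSingle_apply]
  split_ifs with h
  · rw [h]
  · exact scalarPauli_zero _ _

/-- Testing with spinors that have a single nonzero component, orthogonality to the range says that
each component of `G` is a weak solution for its own `c = ±i`, hence zero. -/
theorem pauliMinimal_range_dense (hA : ContDiff ℝ 1 A) (hV : Continuous V)
    (hgrowth : ∃ a d : ℝ, 0 < a ∧ ∀ x : Plane, -a * ‖x‖ ^ 2 + d ≤ V x) {z : ℂ} (hz : z.im ≠ 0)
    (G : PauliHilbert)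
    (hG : ∀ x : (pauliMinimal A V hA hV).domain,
      inner ℂ (pauliMinimal A V hA hV x - z • (x : PauliHilbert)) G = 0) : G = 0 := by
  have hcomp : ∀ j : Fin 2, (fun x => G x j) =ᵐ[volume] 0 := by
    intro j
    refine weakSolution_eq_zero (z := z) hA hV hgrowth (conj_spinUnit j) (norm_spinUnit j) hz
      (memLp_spinor_apply (Lp.memLp G) j) fun f hf hfc => ?_
    have hf2 : ContDiff ℝ 2 f := hf.of_le (by norm_cast)
    have h := hG (domainVector hA hV (testSingle j f hf hfc))
    rw [pauliMinimal_apply, coe_domainVector] at h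
    set ψ := testSingle j f hf hfc
    have hm : MemLp (fun x => pauliExpr A V ψ x - z • (ψ : Plane → Spinor) x) 2 volume :=
      (pauliExpr_memLp hA hV ψ).sub ((testSpinors_memLp ψ).const_smul z)
    have e : pauliOnTest A V hA hV ψ - z • testSpinorsToL2 ψ = hm.toLp _ := by
      change (pauliExpr_memLp hA hV ψ).toLp _ - z • (testSpinors_memLp ψ).toLp _ = _
      rw [← MemLp.toLp_const_smul, ← MemLp.toLp_sub]
      rfl
    rw [e] at h
    rw [inner_toLp_spinor, Finset.sum_eq_single j] at h
    · rw [← h]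
      refine integral_congr_ae (Eventually.of_forall fun x => ?_)
      have h1 : pauliExpr A V ψ x j = scalarPauli A V (spinUnit j) f x := by
        change pauliExpr A V (spinorSingle j f) x j = _
        rw [pauliExpr_spinorSingle hA hf2, spinorSingle_apply, if_pos rfl]
      have h2 : (ψ : Plane → Spinor) x j = f x := by
        change spinorSingle j f x j = _
        rw [spinorSingle_apply, if_pos rfl]
      simp only [PiLp.sub_apply, PiLp.smul_apply, smul_eq_mul, h1, h2]
    · intro i _ hij
      have h0 : ∀ x, (pauliExpr A V ψ x - z • (ψ : Plane → Spinor) x) i = 0 := by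
        intro x
        have h1 : pauliExpr A V ψ x i = 0 := by
          change pauliExpr A V (spinorSingle j f) x i = _
          rw [pauliExpr_spinorSingle hA hf2, spinorSingle_apply, if_neg hij]
        have h2 : (ψ : Plane → Spinor) x i = 0 := by
          change spinorSingle j f x i = _
          rw [spinorSingle_apply, if_neg hij]
        simp [h1, h2]
      simp only [h0]
      simp
    · intro hj
      exact absurd (Finset.mem_univ j) hj
  refine Lp.ext ?_
  filter_upwards [hcomp 0, hcomp 1, Lp.coeFn_zero Spinor 2 (volume : Measure Plane)] with x h0 h1 h2
  rw [h2]
  ext i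
  fin_cases i
  · exact h0
  · exact h1

theorem unboundedSpectrum_pauliOperator_subset (hA : ContDiff ℝ 1 A) (hV : Continuous V)
    (hgrowth : ∃ a d : ℝ, 0 < a ∧ ∀ x : Plane, -a * ‖x‖ ^ 2 + d ≤ V x) :
    unboundedSpectrum (pauliOperator A V hA hV) ⊆ Set.range ((↑) : ℝ → ℂ) := by
  intro z hz
  by_contra h
  have him : z.im ≠ 0 := fun h0 => h ⟨z.re, Complex.ext (by simp) (by simp [h0])⟩
  exact hz (mem_unboundedResolventSet_closure (pauliMinimal_dense hA hV)
    (pauliMinimal_symmetric hA hV) him (pauliMinimal_range_dense hA hV hgrowth him))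

theorem l2norm_spinorSingle (j : Fin 2) (f : Plane → ℂ) : l2norm (spinorSingle j f) = l2norm f := by
  rw [l2norm, l2norm]
  congr 1
  refine eLpNorm_congr_norm_ae (Eventually.of_forall fun x => ?_)
  simp [spinorSingle]

/-- Twice continuously differentiable compactly supported functions are approximated by test
functions in the graph norm of `scalarPauli`. -/
theorem tendsto_scalarPauli_smoothing (hA : ContDiff ℝ 1 A) (hV : Continuous V) {c : ℂ}
    {u : Plane → ℂ} (hu : ContDiff ℝ 2 u) (huc : HasCompactSupport u) :
    Tendsto (fun n => l2norm fun x => scalarPauli A V c (smoothing (mollifier n) u) x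
      - scalarPauli A V c u x) atTop (𝓝 0) := by
  obtain ⟨S, hS⟩ := huc.isCompact.isBounded.subset_closedBall (0 : Plane)
  have hcont : ∀ a, Continuous (complexPotential A a) := fun a =>
    (complexPotential_contDiff hA).continuous
  have hex : ∀ f : Plane → ℂ, Continuous f → ∃ M : ℝ, 0 ≤ M ∧
      ∀ x ∈ Metric.closedBall (0 : Plane) (S + 1), ‖f x‖ ≤ M := fun f hf => by
    obtain ⟨M, hM⟩ := (isCompact_closedBall (0 : Plane) (S + 1)).exists_bound_of_continuousOn
      hf.continuousOn
    exact ⟨max M 0, le_max_right _ _, fun x hx => (hM x hx).trans (le_max_left _ _)⟩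
  obtain ⟨M₁, hM₁0, hM₁⟩ := hex _ (hcont c)
  obtain ⟨M₂, hM₂0, hM₂⟩ := hex _ (hcont (-c))
  obtain ⟨M₃, hM₃0, hM₃⟩ := hex _ (pauliPotential_continuous hA hV c)
  have hu1 : ∀ a, ContDiff ℝ 1 (wirtinger a u) := fun a => wirtinger_contDiff hu (by norm_num)
  have hu1c : ∀ a, HasCompactSupport (wirtinger a u) := fun a => wirtinger_hasCompactSupport huc
  have hu2 : Continuous (wirtinger (-c) (wirtinger c u)) :=
    (wirtinger_contDiff (n := 0) (hu1 c) (by simp)).continuous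
  have hu2c : HasCompactSupport (wirtinger (-c) (wirtinger c u)) :=
    wirtinger_hasCompactSupport (hu1c c)
  have m0 : MemLp u 2 volume := hu.continuous.memLp_of_hasCompactSupport huc
  have m1 : ∀ a, MemLp (wirtinger a u) 2 volume := fun a =>
    (hu1 a).continuous.memLp_of_hasCompactSupport (hu1c a)
  have m2 : MemLp (wirtinger (-c) (wirtinger c u)) 2 volume :=
    hu2.memLp_of_hasCompactSupport hu2c
  set δ : (Plane → ℂ) → ℕ → Plane → ℂ := fun f n x => smoothing (mollifier n) f x - f x with hδ
  have hδm : ∀ {f}, MemLp f 2 volume → ∀ n, MemLp (δ f n) 2 volume := fun hf n =>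
    (memLp_smoothing_mollifier n hf).sub hf
  have hδ0 : ∀ {f : Plane → ℂ}, (∀ x, S < ‖x‖ → f x = 0) → ∀ n x,
      x ∉ Metric.closedBall (0 : Plane) (S + 1) → δ f n x = 0 := by
    intro f hf n x hx
    rw [mem_closedBall_zero_iff, not_le] at hx
    have h1 : smoothing (mollifier n) f x = 0 := by
      rw [smoothing_eq]
      refine integral_eq_zero_of_ae (Eventually.of_forall fun y => ?_)
      by_cases hy : S < ‖y‖
      · simp [hf y hy]
      · have h2 : 1 / ((n : ℝ) + 1) ≤ ‖x - y‖ := by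
          have h3 : 1 / ((n : ℝ) + 1) ≤ 1 := by
            rw [div_le_one (by positivity)]
            have : (0 : ℝ) ≤ n := Nat.cast_nonneg n
            linarith
          have := norm_sub_norm_le x y
          linarith
        simp [mollifier_eq_zero h2]
    simp only [hδ, h1, hf x (by linarith), sub_zero]
  have hz0 : ∀ x, S < ‖x‖ → x ∉ tsupport u := fun x hx h => by
    have := mem_closedBall_zero_iff.1 (hS h)
    linarith
  have z0 : ∀ x, S < ‖x‖ → u x = 0 := fun x hx => image_eq_zero_of_notMem_tsupport (hz0 x hx)
  have z1 : ∀ a x, S < ‖x‖ → wirtinger a u x = 0 := fun a x hx => by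
    have h1 : fderiv ℝ u x = 0 :=
      image_eq_zero_of_notMem_tsupport (fun h => hz0 x hx (tsupport_fderiv_subset ℝ h))
    simp [wirtinger, h1]
  -- All derivatives are moved onto `u`, so the difference is a combination of mollification errors
  -- of `u` and its derivatives with continuous coefficients. These errors vanish off a fixed ball,
  -- where the coefficients are bounded.
  have hexp : ∀ n x, scalarPauli A V c (smoothing (mollifier n) u) x - scalarPauli A V c u x
      = -δ (wirtinger (-c) (wirtinger c u)) n x
        + I * complexPotential A c x * δ (wirtinger (-c) u) n x
        + I * complexPotential A (-c) x * δ (wirtinger c u) n x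
        + pauliPotential A V c x * δ u n x := by
    intro n x
    have hk := (mollifier_contDiff n).continuous
    have hs : ContDiff ℝ 2 (smoothing (mollifier n) u) :=
      (smoothing_contDiff (mollifier_contDiff n) (mollifier_hasCompactSupport n)
        hu.continuous.locallyIntegrable).of_le (by norm_cast)
    have hu1' : ContDiff ℝ 1 u := hu.of_le one_le_two
    rw [scalarPauli_eq V hA c hs, scalarPauli_eq V hA c hu, wirtinger_smoothing_right hu1' huc hk,
      wirtinger_smoothing_right hu1' huc hk, wirtinger_smoothing_right (hu1 c) (hu1c c) hk]
    simp only [hδ]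
    ring
  have hmul : ∀ {a f : Plane → ℂ} {M : ℝ}, 0 ≤ M → Continuous a →
      (∀ x ∈ Metric.closedBall (0 : Plane) (S + 1), ‖a x‖ ≤ M) → MemLp f 2 volume →
      (∀ x, S < ‖x‖ → f x = 0) → ∀ n,
      MemLp (fun x => a x * δ f n x) 2 volume ∧
        l2norm (fun x => a x * δ f n x) ≤ M * l2norm (δ f n) := by
    intro a f M hM0 ha haM hf hf0 n
    have hle : ∀ x, ‖a x * δ f n x‖ ≤ M * ‖δ f n x‖ := by
      intro x
      by_cases hx : x ∈ Metric.closedBall (0 : Plane) (S + 1)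
      · rw [norm_mul]
        gcongr
        exact haM x hx
      · rw [hδ0 hf0 n x hx]; simp
    refine ⟨((hδm hf n).const_mul (M : ℂ)).of_le (ha.aestronglyMeasurable.mul (hδm hf n).1)
      (Eventually.of_forall fun x => ?_), l2norm_le_mul hM0 (hδm hf n) hle⟩
    rw [norm_mul (M : ℂ), Complex.norm_real, Real.norm_of_nonneg hM0]
    exact hle x
  have hc1 : Continuous fun x => I * complexPotential A c x := continuous_const.mul (hcont c)
  have hc2 : Continuous fun x => I * complexPotential A (-c) x := continuous_const.mul (hcont (-c))
  have b1 := hmul hM₁0 hc1 (fun x hx => by simpa using hM₁ x hx) (m1 (-c)) (z1 (-c))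
  have b2 := hmul hM₂0 hc2 (fun x hx => by simpa using hM₂ x hx) (m1 c) (z1 c)
  have b3 := hmul hM₃0 (pauliPotential_continuous hA hV c) hM₃ m0 z0
  have hlim := (((tendsto_smoothing m2).add ((tendsto_smoothing (m1 (-c))).const_mul M₁)).add
    ((tendsto_smoothing (m1 c)).const_mul M₂)).add ((tendsto_smoothing m0).const_mul M₃)
  simp only [mul_zero, add_zero] at hlim
  refine squeeze_zero (fun n => l2norm_nonneg _) (fun n => ?_) hlim
  simp only [hexp]
  have k0 : MemLp (fun x => -δ (wirtinger (-c) (wirtinger c u)) n x) 2 volume := (hδm m2 n).neg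
  have k0n : l2norm (fun x => -δ (wirtinger (-c) (wirtinger c u)) n x)
      ≤ l2norm (δ (wirtinger (-c) (wirtinger c u)) n) :=
    l2norm_mono (hδm m2 n) fun x => by rw [norm_neg]
  have k1 := k0.add (b1 n).1
  have k2 := k1.add (b2 n).1
  refine (l2norm_add_le k2 (b3 n).1).trans (add_le_add ?_ (b3 n).2)
  refine (l2norm_add_le k1 (b2 n).1).trans (add_le_add ?_ (b2 n).2)
  exact (l2norm_add_le k0 (b1 n).1).trans (add_le_add k0n (b1 n).2)

/-- Approximate eigenfunctions of one spin component give points of the spectrum. -/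
theorem mem_spectrum_of_approximate_eigenfunctions (hA : ContDiff ℝ 1 A) (hV : Continuous V)
    {a : ℝ} (h : ∀ δ : ℝ, 0 < δ → ∃ (j : Fin 2) (u : Plane → ℂ), ContDiff ℝ 2 u ∧
      HasCompactSupport u ∧
      l2norm (fun x => scalarPauli A V (spinUnit j) u x - a * u x) < δ * l2norm u) :
    (a : ℂ) ∈ unboundedSpectrum (pauliOperator A V hA hV) := by
  refine mem_unboundedSpectrum_closure fun δ hδ => ?_
  obtain ⟨j, u, hu, huc, hlt⟩ := h δ hδ
  set c := spinUnit j
  have hus : ∀ n, ContDiff ℝ ∞ (smoothing (mollifier n) u) := fun n =>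
    smoothing_contDiff (mollifier_contDiff n) (mollifier_hasCompactSupport n)
      hu.continuous.locallyIntegrable
  have husc : ∀ n, HasCompactSupport (smoothing (mollifier n) u) := fun n =>
    smoothing_hasCompactSupport (mollifier_hasCompactSupport n) huc
  have hum : MemLp u 2 volume := hu.continuous.memLp_of_hasCompactSupport huc
  have hunm := fun n => memLp_smoothing_mollifier n hum
  have hPm : ∀ {f : Plane → ℂ}, ContDiff ℝ 2 f → HasCompactSupport f →
      MemLp (fun x => scalarPauli A V c f x - a * f x) 2 volume := fun hf hfc =>
    ((scalarPauli_continuous hA hV c hf).sub (continuous_const.mul hf.continuous)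
      ).memLp_of_hasCompactSupport ((scalarPauli_hasCompactSupport hfc).sub
        (hfc.mul_left (f := fun _ => (a : ℂ))))
  have hSm : ∀ {f : Plane → ℂ}, ContDiff ℝ 2 f → HasCompactSupport f →
      MemLp (scalarPauli A V c f) 2 volume := fun hf hfc =>
    (scalarPauli_continuous hA hV c hf).memLp_of_hasCompactSupport
      (scalarPauli_hasCompactSupport hfc)
  have hus2 : ∀ n, ContDiff ℝ 2 (smoothing (mollifier n) u) := fun n => (hus n).of_le (by norm_cast)
  have t1 : Tendsto (fun n => l2norm (smoothing (mollifier n) u)) atTop (𝓝 (l2norm u)) :=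
    tendsto_l2norm_of_sub hunm hum (tendsto_smoothing hum)
  have t2 : Tendsto (fun n => l2norm fun x => scalarPauli A V c (smoothing (mollifier n) u) x
      - a * smoothing (mollifier n) u x) atTop
      (𝓝 (l2norm fun x => scalarPauli A V c u x - a * u x)) := by
    refine tendsto_l2norm_of_sub (fun n => hPm (hus2 n) (husc n)) (hPm hu huc) ?_
    have h3 := (tendsto_scalarPauli_smoothing hA hV (c := c) hu huc).add
      ((tendsto_smoothing hum).const_mul |a|)
    simp only [mul_zero, add_zero] at h3
    refine squeeze_zero (fun n => l2norm_nonneg _) (fun n => ?_) h3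
    have e : (fun x => scalarPauli A V c (smoothing (mollifier n) u) x
        - a * smoothing (mollifier n) u x - (scalarPauli A V c u x - a * u x))
        = fun x => (scalarPauli A V c (smoothing (mollifier n) u) x - scalarPauli A V c u x)
          - a * (smoothing (mollifier n) u x - u x) := by
      funext x; ring
    have m1 : MemLp (fun x => smoothing (mollifier n) u x - u x) 2 volume := (hunm n).sub hum
    rw [e]
    refine (l2norm_sub_le ((hSm (hus2 n) (husc n)).sub (hSm hu huc))
      (m1.const_mul (a : ℂ))).trans (add_le_add le_rfl ?_)
    refine l2norm_le_mul (abs_nonneg a) m1 fun x => ?_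
    rw [norm_mul, Complex.norm_real, Real.norm_eq_abs]
  -- The inequality for `u` is strict, so it persists for a sufficiently fine mollification, which
  -- is a legitimate test function.
  obtain ⟨n, hn⟩ := (t2.eventually_lt (t1.const_mul δ) hlt).exists
  set f := smoothing (mollifier n) u
  set ψ := testSingle j f (hus n) (husc n)
  refine ⟨domainVector hA hV ψ, ?_⟩
  rw [pauliMinimal_apply, coe_domainVector]
  have e1 : ‖testSpinorsToL2 ψ‖ = l2norm f := by
    change ‖(testSpinors_memLp ψ).toLp _‖ = _
    rw [l2norm_toLp]
    exact l2norm_spinorSingle j f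
  have hm : MemLp (fun x => pauliExpr A V ψ x - (a : ℂ) • (ψ : Plane → Spinor) x) 2 volume :=
    (pauliExpr_memLp hA hV ψ).sub ((testSpinors_memLp ψ).const_smul (a : ℂ))
  have e : pauliOnTest A V hA hV ψ - (a : ℂ) • testSpinorsToL2 ψ = hm.toLp _ := by
    change (pauliExpr_memLp hA hV ψ).toLp _ - (a : ℂ) • (testSpinors_memLp ψ).toLp _ = _
    rw [← MemLp.toLp_const_smul, ← MemLp.toLp_sub]
    rfl
  have e2 : (fun x => pauliExpr A V ψ x - (a : ℂ) • (ψ : Plane → Spinor) x)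
      = spinorSingle j fun x => scalarPauli A V c f x - a * f x := by
    funext x
    have h1 : pauliExpr A V ψ x = spinorSingle j (scalarPauli A V c f) x :=
      congrFun (pauliExpr_spinorSingle hA (hus2 n) j) x
    have h2 : (ψ : Plane → Spinor) x = spinorSingle j f x := rfl
    rw [h1, h2]
    ext i
    simp only [PiLp.sub_apply, PiLp.smul_apply, smul_eq_mul, spinorSingle_apply]
    split_ifs <;> simp
  rw [e, e1]
  rw [l2norm_toLp, e2, l2norm_spinorSingle]
  exact hn

end PauliRealization

/-! ### The Poincaré gauge -/

noncomputable section PoincareGauge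

theorem fderiv_plane_apply {A : Plane → Plane} {x : Plane} (hA : DifferentiableAt ℝ A x)
    (v : Plane) (j : Fin 2) : fderiv ℝ (fun y => A y j) x v = (fderiv ℝ A x v) j := by
  have h : HasFDerivAt (fun y => A y j)
      ((EuclideanSpace.proj j : Plane →L[ℝ] ℝ).comp (fderiv ℝ A x)) x :=
    (EuclideanSpace.proj j : Plane →L[ℝ] ℝ).hasFDerivAt.comp x hA.hasFDerivAt
  rw [h.fderiv]
  rfl

theorem plane_eq_sum (v : Plane) : v = v 0 • planeUnit 0 + v 1 • planeUnit 1 := by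
  ext i
  fin_cases i <;> simp [planeUnit]

theorem clm_apply_eq (L : Plane →L[ℝ] ℝ) (v : Plane) :
    L v = v 0 * L (planeUnit 0) + v 1 * L (planeUnit 1) := by
  conv_lhs => rw [plane_eq_sum v]
  simp

/-- A closed vector field on the plane is a gradient. -/
theorem exists_potential_of_closed {p q : Plane → ℝ} (hp : ContDiff ℝ 1 p) (hq : ContDiff ℝ 1 q)
    (hpq : ∀ x, fderiv ℝ p x (planeUnit 1) = fderiv ℝ q x (planeUnit 0)) :
    ∃ g : Plane → ℝ, ContDiff ℝ 2 g ∧ ∀ x, fderiv ℝ g x (planeUnit 0) = p x ∧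
      fderiv ℝ g x (planeUnit 1) = q x := by
  let w : Plane → Plane →L[ℝ] ℝ := fun x =>
    p x • (EuclideanSpace.proj 0 : Plane →L[ℝ] ℝ) + q x • (EuclideanSpace.proj 1 : Plane →L[ℝ] ℝ)
  have hw : ContDiff ℝ 1 w := (hp.smul contDiff_const).add (hq.smul contDiff_const)
  have hd : ∀ x v u, fderiv ℝ w x v u = fderiv ℝ p x v * u 0 + fderiv ℝ q x v * u 1 := by
    intro x v u
    have h1 : HasFDerivAt w ((fderiv ℝ p x).smulRight (EuclideanSpace.proj 0 : Plane →L[ℝ] ℝ)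
        + (fderiv ℝ q x).smulRight (EuclideanSpace.proj 1 : Plane →L[ℝ] ℝ)) x :=
      ((hp.differentiable one_ne_zero x).hasFDerivAt.smul_const
        (EuclideanSpace.proj 0 : Plane →L[ℝ] ℝ)).add
        ((hq.differentiable one_ne_zero x).hasFDerivAt.smul_const
          (EuclideanSpace.proj 1 : Plane →L[ℝ] ℝ))
    rw [h1.fderiv]
    simp
  obtain ⟨g, hg⟩ := convex_univ.exists_forall_hasFDerivAt_of_fderiv_symmetric isOpen_univ
    (hw.differentiable one_ne_zero).differentiableOn (fun x _ v u => by
      rw [hd, hd, clm_apply_eq (fderiv ℝ p x) v, clm_apply_eq (fderiv ℝ q x) v,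
        clm_apply_eq (fderiv ℝ p x) u, clm_apply_eq (fderiv ℝ q x) u, hpq]
      ring)
  have hg' : fderiv ℝ g = w := funext fun x => (hg x trivial).fderiv
  refine ⟨g, ?_, fun x => ?_⟩
  · have : ContDiff ℝ (1 + 1) g :=
      contDiff_succ_iff_fderiv.2 ⟨fun x => (hg x trivial).differentiableAt, by simp, hg' ▸ hw⟩
    exact this.of_le (by norm_num)
  · rw [hg']
    simp [w, planeUnit]

/-- The weighted average `∫₀¹ t B(x₀ + t (x - x₀)) dt`. -/
def radialMean (B : Plane → ℝ) (x₀ x : Plane) : ℝ := ∫ t in (0 : ℝ)..1, t * B (x₀ + t • (x - x₀))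

section RadialMean

variable {B : Plane → ℝ}

theorem hasFDerivAt_radialMean (hB : ContDiff ℝ 1 B) (x₀ x : Plane) : HasFDerivAt (radialMean B x₀)
    (∫ t in (0 : ℝ)..1, t ^ 2 • fderiv ℝ B (x₀ + t • (x - x₀))) x := by
  have hc : Continuous fun z : Plane × ℝ => z.2 ^ 2 • fderiv ℝ B (x₀ + z.2 • (z.1 - x₀)) :=
    (continuous_snd.pow 2).smul ((hB.continuous_fderiv one_ne_zero).comp (by fun_prop))
  have hcB : ∀ y : Plane, Continuous fun t : ℝ => t * B (x₀ + t • (y - x₀)) := fun y =>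
    continuous_id.mul (hB.continuous.comp (by fun_prop))
  have hcF : Continuous fun t : ℝ => t ^ 2 • fderiv ℝ B (x₀ + t • (x - x₀)) :=
    hc.comp (continuous_const.prodMk continuous_id)
  obtain ⟨K, hK⟩ := ((isCompact_closedBall x 1).prod (isCompact_Icc (a := (0 : ℝ)) (b := 1)))
    |>.exists_bound_of_continuousOn hc.continuousOn
  refine intervalIntegral.hasFDerivAt_integral_of_dominated_of_fderiv_le
    (F := fun y t => t * B (x₀ + t • (y - x₀)))
    (F' := fun y t => t ^ 2 • fderiv ℝ B (x₀ + t • (y - x₀))) (bound := fun _ => K)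
    (Metric.closedBall_mem_nhds x one_pos)
    (Eventually.of_forall fun y => (hcB y).aestronglyMeasurable)
    ((hcB x).intervalIntegrable _ _) hcF.aestronglyMeasurable
    (Eventually.of_forall fun t ht y hy => hK (y, t) ⟨hy, ?_⟩) intervalIntegrable_const
    (Eventually.of_forall fun t ht y hy => ?_)
  · rw [Set.uIoc_of_le zero_le_one] at ht
    exact ⟨ht.1.le, ht.2⟩
  · have h1 : HasFDerivAt (fun y : Plane => x₀ + t • (y - x₀)) (t • ContinuousLinearMap.id ℝ Plane)
        y := (((hasFDerivAt_id y).sub_const x₀).const_smul t).const_add x₀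
    have h2 := ((hB.differentiable one_ne_zero (x₀ + t • (y - x₀))).hasFDerivAt.comp y h1).const_mul
      t
    have e : t ^ 2 • fderiv ℝ B (x₀ + t • (y - x₀))
        = t • (fderiv ℝ B (x₀ + t • (y - x₀))).comp (t • ContinuousLinearMap.id ℝ Plane) := by
      ext v
      simp
      ring
    rw [e]
    exact h2

theorem radialMean_contDiff (hB : ContDiff ℝ 1 B) (x₀ : Plane) :
    ContDiff ℝ 1 (radialMean B x₀) := by
  refine contDiff_one_iff_fderiv.2 ⟨fun x => (hasFDerivAt_radialMean hB x₀ x).differentiableAt, ?_⟩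
  have e : fderiv ℝ (radialMean B x₀)
      = fun x => ∫ t in (0 : ℝ)..1, t ^ 2 • fderiv ℝ B (x₀ + t • (x - x₀)) :=
    funext fun x => (hasFDerivAt_radialMean hB x₀ x).fderiv
  rw [e]
  refine intervalIntegral.continuous_parametric_intervalIntegral_of_continuous' ?_ 0 1
  exact (continuous_snd.pow 2).smul ((hB.continuous_fderiv one_ne_zero).comp (by fun_prop))

/-- Integrate the derivative of `t² B(x₀ + t (x - x₀))` over `[0, 1]`. The left side is the curl of
`m (-y₂, y₁)`, with `m` the radial mean and `y = x - x₀`, so this field is a vector potential of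
`B`. -/
theorem two_mul_radialMean_add (hB : ContDiff ℝ 1 B) (x₀ x : Plane) :
    2 * radialMean B x₀ x + fderiv ℝ (radialMean B x₀) x (x - x₀) = B x := by
  have hcF : Continuous fun t : ℝ => t ^ 2 • fderiv ℝ B (x₀ + t • (x - x₀)) :=
    (continuous_id.pow 2).smul ((hB.continuous_fderiv one_ne_zero).comp (by fun_prop))
  have hcB : Continuous fun t : ℝ => t * B (x₀ + t • (x - x₀)) :=
    continuous_id.mul (hB.continuous.comp (by fun_prop))
  have hcF' : Continuous fun t : ℝ => t ^ 2 * fderiv ℝ B (x₀ + t • (x - x₀)) (x - x₀) :=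
    hcF.clm_apply continuous_const
  have hder : ∀ t ∈ Set.uIcc (0 : ℝ) 1, HasDerivAt (fun t : ℝ => t ^ 2 * B (x₀ + t • (x - x₀)))
      (2 * (t * B (x₀ + t • (x - x₀))) + t ^ 2 * fderiv ℝ B (x₀ + t • (x - x₀)) (x - x₀)) t := by
    intro t _
    have h1 : HasDerivAt (fun t : ℝ => x₀ + t • (x - x₀)) (x - x₀) t := by
      simpa using ((hasDerivAt_id t).smul_const (x - x₀)).const_add x₀
    have h2 := (hasDerivAt_pow 2 t).mul
      ((hB.differentiable one_ne_zero (x₀ + t • (x - x₀))).hasFDerivAt.comp_hasDerivAt t h1)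
    refine h2.congr_deriv ?_
    simp
    ring
  have h := intervalIntegral.integral_eq_sub_of_hasDerivAt hder
    (((hcB.const_mul 2).add hcF').intervalIntegrable _ _)
  rw [intervalIntegral.integral_add ((hcB.const_mul 2).intervalIntegrable _ _)
    (hcF'.intervalIntegrable _ _), intervalIntegral.integral_const_mul] at h
  rw [(hasFDerivAt_radialMean hB x₀ x).fderiv,
    ContinuousLinearMap.intervalIntegral_apply (hcF.intervalIntegrable _ _)]
  simpa [radialMean] using h

variable {x₀ x : Plane} {R G : ℝ}

/-- Since `∫₀¹ t dt = 1/2`, the difference is the weighted mean of `B - B x₀` along the segment,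
which the mean value inequality bounds. -/
theorem abs_radialMean_sub_le (hB : ContDiff ℝ 1 B)
    (hG : ∀ y, ‖y - x₀‖ ≤ R → ‖fderiv ℝ B y‖ ≤ G) (hx : ‖x - x₀‖ ≤ R) :
    |radialMean B x₀ x - B x₀ / 2| ≤ G * R := by
  have hR : 0 ≤ R := (norm_nonneg _).trans hx
  have hG0 : 0 ≤ G := (norm_nonneg _).trans (hG x hx)
  have hcB : Continuous fun t : ℝ => t * B (x₀ + t • (x - x₀)) :=
    continuous_id.mul (hB.continuous.comp (by fun_prop))
  have e : radialMean B x₀ x - B x₀ / 2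
      = ∫ t in (0 : ℝ)..1, t * (B (x₀ + t • (x - x₀)) - B x₀) := by
    have e1 : (fun t : ℝ => t * (B (x₀ + t • (x - x₀)) - B x₀))
        = fun t => t * B (x₀ + t • (x - x₀)) - t * B x₀ := by funext t; ring
    rw [e1, intervalIntegral.integral_sub (hcB.intervalIntegrable _ _)
      ((by fun_prop : Continuous fun t : ℝ => t * B x₀).intervalIntegrable _ _),
      intervalIntegral.integral_mul_const, integral_id, radialMean]
    ring
  rw [e]
  have h := intervalIntegral.norm_integral_le_of_norm_le_const (a := (0 : ℝ)) (b := 1) (C := G * R)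
    (f := fun t => t * (B (x₀ + t • (x - x₀)) - B x₀)) fun t ht => ?_
  · simpa using h
  rw [Set.uIoc_of_le zero_le_one] at ht
  have hn : ‖t • (x - x₀)‖ ≤ R := by
    rw [norm_smul, Real.norm_of_nonneg ht.1.le]
    nlinarith [norm_nonneg (x - x₀), ht.1, ht.2]
  have h1 : ‖B (x₀ + t • (x - x₀)) - B x₀‖ ≤ G * ‖x₀ + t • (x - x₀) - x₀‖ :=
    (convex_closedBall x₀ R).norm_image_sub_le_of_norm_fderiv_le
      (fun y _ => hB.differentiable one_ne_zero y)
      (fun y hy => hG y (by simpa [dist_eq_norm] using hy))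
      (by simpa using hR) (by simpa [dist_eq_norm] using hn)
  rw [add_sub_cancel_left] at h1
  rw [norm_mul, Real.norm_of_nonneg ht.1.le]
  calc t * _ ≤ 1 * (G * R) := mul_le_mul ht.2
        (h1.trans (mul_le_mul_of_nonneg_left hn hG0)) (norm_nonneg _) zero_le_one
    _ = _ := one_mul _

theorem norm_fderiv_radialMean_le (hB : ContDiff ℝ 1 B)
    (hG : ∀ y, ‖y - x₀‖ ≤ R → ‖fderiv ℝ B y‖ ≤ G) (hx : ‖x - x₀‖ ≤ R) :
    ‖fderiv ℝ (radialMean B x₀) x‖ ≤ G := by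
  rw [(hasFDerivAt_radialMean hB x₀ x).fderiv]
  have h := intervalIntegral.norm_integral_le_of_norm_le_const (a := (0 : ℝ)) (b := 1) (C := G)
    (f := fun t => t ^ 2 • fderiv ℝ B (x₀ + t • (x - x₀))) fun t ht => ?_
  · simpa using h
  rw [Set.uIoc_of_le zero_le_one] at ht
  have h1 : ‖fderiv ℝ B (x₀ + t • (x - x₀))‖ ≤ G := by
    refine hG _ ?_
    rw [add_sub_cancel_left, norm_smul, Real.norm_of_nonneg ht.1.le]
    nlinarith [norm_nonneg (x - x₀), ht.1, ht.2]
  rw [norm_smul, Real.norm_of_nonneg (by positivity)]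
  calc t ^ 2 * _ ≤ 1 * ‖fderiv ℝ B (x₀ + t • (x - x₀))‖ :=
        mul_le_mul_of_nonneg_right (pow_le_one₀ ht.1.le ht.2) (norm_nonneg _)
    _ ≤ G := by rwa [one_mul]

end RadialMean

/-- The gauge transformation to the Poincaré gauge centred at `x₀`. -/
theorem exists_poincareGauge {A : Plane → Plane} {B : Plane → ℝ} (hA : ContDiff ℝ 1 A)
    (hB : ContDiff ℝ 1 B) (hcurl : ∀ x, B x = curl A x) (x₀ : Plane) :
    ∃ g : Plane → ℝ, ContDiff ℝ 2 g ∧ ∀ x,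
      fderiv ℝ g x (planeUnit 0) = A x 0 + radialMean B x₀ x * (x 1 - x₀ 1) ∧
      fderiv ℝ g x (planeUnit 1) = A x 1 - radialMean B x₀ x * (x 0 - x₀ 0) := by
  have hc : ∀ j : Fin 2, ContDiff ℝ 1 fun x : Plane => x j := fun j =>
    (EuclideanSpace.proj j : Plane →L[ℝ] ℝ).contDiff
  have hAj : ∀ j : Fin 2, ContDiff ℝ 1 fun x : Plane => A x j := fun j => (hc j).comp hA
  have hm := radialMean_contDiff hB x₀
  have hcd : ∀ (j : Fin 2) (x v : Plane), fderiv ℝ (fun y : Plane => y j - x₀ j) x v = v j := by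
    intro j x v
    have h : HasFDerivAt (fun y : Plane => y j - x₀ j) (EuclideanSpace.proj j : Plane →L[ℝ] ℝ) x :=
      (EuclideanSpace.proj j : Plane →L[ℝ] ℝ).hasFDerivAt.sub_const _
    rw [h.fderiv]
    rfl
  have hyj : ∀ j : Fin 2, ContDiff ℝ 1 fun x : Plane => x j - x₀ j := fun j =>
    (hc j).sub contDiff_const
  refine exists_potential_of_closed ((hAj 0).add (hm.mul (hyj 1)))
    ((hAj 1).sub (hm.mul (hyj 0))) fun x => ?_
  have d : ∀ {f : Plane → ℝ}, ContDiff ℝ 1 f → DifferentiableAt ℝ f x := fun hf =>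
    hf.differentiable one_ne_zero x
  have key := two_mul_radialMean_add hB x₀ x
  rw [hcurl, curl, clm_apply_eq] at key
  rw [fderiv_fun_add (d (hAj 0)) ((d hm).fun_mul (d (hyj 1))),
    fderiv_fun_sub (d (hAj 1)) ((d hm).fun_mul (d (hyj 0))), fderiv_fun_mul (d hm) (d (hyj 1)),
    fderiv_fun_mul (d hm) (d (hyj 0))]
  simp only [_root_.add_apply, _root_.sub_apply, _root_.smul_apply, smul_eq_mul, hcd,
    fderiv_plane_apply (hA.differentiable one_ne_zero x)]
  simp only [PiLp.sub_apply] at key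
  simp [planeUnit] at key ⊢
  linarith

end PoincareGauge

/-! ### Landau states and their Gaussian tails -/

noncomputable section LandauState

open Complex (I)

section Calculus

variable {c : ℂ} {f : Plane → ℂ} {x : Plane}

theorem wirtinger_pow (hf : DifferentiableAt ℝ f x) (n : ℕ) :
    wirtinger c (fun y => f y ^ n) x = n * f x ^ (n - 1) * wirtinger c f x := by
  have h : HasFDerivAt (fun y => f y ^ n) _ x := hf.hasFDerivAt.pow n
  simp only [wirtinger, h.fderiv, _root_.smul_apply, smul_eq_mul, nsmul_eq_mul]
  ring

theorem wirtinger_cexp (hf : DifferentiableAt ℝ f x) :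
    wirtinger c (fun y => Complex.exp (f y)) x = Complex.exp (f x) * wirtinger c f x := by
  simp only [wirtinger, hf.hasFDerivAt.cexp.fderiv, _root_.smul_apply, smul_eq_mul]
  ring

end Calculus

/-- The complex coordinate `y₁ + c y₂`, `y = x - x₀`. -/
def planeCoord (c : ℂ) (x₀ x : Plane) : ℂ := ((x 0 - x₀ 0 : ℝ) : ℂ) + c * ((x 1 - x₀ 1 : ℝ) : ℂ)

theorem planeCoord_contDiff {n : WithTop ℕ∞} (c : ℂ) (x₀ : Plane) :
    ContDiff ℝ n (planeCoord c x₀) := by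
  have h : ∀ j : Fin 2, ContDiff ℝ n fun x : Plane => ((x j - x₀ j : ℝ) : ℂ) := fun j =>
    Complex.ofRealCLM.contDiff.comp
      ((EuclideanSpace.proj j : Plane →L[ℝ] ℝ).contDiff.sub contDiff_const)
  exact (h 0).add (contDiff_const.mul (h 1))

theorem planeCoord_differentiableAt (c : ℂ) (x₀ x : Plane) :
    DifferentiableAt ℝ (planeCoord c x₀) x :=
  (planeCoord_contDiff (n := 1) c x₀).differentiable one_ne_zero x

theorem wirtinger_planeCoord (a c : ℂ) (x₀ x : Plane) :
    wirtinger a (planeCoord c x₀) x = 1 + a * c := by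
  have h : ∀ j : Fin 2, HasFDerivAt (fun x : Plane => ((x j - x₀ j : ℝ) : ℂ))
      (Complex.ofRealCLM.comp (EuclideanSpace.proj j : Plane →L[ℝ] ℝ)) x := fun j =>
    Complex.ofRealCLM.hasFDerivAt.comp x
      ((EuclideanSpace.proj j : Plane →L[ℝ] ℝ).hasFDerivAt.sub_const _)
  have h2 : HasFDerivAt (planeCoord c x₀)
      (Complex.ofRealCLM.comp (EuclideanSpace.proj 0 : Plane →L[ℝ] ℝ)
        + c • Complex.ofRealCLM.comp (EuclideanSpace.proj 1 : Plane →L[ℝ] ℝ)) x :=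
    (h 0).add ((h 1).const_mul c)
  rw [wirtinger, h2.fderiv]
  simp [planeUnit]

theorem planeCoord_mul {c : ℂ} (hc : c * c = -1) (x₀ x : Plane) :
    planeCoord c x₀ x * planeCoord (-c) x₀ x = ((‖x - x₀‖ ^ 2 : ℝ) : ℂ) := by
  rw [EuclideanSpace.norm_sq_eq, Fin.sum_univ_two]
  simp only [planeCoord, PiLp.sub_apply, Real.norm_eq_abs, sq_abs]
  push_cast
  linear_combination (-((x 1 : ℂ) - x₀ 1) ^ 2) * hc

theorem norm_planeCoord {c : ℂ} (hc : c * c = -1) (hc' : (starRingEnd ℂ) c = -c) (x₀ x : Plane) :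
    ‖planeCoord c x₀ x‖ = ‖x - x₀‖ := by
  have h1 : (starRingEnd ℂ) (planeCoord c x₀ x) = planeCoord (-c) x₀ x := by
    simp [planeCoord, hc']
  have h2 := Complex.mul_conj (planeCoord c x₀ x)
  rw [h1, planeCoord_mul hc, Complex.normSq_eq_norm_sq] at h2
  have h3 : ‖x - x₀‖ ^ 2 = ‖planeCoord c x₀ x‖ ^ 2 := by exact_mod_cast h2
  exact ((pow_left_inj₀ (norm_nonneg _) (norm_nonneg _) two_ne_zero).1 h3).symm

/-- The Gaussian `exp (-b |y|² / 4)`, `y = x - x₀`. -/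
def planeGaussian (c : ℂ) (b : ℝ) (x₀ x : Plane) : ℂ :=
  Complex.exp (-(b / 4 : ℂ) * (planeCoord c x₀ x * planeCoord (-c) x₀ x))

/-- The eigenfunction of the `n`-th Landau level of strength `b` with the most concentrated density
centred at `x₀`. -/
def landauState (c : ℂ) (b : ℝ) (n : ℕ) (x₀ x : Plane) : ℂ :=
  planeCoord (-c) x₀ x ^ n * planeGaussian c b x₀ x

theorem planeGaussian_contDiff {m : WithTop ℕ∞} (c : ℂ) (b : ℝ) (x₀ : Plane) :
    ContDiff ℝ m (planeGaussian c b x₀) :=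
  (contDiff_const.mul ((planeCoord_contDiff c x₀).mul (planeCoord_contDiff (-c) x₀))).cexp

theorem landauState_contDiff {m : WithTop ℕ∞} (c : ℂ) (b : ℝ) (n : ℕ) (x₀ : Plane) :
    ContDiff ℝ m (landauState c b n x₀) :=
  ((planeCoord_contDiff (-c) x₀).pow n).mul (planeGaussian_contDiff c b x₀)

theorem wirtinger_planeGaussian (a c : ℂ) (b : ℝ) (x₀ x : Plane) :
    wirtinger a (planeGaussian c b x₀) x = -(b / 4) * ((1 + a * c) * planeCoord (-c) x₀ x
      + (1 - a * c) * planeCoord c x₀ x) * planeGaussian c b x₀ x := by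
  have h1 := planeCoord_differentiableAt c x₀ x
  have h2 := planeCoord_differentiableAt (-c) x₀ x
  have h := wirtinger_cexp (c := a) ((h1.fun_mul h2).const_mul (-(b / 4 : ℂ)))
  rw [wirtinger_const_mul _ (h1.fun_mul h2), wirtinger_mul h1 h2, wirtinger_planeCoord,
    wirtinger_planeCoord] at h
  refine Eq.trans h ?_
  rw [planeGaussian]
  ring

section

variable {c : ℂ}

/-- The operator annihilates `y₁ + cy₂` and sends `y₁ - cy₂` to `2`, so it lowers the power by one
and also differentiates the Gaussian. For `n = 0` the truncated `n - 1` is harmless, its coefficient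
being zero. -/
theorem wirtinger_landauState (hc : c * c = -1) (b : ℝ) (n : ℕ) (x₀ x : Plane) :
    wirtinger c (landauState c b n x₀) x = 2 * n * landauState c b (n - 1) x₀ x
      - b / 2 * planeCoord c x₀ x * landauState c b n x₀ x := by
  have h2 := planeCoord_differentiableAt (-c) x₀ x
  have h3 := (planeGaussian_contDiff (m := 1) c b x₀).differentiable one_ne_zero x
  have h := wirtinger_mul (c := c) (h2.fun_pow n) h3
  rw [wirtinger_pow h2, wirtinger_planeCoord, wirtinger_planeGaussian, mul_neg, hc] at h
  refine Eq.trans h ?_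
  simp only [landauState]
  ring

/-- This operator annihilates `y₁ - cy₂`, so only the Gaussian is differentiated. -/
theorem wirtinger_neg_landauState (hc : c * c = -1) (b : ℝ) (n : ℕ) (x₀ x : Plane) :
    wirtinger (-c) (landauState c b n x₀) x
      = -(b / 2) * planeCoord (-c) x₀ x * landauState c b n x₀ x := by
  have h2 := planeCoord_differentiableAt (-c) x₀ x
  have h3 := (planeGaussian_contDiff (m := 1) c b x₀).differentiable one_ne_zero x
  have h := wirtinger_mul (c := -c) (h2.fun_pow n) h3
  rw [wirtinger_pow h2, wirtinger_planeCoord, wirtinger_planeGaussian, neg_mul_neg, hc] at h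
  refine Eq.trans h ?_
  simp only [landauState]
  linear_combination (-(b / 4) * (planeCoord c x₀ x - planeCoord (-c) x₀ x)
    * planeCoord (-c) x₀ x ^ n * planeGaussian c b x₀ x) * hc

theorem planeCoord_mul_landauState (c : ℂ) (b : ℝ) {n : ℕ} (hn : n ≠ 0) (x₀ x : Plane) :
    planeCoord (-c) x₀ x * landauState c b (n - 1) x₀ x = landauState c b n x₀ x := by
  rw [landauState, landauState, ← mul_assoc, mul_pow_sub_one hn]

theorem norm_landauState (hc : c * c = -1) (hc' : (starRingEnd ℂ) c = -c) (b : ℝ) (n : ℕ)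
    (x₀ x : Plane) :
    ‖landauState c b n x₀ x‖ = ‖x - x₀‖ ^ n * Real.exp (-(b / 4) * ‖x - x₀‖ ^ 2) := by
  rw [landauState, norm_mul, norm_pow, norm_planeCoord (by simpa using hc) (by simp [hc']),
    planeGaussian, planeCoord_mul hc, Complex.norm_exp]
  congr 2
  rw [← Complex.ofReal_ofNat, ← Complex.ofReal_div, ← Complex.ofReal_neg, ← Complex.ofReal_mul,
    Complex.ofReal_re]

end

section Moments

/-- Half of the exponent absorbs the power through `tⁿ / n! ≤ eᵗ`; the other half remains
integrable. -/
theorem integrable_pow_mul_gaussian {b : ℝ} (hb : 0 < b) (n : ℕ) :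
    Integrable fun y : Plane => ‖y‖ ^ (2 * n) * Real.exp (-b * ‖y‖ ^ 2) := by
  have h1 : Integrable fun y : Plane => Real.exp (-(b / 2) * ‖y‖ ^ 2) := by
    have h := (GaussianFourier.integrable_cexp_neg_mul_sq_norm_add (V := Plane)
      (b := ((b / 2 : ℝ) : ℂ)) (by simpa using hb) 0 0).norm
    refine h.congr (Eventually.of_forall fun y => ?_)
    simp only [zero_mul, add_zero, Complex.norm_exp]
    congr 1
    rw [← Complex.ofReal_pow, ← Complex.ofReal_neg, ← Complex.ofReal_mul, Complex.ofReal_re]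
  refine (h1.const_mul (n.factorial * (2 / b) ^ n)).mono' (by fun_prop)
    (Eventually.of_forall fun y => ?_)
  rw [Real.norm_of_nonneg (by positivity)]
  have h2 := Real.pow_div_factorial_le_exp (b / 2 * ‖y‖ ^ 2) (by positivity) n
  rw [div_le_iff₀ (by positivity)] at h2
  have e1 : ‖y‖ ^ (2 * n) = (2 / b) ^ n * (b / 2 * ‖y‖ ^ 2) ^ n := by
    rw [← mul_pow, pow_mul]
    congr 1
    field_simp
  have e2 : Real.exp (-b * ‖y‖ ^ 2) = Real.exp (-(b / 2 * ‖y‖ ^ 2))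
      * Real.exp (-(b / 2) * ‖y‖ ^ 2) := by
    rw [← Real.exp_add]; congr 1; ring
  have e3 : Real.exp (b / 2 * ‖y‖ ^ 2) * Real.exp (-(b / 2 * ‖y‖ ^ 2)) = 1 := by
    rw [← Real.exp_add, add_neg_cancel, Real.exp_zero]
  rw [e1, e2]
  calc (2 / b) ^ n * (b / 2 * ‖y‖ ^ 2) ^ n
        * (Real.exp (-(b / 2 * ‖y‖ ^ 2)) * Real.exp (-(b / 2) * ‖y‖ ^ 2))
      ≤ (2 / b) ^ n * (Real.exp (b / 2 * ‖y‖ ^ 2) * n.factorial)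
        * (Real.exp (-(b / 2 * ‖y‖ ^ 2)) * Real.exp (-(b / 2) * ‖y‖ ^ 2)) := by gcongr
    _ = (n.factorial * (2 / b) ^ n) * (Real.exp (b / 2 * ‖y‖ ^ 2)
        * Real.exp (-(b / 2 * ‖y‖ ^ 2))) * Real.exp (-(b / 2) * ‖y‖ ^ 2) := by ring
    _ = _ := by rw [e3, mul_one]

/-- Substitute `√2 y` for `y`: the power contributes `2ⁿ` and the area element `2`. -/
theorem integral_pow_mul_gaussian_half (b : ℝ) (n : ℕ) :
    ∫ y : Plane, ‖y‖ ^ (2 * n) * Real.exp (-(b / 4) * ‖y‖ ^ 2)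
      = 2 ^ (n + 1) * ∫ y : Plane, ‖y‖ ^ (2 * n) * Real.exp (-(b / 2) * ‖y‖ ^ 2) := by
  have h := Measure.integral_comp_smul (volume : Measure Plane)
    (fun y => ‖y‖ ^ (2 * n) * Real.exp (-(b / 4) * ‖y‖ ^ 2)) (√2)
  have hs : √2 ^ 2 = 2 := Real.sq_sqrt zero_le_two
  have e : (fun y : Plane => ‖√2 • y‖ ^ (2 * n) * Real.exp (-(b / 4) * ‖√2 • y‖ ^ 2))
      = fun y => 2 ^ n * (‖y‖ ^ (2 * n) * Real.exp (-(b / 2) * ‖y‖ ^ 2)) := by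
    funext y
    rw [norm_smul, Real.norm_of_nonneg (Real.sqrt_nonneg _), mul_pow, mul_pow, pow_mul, hs,
      mul_assoc,
      show -(b / 4) * (2 * ‖y‖ ^ 2) = -(b / 2) * ‖y‖ ^ 2 by ring]
  rw [e, integral_const_mul, finrank_euclideanSpace_fin, hs, abs_of_nonneg (by norm_num),
    smul_eq_mul] at h
  rw [pow_succ]
  linarith

variable {c : ℂ} (b : ℝ) (n : ℕ) (x₀ : Plane)

theorem sq_norm_landauState (hc : c * c = -1) (hc' : (starRingEnd ℂ) c = -c) (x : Plane) :
    ‖landauState c b n x₀ x‖ ^ 2 = ‖x - x₀‖ ^ (2 * n) * Real.exp (-(b / 2) * ‖x - x₀‖ ^ 2) := by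
  rw [norm_landauState hc hc', mul_pow, ← pow_mul, mul_comm n, ← Real.exp_nat_mul]
  congr 2
  push_cast
  ring

variable {b}

theorem landauState_memLp (hc : c * c = -1) (hc' : (starRingEnd ℂ) c = -c) (hb : 0 < b) :
    MemLp (landauState c b n x₀) 2 volume := by
  refine (memLp_two_iff_integrable_sq_norm
    (landauState_contDiff (m := 0) c b n x₀).continuous.aestronglyMeasurable).2 ?_
  simp only [sq_norm_landauState b n x₀ hc hc']
  exact (integrable_pow_mul_gaussian (half_pos hb) n).comp_sub_right x₀

theorem l2norm_landauState_pos (hc : c * c = -1) (hc' : (starRingEnd ℂ) c = -c) (hb : 0 < b) :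
    0 < l2norm (landauState c b n x₀) := by
  have hm := landauState_memLp n x₀ hc hc' hb
  refine lt_of_le_of_ne (l2norm_nonneg _) fun h => ?_
  have h0 : eLpNorm (landauState c b n x₀) 2 volume = 0 :=
    ((ENNReal.toReal_eq_zero_iff _).1 h.symm).resolve_right hm.eLpNorm_ne_top
  rw [eLpNorm_eq_zero_iff hm.1 two_ne_zero] at h0
  have h1 := ((landauState_contDiff (m := 0) c b n x₀).continuous.ae_eq_iff_eq volume
    continuous_zero).1 h0
  have h2 := congrArg norm (congrFun h1 (x₀ + planeUnit 0))
  rw [norm_landauState hc hc', add_sub_cancel_left, norm_planeUnit] at h2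
  simp at h2

/-- Half of the Gaussian exponent `b‖x - x₀‖²/2` is given up, and at distance at least `R / 2` that
half is at least `bR²/16`. The weaker Gaussian left over costs only `2ⁿ⁺¹` by
`integral_pow_mul_gaussian_half`. -/
theorem integral_landauState_tail_le (hc : c * c = -1) (hc' : (starRingEnd ℂ) c = -c) (hb : 0 < b)
    {R : ℝ} (hR : 0 ≤ R) :
    ∫ x, ‖{x | R / 2 ≤ ‖x - x₀‖}.indicator (landauState c b n x₀) x‖ ^ 2
      ≤ ∫ x, Real.exp (-(b * R ^ 2 / 16))
        * (‖x - x₀‖ ^ (2 * n) * Real.exp (-(b / 4) * ‖x - x₀‖ ^ 2)) := by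
  refine integral_mono_of_nonneg (Eventually.of_forall fun x => sq_nonneg _)
    (((integrable_pow_mul_gaussian (div_pos hb four_pos) n).comp_sub_right x₀).const_mul _)
    (Eventually.of_forall fun x => ?_)
  by_cases hx : R / 2 ≤ ‖x - x₀‖
  · have e : {x | R / 2 ≤ ‖x - x₀‖}.indicator (landauState c b n x₀) x = landauState c b n x₀ x :=
      Set.indicator_of_mem (s := {x | R / 2 ≤ ‖x - x₀‖}) hx _
    have h3 : (R / 2) ^ 2 ≤ ‖x - x₀‖ ^ 2 := pow_le_pow_left₀ (by linarith) hx 2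
    have h4 : Real.exp (-(b / 2) * ‖x - x₀‖ ^ 2)
        ≤ Real.exp (-(b * R ^ 2 / 16)) * Real.exp (-(b / 4) * ‖x - x₀‖ ^ 2) := by
      rw [← Real.exp_add]
      refine Real.exp_le_exp.2 ?_
      nlinarith
    simp only [e]
    rw [sq_norm_landauState b n x₀ hc hc', mul_left_comm]
    exact mul_le_mul_of_nonneg_left h4 (pow_nonneg (norm_nonneg _) _)
  · have e : {x | R / 2 ≤ ‖x - x₀‖}.indicator (landauState c b n x₀) x = 0 :=
      Set.indicator_of_notMem (s := {x | R / 2 ≤ ‖x - x₀‖}) hx _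
    simp only [e, norm_zero, zero_pow two_ne_zero]
    positivity

theorem l2norm_indicator_le {f : Plane → ℂ} {S : Set Plane} (hS : MeasurableSet S)
    (hf : MemLp f 2 volume) {q : ℝ} (hq : 0 ≤ q)
    (h : ∫ x, ‖S.indicator f x‖ ^ 2 ≤ q * ∫ x, ‖f x‖ ^ 2) :
    l2norm (S.indicator f) ≤ √q * l2norm f := by
  rw [← l2norm_sq hf, ← l2norm_sq (f := S.indicator f) (hf.indicator hS)] at h
  refine le_of_sq_le_sq (h.trans_eq ?_) (mul_nonneg (Real.sqrt_nonneg _) (l2norm_nonneg _))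
  rw [mul_pow, Real.sq_sqrt hq]

theorem l2norm_landauState_tail (hc : c * c = -1) (hc' : (starRingEnd ℂ) c = -c) (hb : 0 < b)
    {R : ℝ} (hR : 0 ≤ R) :
    l2norm ({x | R / 2 ≤ ‖x - x₀‖}.indicator (landauState c b n x₀))
      ≤ √(Real.exp (-(b * R ^ 2 / 16)) * 2 ^ (n + 1)) * l2norm (landauState c b n x₀) := by
  refine l2norm_indicator_le (measurableSet_le measurable_const (by fun_prop))
    (landauState_memLp n x₀ hc hc' hb) (by positivity)
    ((integral_landauState_tail_le n x₀ hc hc' hb hR).trans_eq ?_)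
  have h1 : ∫ x, ‖landauState c b n x₀ x‖ ^ 2
      = ∫ y : Plane, ‖y‖ ^ (2 * n) * Real.exp (-(b / 2) * ‖y‖ ^ 2) := by
    simp only [sq_norm_landauState b n x₀ hc hc']
    exact integral_sub_right_eq_self
      (fun y : Plane => ‖y‖ ^ (2 * n) * Real.exp (-(b / 2) * ‖y‖ ^ 2)) x₀
  rw [integral_const_mul, h1, mul_assoc, ← integral_pow_mul_gaussian_half]
  exact congrArg (Real.exp (-(b * R ^ 2 / 16)) * ·) (integral_sub_right_eq_self
    (fun y : Plane => ‖y‖ ^ (2 * n) * Real.exp (-(b / 4) * ‖y‖ ^ 2)) x₀)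

end Moments

end LandauState

/-! ### The Pauli component applied to a gauged, cut off Landau state -/

noncomputable section TrialFunction

open Complex (I)

/-- The phase `exp (i g)`. -/
def phase (g : Plane → ℝ) (x : Plane) : ℂ := Complex.exp (I * g x)

theorem phase_contDiff {n : WithTop ℕ∞} {g : Plane → ℝ} (hg : ContDiff ℝ n g) :
    ContDiff ℝ n (phase g) :=
  (contDiff_const.mul (Complex.ofRealCLM.contDiff.comp hg)).cexp

theorem norm_phase (g : Plane → ℝ) (x : Plane) : ‖phase g x‖ = 1 := by
  rw [phase, mul_comm, Complex.norm_exp_ofReal_mul_I]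

theorem wirtinger_phase {g : Plane → ℝ} {x : Plane} (hg : DifferentiableAt ℝ g x) (a : ℂ) :
    wirtinger a (phase g) x
      = phase g x * (I * (fderiv ℝ g x (planeUnit 0) + a * fderiv ℝ g x (planeUnit 1))) := by
  have h1 : HasFDerivAt (fun y => (g y : ℂ)) (Complex.ofRealCLM.comp (fderiv ℝ g x)) x :=
    Complex.ofRealCLM.hasFDerivAt.comp x hg.hasFDerivAt
  have h2 := wirtinger_cexp (c := a) (h1.differentiableAt.const_mul I)
  rw [wirtinger_const_mul _ h1.differentiableAt] at h2
  refine h2.trans ?_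
  rw [wirtinger, h1.fderiv]
  rfl

section Gauge

variable {A : Plane → Plane} {V : Plane → ℝ} {x₀ : Plane} {g m : Plane → ℝ}

/-- The phase replaces `A` by the Poincaré gauge `m (-y₂, y₁)`. As `a² = -1`, its combination `A₁ +
aA₂` is `a m (y₁ + ay₂)`. -/
theorem momentum_phase_mul (hg : Differentiable ℝ g)
    (hgm : ∀ x, fderiv ℝ g x (planeUnit 0) = A x 0 + m x * (x 1 - x₀ 1) ∧
      fderiv ℝ g x (planeUnit 1) = A x 1 - m x * (x 0 - x₀ 0))
    {a : ℂ} (ha : a * a = -1) {v : Plane → ℂ} {x : Plane} (hv : DifferentiableAt ℝ v x) :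
    momentum A a (fun y => phase g y * v y) x = phase g x *
      (-I * (wirtinger a v x + -I * a * m x * planeCoord a x₀ x * v x)) := by
  have hp : DifferentiableAt ℝ (phase g) x := by
    have h1 : DifferentiableAt ℝ (fun y => (g y : ℂ)) x :=
      Complex.ofRealCLM.differentiableAt.comp x (hg x)
    exact (h1.const_mul I).cexp
  rw [momentum_mul hp hv, wirtinger_phase (hg x), (hgm x).1, (hgm x).2, momentum, complexPotential,
    planeCoord]
  push_cast
  linear_combination -(phase g x * v x) * (A x 0 + m x * (x 1 - x₀ 1)
    + a * (A x 1 - m x * (x 0 - x₀ 0)) + a * m x * (x 0 - x₀ 0 + a * (x 1 - x₀ 1)))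
    * Complex.I_mul_I + phase g x * v x * m x * (x 1 - x₀ 1) * ha

/-- The deviation of the magnetic potential from the one of a constant field of strength `b`. -/
def fieldDefect (c : ℂ) (b : ℝ) (m : Plane → ℝ) (x : Plane) : ℂ := -I * c * m x - b / 2

theorem fieldDefect_contDiff {n : WithTop ℕ∞} (c : ℂ) (b : ℝ) (hm : ContDiff ℝ n m) :
    ContDiff ℝ n (fieldDefect c b m) :=
  (contDiff_const.mul (Complex.ofRealCLM.contDiff.comp hm)).sub contDiff_const

variable {c : ℂ} {b : ℝ} {n : ℕ} {χ : Plane → ℂ}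

theorem momentum_trial (hg : Differentiable ℝ g)
    (hgm : ∀ x, fderiv ℝ g x (planeUnit 0) = A x 0 + m x * (x 1 - x₀ 1) ∧
      fderiv ℝ g x (planeUnit 1) = A x 1 - m x * (x 0 - x₀ 0))
    (hc : c * c = -1) (hχ : Differentiable ℝ χ) (x : Plane) :
    momentum A c (fun y => phase g y * (χ y * landauState c b n x₀ y)) x
      = phase g x * (-I * (wirtinger c χ x * landauState c b n x₀ x
        + χ x * (2 * n * landauState c b (n - 1) x₀ x
          + fieldDefect c b m x * (planeCoord c x₀ x * landauState c b n x₀ x)))) := by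
  have hψ : DifferentiableAt ℝ (landauState c b n x₀) x :=
    (landauState_contDiff (m := 1) c b n x₀).differentiable one_ne_zero x
  rw [momentum_phase_mul hg hgm hc ((hχ x).fun_mul hψ), wirtinger_mul (hχ x) hψ,
    wirtinger_landauState hc, fieldDefect]
  ring

/-- Up to the phase, without cutoff and with zero defect, `π₁ + cπ₂` lowers the `n`-th state to
`-2in` times the one below, and `π₁ - cπ₂` raises it back, giving `2nb`. Every other term contains a
derivative of the cutoff or the field defect. The condition `n ≠ 0` lets the factor `y₁ - cy₂` turn
the lower state back into the `n`-th one. -/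
theorem scalarPauli_trial (hg : Differentiable ℝ g) (hm : ContDiff ℝ 1 m)
    (hgm : ∀ x, fderiv ℝ g x (planeUnit 0) = A x 0 + m x * (x 1 - x₀ 1) ∧
      fderiv ℝ g x (planeUnit 1) = A x 1 - m x * (x 0 - x₀ 0))
    (hc : c * c = -1) (hχ : ContDiff ℝ 2 χ) (hn : n ≠ 0) (x : Plane) :
    scalarPauli A V c (fun y => phase g y * (χ y * landauState c b n x₀ y)) x
      = phase g x * ((2 * n * b + V x) * (χ x * landauState c b n x₀ x)
        - wirtinger (-c) (wirtinger c χ) x * landauState c b n x₀ x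
        - 2 * n * wirtinger (-c) χ x * landauState c b (n - 1) x₀ x
        - wirtinger (-c) χ x * fieldDefect c b m x * planeCoord c x₀ x * landauState c b n x₀ x
        + (b + fieldDefect c b m x) * wirtinger c χ x * planeCoord (-c) x₀ x
          * landauState c b n x₀ x
        - χ x * wirtinger (-c) (fieldDefect c b m) x * planeCoord c x₀ x * landauState c b n x₀ x
        + (2 * n - 2) * fieldDefect c b m x * χ x * landauState c b n x₀ x
        + (b + fieldDefect c b m x) * fieldDefect c b m x * χ x
          * (planeCoord c x₀ x * planeCoord (-c) x₀ x) * landauState c b n x₀ x) := by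
  have hχ1 : Differentiable ℝ χ := hχ.differentiable two_ne_zero
  have hψ : ∀ k, DifferentiableAt ℝ (landauState c b k x₀) x := fun k =>
    (landauState_contDiff (m := 1) c b k x₀).differentiable one_ne_zero x
  have hw : DifferentiableAt ℝ (wirtinger c χ) x :=
    (wirtinger_contDiff (n := 1) hχ (by norm_num)).differentiable one_ne_zero x
  have hτ : DifferentiableAt ℝ (fieldDefect c b m) x :=
    (fieldDefect_contDiff c b hm).differentiable one_ne_zero x
  have hζ := planeCoord_differentiableAt c x₀ x
  have hζψ := hζ.fun_mul (hψ n)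
  have hin := ((hψ (n - 1)).const_mul (2 * n : ℂ)).fun_add (hτ.fun_mul hζψ)
  have hv := (hw.fun_mul (hψ n)).fun_add ((hχ1 x).fun_mul hin)
  have e : momentum A c (fun y => phase g y * (χ y * landauState c b n x₀ y)) = _ :=
    funext fun x => momentum_trial hg hgm hc hχ1 x
  rw [scalarPauli, e, momentum_phase_mul (a := -c) hg hgm (by simpa using hc) (hv.const_mul _),
    wirtinger_const_mul _ hv, wirtinger_add (hw.fun_mul (hψ n)) ((hχ1 x).fun_mul hin),
    wirtinger_mul hw (hψ n), wirtinger_mul (hχ1 x) hin,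
    wirtinger_add ((hψ (n - 1)).const_mul (2 * n : ℂ)) (hτ.fun_mul hζψ),
    wirtinger_const_mul _ (hψ (n - 1)), wirtinger_mul hτ hζψ, wirtinger_mul hζ (hψ n),
    wirtinger_planeCoord, wirtinger_neg_landauState hc, wirtinger_neg_landauState hc]
  have e2 := planeCoord_mul_landauState c b hn x₀ x
  have e3 : -I * -c * (m x : ℂ) = -(fieldDefect c b m x + b / 2) := by
    rw [fieldDefect]; ring
  have e4 : 1 + -c * c = 2 := by linear_combination -hc
  rw [e3, e4, ← e2]
  ring_nf
  simp only [Complex.I_sq]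
  ring

end Gauge

end TrialFunction

/-! ### Error bounds for the trial function -/

noncomputable section TrialEstimate

open Complex (I)

theorem norm_add_four_le (p q r s : ℂ) : ‖p + q + r + s‖ ≤ ‖p‖ + ‖q‖ + ‖r‖ + ‖s‖ :=
  (norm_add_le _ _).trans (add_le_add_left ((norm_add_le _ _).trans
    (add_le_add_left (norm_add_le _ _) _)) _)

/-- The bound for the part of the error that comes from the variation of the fields. -/
theorem norm_field_error_le {χ dτ ζ ζ' τ ψ w : ℂ} {b G G' R : ℝ} {n : ℕ} (hb : 0 ≤ b) (hR : 0 ≤ R)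
    (hG : 0 ≤ G) (hχ : ‖χ‖ ≤ 1) (hdτ : ‖dτ‖ ≤ 2 * G) (hζ : ‖ζ‖ ≤ R) (hζ' : ‖ζ'‖ ≤ R)
    (hτ : ‖τ‖ ≤ G * R) (hw : ‖w‖ ≤ G' * R) :
    ‖w * χ * ψ + -(χ * dτ * ζ * ψ) + (2 * n - 2) * τ * χ * ψ + (b + τ) * τ * χ * (ζ * ζ') * ψ‖
      ≤ (G' * R + (2 * n + 4) * (G * R) + (b + G * R) * (G * R) * R ^ 2) * ‖ψ‖ := by
  have h1 : ‖w * χ * ψ‖ ≤ (G' * R) * 1 * ‖ψ‖ := by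
    have := (norm_nonneg w).trans hw
    simp only [norm_mul]; gcongr
  have h2 : ‖-(χ * dτ * ζ * ψ)‖ ≤ 1 * (2 * G) * R * ‖ψ‖ := by
    simp only [norm_neg, norm_mul]; gcongr
  have h3 : ‖(2 * n - 2) * τ * χ * ψ‖ ≤ (2 * n + 2) * (G * R) * 1 * ‖ψ‖ := by
    have h : ‖(2 * n - 2 : ℂ)‖ ≤ 2 * n + 2 := by
      refine (norm_sub_le _ _).trans ?_
      simp
    simp only [norm_mul]; gcongr
  have h4 : ‖(b + τ) * τ * χ * (ζ * ζ') * ψ‖ ≤ (b + G * R) * (G * R) * 1 * (R * R) * ‖ψ‖ := by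
    have h : ‖(b + τ : ℂ)‖ ≤ b + G * R := by
      refine (norm_add_le _ _).trans ?_
      rw [Complex.norm_real, Real.norm_of_nonneg hb]
      gcongr
    simp only [norm_mul]; gcongr
  calc _ ≤ _ := norm_add_four_le _ _ _ _
    _ ≤ _ := add_le_add (add_le_add (add_le_add h1 h2) h3) h4
    _ = _ := by ring

/-- The bound for the part of the error that comes from the derivatives of the cutoff. -/
theorem norm_cutoff_error_le {ddχ dχ dχ' ζ ζ' τ ψ ψ' : ℂ} {b G R C : ℝ} {n : ℕ} (hb : 0 ≤ b)
    (hR : 0 < R) (hG : 0 ≤ G) (hC : 0 ≤ C) (hddχ : ‖ddχ‖ ≤ C / R ^ 2) (hdχ : ‖dχ‖ ≤ C / R)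
    (hdχ' : ‖dχ'‖ ≤ C / R) (hζ : ‖ζ‖ ≤ R) (hζ' : ‖ζ'‖ ≤ R) (hτ : ‖τ‖ ≤ G * R)
    (hψ' : ‖ψ'‖ ≤ 2 / R * ‖ψ‖) :
    ‖-(ddχ * ψ) + -(2 * n * dχ' * ψ') + -(dχ' * τ * ζ * ψ) + (b + τ) * dχ * ζ' * ψ‖
      ≤ C * ((4 * n + 1) / R ^ 2 + 2 * (G * R) + b) * ‖ψ‖ := by
  have h1 : ‖-(ddχ * ψ)‖ ≤ C / R ^ 2 * ‖ψ‖ := by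
    simp only [norm_neg, norm_mul]; gcongr
  have h2 : ‖-(2 * n * dχ' * ψ')‖ ≤ 2 * n * (C / R) * (2 / R * ‖ψ‖) := by
    simp only [norm_neg, norm_mul, Complex.norm_natCast, Complex.norm_ofNat]; gcongr
  have h3 : ‖-(dχ' * τ * ζ * ψ)‖ ≤ C / R * (G * R) * R * ‖ψ‖ := by
    simp only [norm_neg, norm_mul]; gcongr
  have h4 : ‖(b + τ) * dχ * ζ' * ψ‖ ≤ (b + G * R) * (C / R) * R * ‖ψ‖ := by
    have h : ‖(b + τ : ℂ)‖ ≤ b + G * R := by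
      refine (norm_add_le _ _).trans ?_
      rw [Complex.norm_real, Real.norm_of_nonneg hb]
      gcongr
    simp only [norm_mul]; gcongr
  calc _ ≤ _ := norm_add_four_le _ _ _ _
    _ ≤ _ := add_le_add (add_le_add (add_le_add h1 h2) h3) h4
    _ = _ := by field_simp; ring

theorem scalarPauli_congr {A : Plane → Plane} {V : Plane → ℝ} {c : ℂ} {f g : Plane → ℂ} {x : Plane}
    (h : f =ᶠ[𝓝 x] g) : scalarPauli A V c f x = scalarPauli A V c g x := by
  have h1 : momentum A c f =ᶠ[𝓝 x] momentum A c g :=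
    h.eventually_nhds.mono fun y hy => momentum_congr hy
  rw [scalarPauli, scalarPauli, momentum_congr h1, h.eq_of_nhds]

section Defect

variable {B : Plane → ℝ} {c : ℂ} {b R G : ℝ} {x₀ x : Plane}

/-- Because `b` is the frozen field up to the sign `-ic`, the defect is, up to that sign, the
deviation of the radial mean from half the field at the centre. -/
theorem norm_fieldDefect_le (hB : ContDiff ℝ 1 B) (hc : ‖c‖ = 1) (hb : -I * c * B x₀ = b)
    (hG : ∀ y, ‖y - x₀‖ ≤ R → ‖fderiv ℝ B y‖ ≤ G) (hx : ‖x - x₀‖ ≤ R) :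
    ‖fieldDefect c b (radialMean B x₀) x‖ ≤ G * R := by
  have e : fieldDefect c b (radialMean B x₀) x
      = -I * c * ((radialMean B x₀ x - B x₀ / 2 : ℝ) : ℂ) := by
    rw [fieldDefect, ← hb]; push_cast; ring
  rw [e, norm_mul, norm_mul, norm_neg, Complex.norm_I, hc, one_mul, one_mul, Complex.norm_real]
  exact abs_radialMean_sub_le hB hG hx

theorem norm_wirtinger_fieldDefect_le (hB : ContDiff ℝ 1 B) (hc : ‖c‖ = 1)
    (hG : ∀ y, ‖y - x₀‖ ≤ R → ‖fderiv ℝ B y‖ ≤ G) (hx : ‖x - x₀‖ ≤ R) :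
    ‖wirtinger (-c) (fieldDefect c b (radialMean B x₀)) x‖ ≤ 2 * G := by
  have h1 : HasFDerivAt (fun y => (radialMean B x₀ y : ℂ))
      (Complex.ofRealCLM.comp (fderiv ℝ (radialMean B x₀) x)) x :=
    Complex.ofRealCLM.hasFDerivAt.comp x
      (hasFDerivAt_radialMean hB x₀ x).differentiableAt.hasFDerivAt
  have e : wirtinger (-c) (fieldDefect c b (radialMean B x₀)) x
      = -I * c * wirtinger (-c) (fun y => (radialMean B x₀ y : ℂ)) x := by
    have h2 := wirtinger_sub (c := -c) (h1.differentiableAt.const_mul (-I * c))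
      (differentiableAt_const (b / 2 : ℂ))
    rw [wirtinger_const, sub_zero, wirtinger_const_mul _ h1.differentiableAt] at h2
    exact h2
  rw [e, norm_mul, norm_mul, norm_neg, Complex.norm_I, hc, one_mul, one_mul]
  refine (norm_wirtinger_le (by rwa [norm_neg])).trans ?_
  rw [h1.fderiv]
  gcongr
  refine ((Complex.ofRealCLM).opNorm_comp_le _).trans ?_
  rw [Complex.ofRealCLM_norm, one_mul]
  exact norm_fderiv_radialMean_le hB hG hx

end Defect

/-- Approximate eigenfunctions built from a state of the `n`-th Landau level. -/
theorem exists_trial_function {c : ℂ} (hc : c * c = -1) (hc' : (starRingEnd ℂ) c = -c) :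
    ∃ C : ℝ, 0 < C ∧ ∀ {A : Plane → Plane} {B V : Plane → ℝ}, ContDiff ℝ 1 A → ContDiff ℝ 1 B →
      ContDiff ℝ 1 V → (∀ x, B x = curl A x) → ∀ {x₀ : Plane} {b R G G' : ℝ} {n : ℕ}, 0 < b →
      0 < R → n ≠ 0 → -I * c * B x₀ = b → (∀ y, ‖y - x₀‖ ≤ R → ‖fderiv ℝ B y‖ ≤ G) →
      (∀ y, ‖y - x₀‖ ≤ R → ‖fderiv ℝ V y‖ ≤ G') →
      ∃ u : Plane → ℂ, ContDiff ℝ 2 u ∧ HasCompactSupport u ∧ ∃ N : ℝ, 0 < N ∧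
        N ≤ l2norm u + √(Real.exp (-(b * R ^ 2 / 16)) * 2 ^ (n + 1)) * N ∧
        l2norm (fun x => scalarPauli A V c u x - (2 * n * b + V x₀ : ℝ) * u x)
          ≤ (G' * R + (2 * n + 4) * (G * R) + (b + G * R) * (G * R) * R ^ 2) * N
            + C * ((4 * n + 1) / R ^ 2 + 2 * (G * R) + b)
              * (√(Real.exp (-(b * R ^ 2 / 16)) * 2 ^ (n + 1)) * N) := by
  have hcn : ‖c‖ = 1 := by
    have h := congrArg norm hc
    rw [norm_mul, norm_neg, norm_one] at h
    nlinarith [norm_nonneg c]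
  obtain ⟨C, hC, hCb⟩ := exists_cutoff_bound c
  refine ⟨C, hC, fun {A B V} hA hB hV hcurl {x₀ b R G G' n} hb hR hn hbB hG hG' => ?_⟩
  obtain ⟨g, hg, hgm⟩ := exists_poincareGauge hA hB hcurl x₀
  have hG0 : 0 ≤ G := (norm_nonneg _).trans (hG x₀ (by simpa using hR.le))
  have hG0' : 0 ≤ G' := (norm_nonneg _).trans (hG' x₀ (by simpa using hR.le))
  set ψ := landauState c b n x₀ with hψdef
  set τ := fieldDefect c b (radialMean B x₀)
  set S : Set Plane := {x | R / 2 ≤ ‖x - x₀‖} with hSdef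
  set q := √(Real.exp (-(b * R ^ 2 / 16)) * 2 ^ (n + 1))
  set u : Plane → ℂ := fun x => phase g x * (cutoff x₀ R x * ψ x) with hu
  have hψc : ContDiff ℝ 2 ψ := landauState_contDiff c b n x₀
  have hχ : ContDiff ℝ 2 (cutoff x₀ R) := (cutoff_contDiff x₀ R).of_le (by norm_cast)
  have huc : ContDiff ℝ 2 u := (phase_contDiff hg).mul (hχ.mul hψc)
  have hus : HasCompactSupport u := ((cutoff_hasCompactSupport x₀ hR).mul_right).mul_left
  have hψm : MemLp ψ 2 volume := landauState_memLp n x₀ hc hc' hb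
  have hSm : MeasurableSet S := measurableSet_le measurable_const (by fun_prop)
  have hψS : MemLp (S.indicator ψ) 2 volume := hψm.indicator hSm
  have hum : MemLp u 2 volume := huc.continuous.memLp_of_hasCompactSupport hus
  have htail : l2norm (S.indicator ψ) ≤ q * l2norm ψ := l2norm_landauState_tail n x₀ hc hc' hb hR.le
  set ε₁ := G' * R + (2 * n + 4) * (G * R) + (b + G * R) * (G * R) * R ^ 2
  set ε₂ := C * ((4 * n + 1) / R ^ 2 + 2 * (G * R) + b)
  have hε₁ : 0 ≤ ε₁ := by positivity
  have hε₂ : 0 ≤ ε₂ := by positivity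
  have hin : ∀ x ∈ S, ‖S.indicator ψ x‖ = ‖ψ x‖ := fun x hx => by rw [Set.indicator_of_mem hx]
  have hnu : ∀ x, ‖u x‖ = ‖cutoff x₀ R x‖ * ‖ψ x‖ := fun x => by
    rw [hu, norm_mul, norm_phase, one_mul, norm_mul]
  have hpt : ∀ x, ‖scalarPauli A V c u x - (2 * n * b + V x₀ : ℝ) * u x‖
      ≤ ε₁ * ‖ψ x‖ + ε₂ * ‖S.indicator ψ x‖ := by
    intro x
    rcases lt_or_ge R ‖x - x₀‖ with hx | hx
    · have h0 : u =ᶠ[𝓝 x] fun _ => 0 := by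
        have : ∀ᶠ y in 𝓝 x, R < ‖y - x₀‖ :=
          (continuous_id.sub continuous_const).norm.continuousAt.eventually_const_lt hx
        filter_upwards [this] with y hy
        rw [hu]
        simp [cutoff_eq_zero hR hy.le]
      rw [scalarPauli_congr h0, scalarPauli_zero, h0.eq_of_nhds]
      simp only [mul_zero, sub_zero, norm_zero]
      positivity
    have hτ : ‖τ x‖ ≤ G * R := norm_fieldDefect_le hB hcn hbB hG hx
    have hdτ : ‖wirtinger (-c) τ x‖ ≤ 2 * G := norm_wirtinger_fieldDefect_le hB hcn hG hx
    have hζ : ‖planeCoord c x₀ x‖ ≤ R := by rwa [norm_planeCoord hc hc']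
    have hζ' : ‖planeCoord (-c) x₀ x‖ ≤ R := by
      rwa [norm_planeCoord (by simpa using hc) (by simp [hc'])]
    have hVx : ‖((V x - V x₀ : ℝ) : ℂ)‖ ≤ G' * R := by
      rw [Complex.norm_real]
      have h := (convex_closedBall x₀ R).norm_image_sub_le_of_norm_fderiv_le (𝕜 := ℝ) (f := V)
        (fun y _ => hV.differentiable one_ne_zero y)
        (fun y hy => hG' y (by simpa [dist_eq_norm] using hy))
        (Metric.mem_closedBall_self hR.le) (show x ∈ _ by simpa [dist_eq_norm] using hx)
      exact h.trans (mul_le_mul_of_nonneg_left hx hG0')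
    set χ := cutoff x₀ R
    -- The first group of terms comes from the variation of the fields and is present on the whole
    -- ball. The second contains derivatives of the cutoff and lives where only the tail of `ψ`
    -- matters.
    have e : scalarPauli A V c u x - (2 * n * b + V x₀ : ℝ) * u x = phase g x *
        ((((V x - V x₀ : ℝ) : ℂ) * χ x * ψ x + -(χ x * wirtinger (-c) τ x * planeCoord c x₀ x * ψ x)
          + (2 * n - 2) * τ x * χ x * ψ x
          + (b + τ x) * τ x * χ x * (planeCoord c x₀ x * planeCoord (-c) x₀ x) * ψ x)
        + (-(wirtinger (-c) (wirtinger c χ) x * ψ x)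
          + -(2 * n * wirtinger (-c) χ x * landauState c b (n - 1) x₀ x)
          + -(wirtinger (-c) χ x * τ x * planeCoord c x₀ x * ψ x)
          + (b + τ x) * wirtinger c χ x * planeCoord (-c) x₀ x * ψ x)) := by
      rw [hu, scalarPauli_trial (hg.differentiable two_ne_zero)
        (radialMean_contDiff hB x₀) hgm hc hχ
        hn]
      push_cast
      ring
    rw [e, norm_mul, norm_phase, one_mul]
    refine (norm_add_le _ _).trans (add_le_add (norm_field_error_le hb.le hR.le hG0
      (norm_cutoff_le x₀ R x) hdτ hζ hζ' hτ hVx) ?_)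
    rcases lt_or_ge ‖x - x₀‖ (R / 2) with hx2 | hx2
    · rw [wirtinger_cutoff_eq_zero hR hx2, wirtinger_cutoff_eq_zero hR hx2,
        wirtinger_wirtinger_cutoff_eq_zero hR hx2]
      simp only [zero_mul, mul_zero, neg_zero, add_zero, norm_zero]
      positivity
    · rw [hin x hx2]
      obtain ⟨h1, h2, h3⟩ := hCb x₀ R hR x
      refine norm_cutoff_error_le hb.le hR hG0 hC.le h3 h1 h2 hζ hζ' hτ ?_
      -- The lower state times the distance to `x₀` has the modulus of `ψ`; that distance is at
      -- least `R / 2` here, whence the factor `2 / R`.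
      have h4 := congrArg norm (planeCoord_mul_landauState c b hn x₀ x)
      rw [norm_mul, norm_planeCoord (by simpa using hc) (by simp [hc'])] at h4
      rw [div_mul_eq_mul_div, le_div_iff₀ hR]
      have h5 : R / 2 * ‖landauState c b (n - 1) x₀ x‖ ≤ ‖ψ x‖ :=
        (mul_le_mul_of_nonneg_right hx2 (norm_nonneg _)).trans_eq h4
      linarith
  refine ⟨u, huc, hus, l2norm ψ, l2norm_landauState_pos n x₀ hc hc' hb, ?_, ?_⟩
  · have h1 : l2norm ψ ≤ l2norm fun x => ‖u x‖ + ‖S.indicator ψ x‖ := by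
      refine l2norm_mono (hum.norm.add hψS.norm) fun x => ?_
      rw [Real.norm_of_nonneg (by positivity)]
      by_cases hx : x ∈ S
      · rw [hin x hx]
        linarith [norm_nonneg (u x)]
      · have h2 : ‖x - x₀‖ ≤ R / 2 := (not_le.1 hx).le
        rw [hnu, cutoff_eq_one hR h2, norm_one, one_mul]
        linarith [norm_nonneg (S.indicator ψ x)]
    have h2 := l2norm_add_le hum.norm hψS.norm
    rw [l2norm_norm, l2norm_norm] at h2
    linarith
  · have h1 : l2norm (fun x => scalarPauli A V c u x - (2 * n * b + V x₀ : ℝ) * u x)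
        ≤ l2norm fun x => ε₁ * ‖ψ x‖ + ε₂ * ‖S.indicator ψ x‖ := by
      refine l2norm_mono ((hψm.norm.const_mul ε₁).add (hψS.norm.const_mul ε₂)) fun x => ?_
      rw [Real.norm_of_nonneg (by positivity)]
      exact hpt x
    have h2 := l2norm_add_le (hψm.norm.const_mul ε₁) (hψS.norm.const_mul ε₂)
    rw [l2norm_const_mul, l2norm_const_mul, l2norm_norm, l2norm_norm, abs_of_nonneg hε₁,
      abs_of_nonneg hε₂] at h2
    exact (h1.trans h2).trans (add_le_add le_rfl (mul_le_mul_of_nonneg_left htail hε₂))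

end TrialEstimate

/-! ### Smallness of the errors and the choice of points on the path -/

noncomputable section PathEstimates

open Complex (I)

/-- The choice of `R` makes `bR²/16 = (6κ + 4) n`. With `2ⁿ⁺¹ ≤ eⁿ⁺¹` and `n ≥ 1`, at least `6κn +
2n` is left in the negative exponent, and the root halves it. The factor `exp (-3κn)` is reserved
for the growth of `b`, the factor `exp (-n)` for smallness. -/
theorem tail_factor_le {κ b R : ℝ} {n : ℕ} (hn : n ≠ 0)
    (hR : b * R ^ 2 = 8 * (4 * (3 * κ + 2)) * n) :
    √(Real.exp (-(b * R ^ 2 / 16)) * 2 ^ (n + 1)) ≤ Real.exp (-(3 * κ * n)) * Real.exp (-n) := by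
  have hn1 : (1 : ℝ) ≤ n := by exact_mod_cast Nat.one_le_iff_ne_zero.2 hn
  refine Real.sqrt_le_iff.2 ⟨by positivity, ?_⟩
  have h2 : (2 : ℝ) ^ (n + 1) ≤ Real.exp ((n + 1 : ℕ) : ℝ) := by
    rw [← Real.exp_one_pow]
    exact pow_le_pow_left₀ zero_le_two (by linarith [Real.add_one_le_exp (1 : ℝ)]) _
  calc Real.exp (-(b * R ^ 2 / 16)) * 2 ^ (n + 1)
      ≤ Real.exp (-(b * R ^ 2 / 16)) * Real.exp ((n + 1 : ℕ) : ℝ) := by gcongr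
    _ ≤ (Real.exp (-(3 * κ * n)) * Real.exp (-n)) ^ 2 := by
        rw [← Real.exp_add, ← Real.exp_add, ← Real.exp_nat_mul, hR]
        refine Real.exp_le_exp.2 ?_
        push_cast
        nlinarith

/-- Here `θ` and `θ'` bound the variation of the two fields over the ball. The relation `bR² = 8Mn`
turns the term quadratic in `R` into a multiple of `nθ` and bounds `(4n + 1)/R²` by `b`, so the
cutoff error is governed by `b q`. -/
theorem trial_error_le {C M α η b θ θ' R q n : ℝ} (hC : 0 ≤ C) (hM : 8 ≤ M) (hn : 1 ≤ n)
    (hR : 0 < R) (hbR : b * R ^ 2 = 8 * M * n) (hθ0 : 0 ≤ θ) (hnθ : n * θ ≤ η)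
    (hθ' : θ' ≤ η) (hηb : η ≤ b) (hη : η ≤ 1 / 2) (hq0 : 0 ≤ q) (hq : q ≤ η)
    (hbq : b * q ≤ α * η) :
    θ' + (2 * n + 4) * θ + (b + θ) * θ * R ^ 2 + C * ((4 * n + 1) / R ^ 2 + 2 * θ + b) * q
      ≤ η * (1 + (6 + 16 * M) + C * (2 * α + 2)) := by
  have h0 : θ ≤ n * θ := le_mul_of_one_le_left hθ0 hn
  have h1 : (b + θ) * θ * R ^ 2 ≤ 16 * M * η := by
    calc (b + θ) * θ * R ^ 2 ≤ (b + b) * θ * R ^ 2 := by gcongr; linarith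
      _ = 2 * θ * (b * R ^ 2) := by ring
      _ = 16 * M * (n * θ) := by rw [hbR]; ring
      _ ≤ 16 * M * η := by gcongr
  have h2 : (2 * n + 4) * θ ≤ 6 * η := by linarith
  have h3 : (4 * n + 1) / R ^ 2 ≤ b := by
    rw [div_le_iff₀ (by positivity), hbR]
    have : 8 * n ≤ M * n := mul_le_mul_of_nonneg_right hM (zero_le_one.trans hn)
    linarith
  have h4 : θ * q ≤ 1 * η := mul_le_mul (by linarith) hq hq0 zero_le_one
  have h5 : C * ((4 * n + 1) / R ^ 2 + 2 * θ + b) * q ≤ η * (C * (2 * α + 2)) := by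
    calc C * ((4 * n + 1) / R ^ 2 + 2 * θ + b) * q ≤ C * (b + 2 * θ + b) * q := by gcongr
      _ = C * (2 * (b * q) + 2 * (θ * q)) := by ring
      _ ≤ C * (2 * (α * η) + 2 * (1 * η)) := by gcongr
      _ = _ := by ring
  linarith

/-- If the fields vary little on the scale of a localized state of the `n`-th Landau level, then
the latter gives an approximate eigenfunction. -/
theorem exists_approximate_eigenfunction {c : ℂ} (hc : c * c = -1) (hc' : (starRingEnd ℂ) c = -c)
    {α κ B₀ δ : ℝ} (hα : 0 < α) (hκ : 0 < κ) (hB₀ : 0 < B₀) (hδ : 0 < δ) :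
    ∃ η : ℝ, 0 < η ∧ ∀ {A : Plane → Plane} {B V : Plane → ℝ}, ContDiff ℝ 1 A → ContDiff ℝ 1 B →
      ContDiff ℝ 1 V → (∀ x, B x = curl A x) → ∀ {x₀ : Plane} {b R G G' : ℝ} {n : ℕ}, B₀ ≤ b →
      b ≤ α * Real.exp (3 * κ * n) → 0 < R → n ≠ 0 →
      b * R ^ 2 = 8 * (4 * (3 * κ + 2)) * n → -I * c * B x₀ = b →
      (∀ y, ‖y - x₀‖ ≤ R → ‖fderiv ℝ B y‖ ≤ G) → (∀ y, ‖y - x₀‖ ≤ R → ‖fderiv ℝ V y‖ ≤ G') →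
      n * (G * R) ≤ η → G' * R ≤ η → Real.exp (-n) ≤ η →
      ∃ u : Plane → ℂ, ContDiff ℝ 2 u ∧ HasCompactSupport u ∧
        l2norm (fun x => scalarPauli A V c u x - (2 * n * b + V x₀ : ℝ) * u x) < δ * l2norm u := by
  obtain ⟨C, hC, h⟩ := exists_trial_function hc hc'
  set M := 4 * (3 * κ + 2) with hM
  have hM8 : 8 ≤ M := by linarith
  set K := 1 + (6 + 16 * M) + C * (2 * α + 2) with hK
  have hKpos : 0 < K := by positivity
  -- The bound `1/2` gives `N ≤ 2 ‖u‖`, the bound `B₀` gives `η ≤ b`, and the last one makes the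
  -- total error at most `δ N / 4`, hence at most `δ ‖u‖ / 2`.
  set η := min (min (1 / 2) B₀) (δ / (4 * K)) with hη
  have hη2 : η ≤ 1 / 2 := (min_le_left _ _).trans (min_le_left _ _)
  have hηB : η ≤ B₀ := (min_le_left _ _).trans (min_le_right _ _)
  have hηδ : η * K ≤ δ / 4 := by
    have : η ≤ δ / (4 * K) := min_le_right _ _
    rw [le_div_iff₀ (by positivity)] at this
    linarith
  have hηpos : 0 < η := lt_min (lt_min (by norm_num) hB₀) (by positivity)
  refine ⟨η, hηpos, fun {A B V} hA hB hV hcurl {x₀ b R G G' n} hB₀b hbα hR hn hbR hbB hG hG' h1 h2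
    h3 => ?_⟩
  have hb : 0 < b := hB₀.trans_le hB₀b
  have hn1 : (1 : ℝ) ≤ n := by exact_mod_cast Nat.one_le_iff_ne_zero.2 hn
  obtain ⟨u, hu, hus, N, hN, hNu, hle⟩ := h hA hB hV hcurl hb hR hn hbB hG hG'
  refine ⟨u, hu, hus, ?_⟩
  have hG0 : 0 ≤ G := (norm_nonneg _).trans (hG x₀ (by simpa using hR.le))
  have hq := tail_factor_le hn hbR
  set q := √(Real.exp (-(b * R ^ 2 / 16)) * 2 ^ (n + 1))
  have hq0 : 0 ≤ q := Real.sqrt_nonneg _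
  have hθ0 : 0 ≤ G * R := by positivity
  set θ := G * R
  have hqη : q ≤ η := by
    refine hq.trans (le_trans ?_ h3)
    have : Real.exp (-(3 * κ * n)) ≤ 1 := Real.exp_le_one_iff.2 (by
      have : 0 ≤ 3 * κ * n := by positivity
      linarith)
    exact mul_le_of_le_one_left (Real.exp_pos _).le this
  have hbq : b * q ≤ α * η := by
    calc b * q ≤ (α * Real.exp (3 * κ * n)) * (Real.exp (-(3 * κ * n)) * Real.exp (-n)) := by gcongr
      _ = α * Real.exp (-n) * (Real.exp (3 * κ * n) * Real.exp (-(3 * κ * n))) := by ring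
      _ = α * Real.exp (-n) := by rw [← Real.exp_add, add_neg_cancel, Real.exp_zero, mul_one]
      _ ≤ α * η := by gcongr
  have herr := trial_error_le (α := α) (θ' := G' * R) hC.le hM8 hn1 hR hbR hθ0 h1 h2
    (hηB.trans hB₀b) hη2 hq0 hqη hbq
  have hN2 : N ≤ 2 * l2norm u := by
    have : q * N ≤ 1 / 2 * N := mul_le_mul_of_nonneg_right (hqη.trans hη2) hN.le
    linarith
  have hu0 : 0 < l2norm u := by linarith
  calc _ ≤ _ := hle
    _ = (G' * R + (2 * n + 4) * θ + (b + θ) * θ * R ^ 2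
          + C * ((4 * n + 1) / R ^ 2 + 2 * θ + b) * q) * N := by ring
    _ ≤ (η * K) * N := by
        exact mul_le_mul_of_nonneg_right herr hN.le
    _ ≤ δ / 4 * (2 * l2norm u) := by gcongr
    _ < δ * l2norm u := by linarith [mul_pos hδ hu0]

/-- A function on `(0, ∞)` that tends to infinity takes large integer values at large arguments. -/
theorem exists_large_natural_value {f : ℝ → ℝ} (hf : ContinuousOn f (Set.Ioi 0))
    (hlim : Tendsto f atTop atTop) {p : ℝ → Prop} (hp : ∀ᶠ t in atTop, p t) (k : ℕ) :
    ∃ t : ℝ, 0 < t ∧ p t ∧ ∃ n : ℕ, k ≤ n ∧ f t = n := by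
  obtain ⟨T, hT⟩ := eventually_atTop.1 (hp.and (eventually_gt_atTop 0))
  -- An integer at least `k` and at least `f T`; the function exceeds it later, so it is attained
  -- after `T` by the intermediate value theorem.
  set n := ⌈f T⌉₊ + k
  obtain ⟨T', hT'n, hT'⟩ := ((hlim.eventually_ge_atTop (n : ℝ)).and (eventually_ge_atTop T)).exists
  have hTn : f T ≤ n := by
    have := Nat.le_ceil (f T)
    push_cast [n]
    linarith [Nat.cast_nonneg (α := ℝ) k]
  obtain ⟨t, ht, hft⟩ := intermediate_value_Icc hT'
    (hf.mono fun s hs => (hT T le_rfl).2.trans_le hs.1) ⟨hTn, hT'n⟩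
  exact ⟨t, (hT t ht.1).2, (hT t ht.1).1, n, by omega, hft⟩

theorem norm_gradient_eq {f : Plane → ℝ} (x : Plane) : ‖gradient f x‖ = ‖fderiv ℝ f x‖ := by
  rw [gradient, LinearIsometryEquiv.norm_map]

theorem norm_fderiv_le_of_variesWithRate {f : Plane → ℝ} {X : Set Plane} {ν C R : ℝ} {x₀ : Plane}
    (h : ∀ x ∈ X, ∀ y : Plane, ‖y‖ ≤ (1 / 2) * ‖x‖ ^ ν →
      |‖gradient f (x + y)‖| ≤ C * |‖gradient f x‖|) (hx₀ : x₀ ∈ X)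
    (hR : R ≤ (1 / 2) * ‖x₀‖ ^ ν) (y : Plane) (hy : ‖y - x₀‖ ≤ R) :
    ‖fderiv ℝ f y‖ ≤ C * ‖gradient f x₀‖ := by
  have := h x₀ hx₀ (y - x₀) (hy.trans hR)
  rwa [add_sub_cancel, abs_norm, abs_norm, norm_gradient_eq] at this

section Asymptotics

variable {b v : ℝ → ℝ} {l B₀ : ℝ}

/-- The field is bounded away from zero, so the shift by `l` changes the quotient only by a bounded
amount. -/
theorem tendsto_landau_index (hB₀ : 0 < B₀) (hb : ∀ t, 0 < t → B₀ ≤ b t)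
    (h1 : Tendsto (fun t => v t / (2 * b t)) atTop atBot) :
    Tendsto (fun t => (l - v t) / (2 * b t)) atTop atTop := by
  have h := tendsto_atTop_add_left_of_le' atTop (-(|l| / (2 * B₀)))
    (f := fun t => l / (2 * b t)) (g := fun t => -(v t / (2 * b t))) ?_
    (tendsto_neg_atBot_atTop.comp h1)
  · refine h.congr fun t => ?_
    ring
  · filter_upwards [eventually_gt_atTop 0] with t ht
    have h2 := hb t ht
    have hbt : 0 < b t := hB₀.trans_le h2
    have h3 : |l / (2 * b t)| ≤ |l| / (2 * B₀) := by
      rw [abs_div, abs_of_pos (by positivity : 0 < 2 * b t)]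
      gcongr
    exact (abs_le.1 h3).1

/-- The size of the potential at points where `2 f b + v` has a fixed value. -/
theorem eventually_potential_bounds (hB₀ : 0 < B₀) (hb : ∀ t, 0 < t → B₀ ≤ b t)
    (h1 : Tendsto (fun t => v t / (2 * b t)) atTop atBot) :
    ∀ᶠ t in atTop, 0 < t ∧ 1 ≤ (l - v t) / (2 * b t) ∧ 1 ≤ |v t|
      ∧ (l - v t) / (2 * b t) * b t ≤ |v t|
      ∧ |v t| ≤ 3 * ((l - v t) / (2 * b t)) * b t := by
  have hf := tendsto_landau_index (l := l) hB₀ hb h1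
  filter_upwards [eventually_gt_atTop 0, hf.eventually_ge_atTop (max 1 ((|l| + 1) / B₀))]
    with t ht hft
  have hbt : 0 < b t := hB₀.trans_le (hb t ht)
  set F := (l - v t) / (2 * b t) with hF
  have hFv : 2 * (F * b t) = l - v t := by rw [hF]; field_simp
  -- Then `v = l - 2Fb` is negative, and `|v| = 2Fb - l` lies between `Fb + 1` and `3Fb`.
  have h2 : |l| + 1 ≤ F * b t := by
    have h3 := (le_max_right _ _).trans hft
    rw [div_le_iff₀ hB₀] at h3
    have hF0 : 0 ≤ F := zero_le_one.trans ((le_max_left _ _).trans hft)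
    exact h3.trans (mul_le_mul_of_nonneg_left (hb t ht) hF0)
  have hl := abs_le.1 (le_refl |l|)
  have hl0 := abs_nonneg l
  have hv : |v t| = 2 * (F * b t) - l := by
    rw [abs_of_neg (by linarith)]; linarith
  refine ⟨ht, (le_max_left _ _).trans hft, ?_, ?_, ?_⟩ <;> rw [hv] <;> linarith

end Asymptotics

end PathEstimates

/-! ### Comparison of scales along the path and the approximate eigenfunctions -/

noncomputable section PathScales

open Complex (I)

theorem sqrt_le_rpow_half {X ε : ℝ} (hX : 1 ≤ X) (hε : 0 ≤ ε) : √X ≤ X ^ ((1 + ε) / 2) := by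
  rw [Real.sqrt_eq_rpow]
  exact Real.rpow_le_rpow_of_exponent_le hX (by linarith)

section Scales

variable {F b w ε : ℝ}

theorem one_le_cube_div_sq (hF : 1 ≤ F) (hb : 0 < b) (hw : 1 ≤ w) (hFb : F * b ≤ w) :
    1 ≤ w ^ 3 / b ^ 2 := by
  rw [one_le_div (by positivity)]
  have h1 : b ≤ w := (le_mul_of_one_le_left hb.le hF).trans hFb
  calc b ^ 2 ≤ w ^ 2 := pow_le_pow_left₀ hb.le h1 2
    _ ≤ w ^ 3 := pow_le_pow_right₀ hw (by norm_num)

/-- With `F` the Landau index and `w = |V|`, this bounds `n R |∇B|` by the `B`-term of the second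
limit, up to a constant. Squaring reduces it to `(Fb)³ ≤ w³`, and the exponent may be raised because
its base is at least `1`. -/
theorem mul_sqrt_div_le (hF : 1 ≤ F) (hb : 0 < b) (hw : 1 ≤ w) (hFb : F * b ≤ w) (hε : 0 ≤ ε) :
    F * √(F / b) ≤ 1 / b * (w ^ 3 / b ^ 2) ^ ((1 + ε) / 2) := by
  refine le_trans ?_ (mul_le_mul_of_nonneg_left
    (sqrt_le_rpow_half (one_le_cube_div_sq hF hb hw hFb) hε) (by positivity))
  refine le_of_sq_le_sq ?_ (by positivity)
  have h3 : (F * b) ^ 3 ≤ w ^ 3 := pow_le_pow_left₀ (by positivity) hFb 3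
  rw [mul_pow, mul_pow, Real.sq_sqrt (by positivity), Real.sq_sqrt (by positivity)]
  calc F ^ 2 * (F / b) = (F * b) ^ 3 / b ^ 4 := by field_simp
    _ ≤ w ^ 3 / b ^ 4 := by gcongr
    _ = _ := by field_simp

/-- The analogue for `R |∇V|` and the `V`-term; squaring reduces it to `Fb ≤ w`. -/
theorem sqrt_div_le (hF : 1 ≤ F) (hb : 0 < b) (hw : 1 ≤ w) (hFb : F * b ≤ w) (hε : 0 ≤ ε) :
    √(F / b) ≤ 1 / w * (w ^ 3 / b ^ 2) ^ ((1 + ε) / 2) := by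
  refine le_trans ?_ (mul_le_mul_of_nonneg_left
    (sqrt_le_rpow_half (one_le_cube_div_sq hF hb hw hFb) hε) (by positivity))
  refine le_of_sq_le_sq ?_ (by positivity)
  rw [mul_pow, Real.sq_sqrt (by positivity), Real.sq_sqrt (by positivity)]
  calc F / b = F * b / b ^ 2 := by field_simp
    _ ≤ w / b ^ 2 := by gcongr
    _ = _ := by field_simp

/-- The hypothesis gives `Y^(1+ε) ≤ s^(1+ε) D`, and `D ≤ D^(1+ε)` since `D ≥ 1`. It removes the
exponent from the third limit. -/
theorem le_mul_of_rpow_le {D Y s : ℝ} (hD : 1 ≤ D) (hY : 0 ≤ Y) (hs : 0 < s) (hε : 0 < ε)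
    (h : 1 / D * Y ^ (1 + ε) ≤ s ^ (1 + ε)) : Y ≤ s * D := by
  have hD0 : 0 < D := zero_lt_one.trans_le hD
  rw [← Real.rpow_le_rpow_iff hY (by positivity) (by linarith : 0 < 1 + ε),
    Real.mul_rpow hs.le hD0.le]
  rw [one_div, inv_mul_le_iff₀ hD0, mul_comm] at h
  refine h.trans (mul_le_mul_of_nonneg_left ?_ (by positivity))
  conv_lhs => rw [← Real.rpow_one D]
  exact Real.rpow_le_rpow_of_exponent_le hD (by linarith)

end Scales

/-- The spin component is selected by the sign of the field so that the effective field strength is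
positive, as the Gaussian requires. -/
theorem neg_I_mul_spinUnit_mul {s : ℝ} : -I * spinUnit (if 0 ≤ s then 0 else 1) * s = |s| := by
  split_ifs with h
  · simp [spinUnit, abs_of_nonneg h]
  · simp [spinUnit, abs_of_neg (not_le.1 h)]

/-- Along a path on which the fields satisfy the assumptions, every real number is in the
spectrum of the Pauli operator. -/
theorem mem_spectrum_of_path {A : Plane → Plane} {B V : Plane → ℝ} (hA : ContDiff ℝ 1 A)
    (hB : ContDiff ℝ 1 B) (hV : ContDiff ℝ 1 V) (hcurl : ∀ x, B x = curl A x)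
    {γ : ℝ → Plane} (hγ : ContinuousOn γ (Set.Ioi 0))
    (hγ_inf : Tendsto (fun t => ‖γ t‖) atTop atTop) {ε ν : ℝ} (hε : 0 < ε) (hν : 0 ≤ ν)
    (hVvar : VariesWithRate (fun x => ‖gradient V x‖) ν (γ '' Set.Ioi 0))
    (hBvar : VariesWithRate (fun x => ‖gradient B x‖) ν (γ '' Set.Ioi 0))
    (h1 : Tendsto (fun t => V (γ t) / (2 * |B (γ t)|)) atTop atBot)
    (h2 : Tendsto (fun t =>
        (‖gradient B (γ t)‖ / |B (γ t)| + ‖gradient V (γ t)‖ / |V (γ t)|) *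
          (|V (γ t)| ^ 3 / B (γ t) ^ 2) ^ ((1 + ε) / 2)) atTop (𝓝 0))
    (h3 : Tendsto (fun t =>
        1 / ‖γ t‖ ^ (2 * ν) * (|V (γ t)| / B (γ t) ^ 2) ^ (1 + ε)) atTop (𝓝 0))
    {α κ B₀ : ℝ} (hα : 0 < α) (hκ : 0 < κ) (hB₀ : 0 < B₀)
    (h4 : ∀ t : ℝ, 0 < t →
      B₀ ≤ |B (γ t)| ∧ |B (γ t)| ≤ α * Real.exp (κ * |V (γ t) / B (γ t)|)) (l : ℝ) :
    (l : ℂ) ∈ unboundedSpectrum (pauliOperator A V hA hV.continuous) := by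
  refine mem_spectrum_of_approximate_eigenfunctions hA hV.continuous fun δ hδ => ?_
  choose η hη H using fun j => exists_approximate_eigenfunction (spinUnit_mul_self j)
    (conj_spinUnit j) hα hκ hB₀ hδ
  obtain ⟨CB, hCB, hB'⟩ := hBvar
  obtain ⟨CV, hCV, hV'⟩ := hVvar
  obtain ⟨e, he, heη⟩ : ∃ e > 0, ∀ j, e ≤ η j := ⟨min (η 0) (η 1), lt_min (hη 0) (hη 1), fun j => by
    fin_cases j
    exacts [min_le_left _ _, min_le_right _ _]⟩
  -- The constant in `bR² = 8Mn`, large enough for the tail to beat the exponential growth of the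
  -- field.
  obtain ⟨M, hM⟩ : ∃ M, M = 4 * (3 * κ + 2) := ⟨_, rfl⟩
  have hMpos : 0 < M := by rw [hM]; positivity
  have hb : ∀ t, 0 < t → B₀ ≤ |B (γ t)| := fun t ht => (h4 t ht).1
  have hFc : ContinuousOn (fun t => (l - V (γ t)) / (2 * |B (γ t)|)) (Set.Ioi 0) := by
    refine (continuousOn_const.sub (hV.continuous.comp_continuousOn hγ)).div
      (continuousOn_const.mul (hB.continuous.comp_continuousOn hγ).abs) fun t ht => ?_
    exact mul_ne_zero two_ne_zero (hB₀.trans_le (hb t ht)).ne'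
  obtain ⟨k, hk⟩ := ((Real.tendsto_exp_neg_atTop_nhds_zero.comp
    tendsto_natCast_atTop_atTop).eventually_le_const he).exists
  have ev := (((eventually_potential_bounds (l := l) hB₀ hb h1).and
    (hγ_inf.eventually_ge_atTop 1)).and
    -- This threshold makes both field errors at most `e`; the next one makes `R² ≤ ‖γ t‖^(2ν) / 4`.
    (h2.eventually_le_const (by positivity : 0 < e / ((CB + CV) * √(8 * M))))).and
    (h3.eventually_le_const (by positivity : 0 < (1 / (32 * M)) ^ (1 + ε)))
  -- At this point of the path the `n`-th Landau level of the frozen field has total energy exactly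
  -- `l`.
  obtain ⟨t, ht, ⟨⟨⟨⟨-, hF1, hV1, hFV, hVF⟩, hγ1⟩, h2t⟩, h3t⟩, n, hkn, hn⟩ :=
    exists_large_natural_value hFc (tendsto_landau_index hB₀ hb h1) ev k
  obtain ⟨hbt, h4t⟩ := h4 t ht
  rw [hn] at hF1 hFV hVF
  obtain ⟨x₀, hx₀⟩ : ∃ x₀, x₀ = γ t := ⟨_, rfl⟩
  have hx₀m : x₀ ∈ γ '' Set.Ioi 0 := ⟨t, ht, hx₀.symm⟩
  rw [← hx₀] at hV1 hFV hVF hγ1 h2t h3t hbt h4t hn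
  rw [abs_div] at h4t
  rw [← sq_abs (B x₀)] at h2t h3t
  have hsgn := neg_I_mul_spinUnit_mul (s := B x₀)
  set j : Fin 2 := if 0 ≤ B x₀ then 0 else 1
  set b := |B x₀|
  have hbpos : 0 < b := hB₀.trans_le hbt
  set R := √(8 * M * (n / b)) with hR
  have hn0 : (0 : ℝ) < n := zero_lt_one.trans_le hF1
  have hRpos : 0 < R := Real.sqrt_pos.2 (by positivity)
  have hR2 : R ^ 2 = 8 * M * (n / b) := Real.sq_sqrt (by positivity)
  have hRs : R = √(8 * M) * √(n / b) := Real.sqrt_mul (by positivity) _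
  -- The trial function must live where the gradients are controlled by their values at `x₀`.
  have hRν : R ≤ 1 / 2 * ‖x₀‖ ^ ν := by
    refine le_of_sq_le_sq ?_ (by positivity)
    have hD : 1 ≤ ‖x₀‖ ^ (2 * ν) := Real.one_le_rpow hγ1 (by positivity)
    have h5 := le_mul_of_rpow_le hD (by positivity) (by positivity) hε h3t
    have h6 : (n : ℝ) / b ≤ |V x₀| / b ^ 2 := by
      rw [div_le_div_iff₀ hbpos (by positivity)]
      nlinarith
    have h7 : ‖x₀‖ ^ (2 * ν) = (‖x₀‖ ^ ν) ^ 2 := by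
      rw [mul_comm, Real.rpow_mul (norm_nonneg _), Real.rpow_two]
    rw [h7] at h5
    calc R ^ 2 = 8 * M * (n / b) := hR2
      _ ≤ 8 * M * (1 / (32 * M) * (‖x₀‖ ^ ν) ^ 2) := by gcongr; exact h6.trans h5
      _ = _ := by field_simp; norm_num
  obtain ⟨X, hX⟩ : ∃ X, X = (|V x₀| ^ 3 / b ^ 2) ^ ((1 + ε) / 2) := ⟨_, rfl⟩
  have hX0 : 0 ≤ X := by rw [hX]; positivity
  have e1 := mul_sqrt_div_le hF1 hbpos hV1 hFV hε.le
  have e2 := sqrt_div_le hF1 hbpos hV1 hFV hε.le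
  rw [← hX] at e1 e2 h2t
  rw [le_div_iff₀ (by positivity)] at h2t
  have hs0 : 0 ≤ √(8 * M) := Real.sqrt_nonneg _
  have hV0 : 0 ≤ ‖gradient V x₀‖ / |V x₀| * X := by positivity
  have hB0 : 0 ≤ ‖gradient B x₀‖ / b * X := by positivity
  -- The index `n` and the scale `√(n/b)` of `R` combine to the power of `|V|` and `b` in the second
  -- limit.
  have g1 : n * (CB * ‖gradient B x₀‖ * R) ≤ e := by
    calc n * (CB * ‖gradient B x₀‖ * R)
        = CB * √(8 * M) * (‖gradient B x₀‖ * (n * √(n / b))) := by rw [hRs]; ring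
      _ ≤ CB * √(8 * M) * (‖gradient B x₀‖ * (1 / b * X)) := by gcongr
      _ = (‖gradient B x₀‖ / b * X) * (CB * √(8 * M)) := by ring
      _ ≤ ((‖gradient B x₀‖ / b + ‖gradient V x₀‖ / |V x₀|) * X) * ((CB + CV) * √(8 * M)) := by
          gcongr
          · exact le_add_of_nonneg_right (by positivity)
          · exact le_add_of_nonneg_right hCV.le
      _ ≤ e := h2t
  have g2 : CV * ‖gradient V x₀‖ * R ≤ e := by
    calc CV * ‖gradient V x₀‖ * R
        = CV * √(8 * M) * (‖gradient V x₀‖ * √(n / b)) := by rw [hRs]; ring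
      _ ≤ CV * √(8 * M) * (‖gradient V x₀‖ * (1 / |V x₀| * X)) := by gcongr
      _ = (‖gradient V x₀‖ / |V x₀| * X) * (CV * √(8 * M)) := by ring
      _ ≤ ((‖gradient B x₀‖ / b + ‖gradient V x₀‖ / |V x₀|) * X) * ((CB + CV) * √(8 * M)) := by
          gcongr
          · exact le_add_of_nonneg_left (by positivity)
          · exact le_add_of_nonneg_left hCB.le
      _ ≤ e := h2t
  have g3 : Real.exp (-n) ≤ e :=
    (Real.exp_le_exp.2 (neg_le_neg (Nat.cast_le.2 hkn))).trans hk
  -- From `|V| ≤ 3nb`, the exponent `κ|V/B|` is at most `3κn`. This is the origin of the `3κ` in the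
  -- choice of `M`.
  have g4 : b ≤ α * Real.exp (3 * κ * n) := by
    refine h4t.trans ?_
    have : |V x₀| / b ≤ 3 * n := (div_le_iff₀ hbpos).2 hVF
    have : κ * (|V x₀| / b) ≤ 3 * κ * n := by
      calc κ * (|V x₀| / b) ≤ κ * (3 * n) := by gcongr
        _ = _ := by ring
    gcongr
  have g5 : b * R ^ 2 = 8 * (4 * (3 * κ + 2)) * n := by
    rw [hR2, ← hM]; field_simp
  obtain ⟨u, hu, hus, hlt⟩ := H j hA hB hV hcurl hbt g4 hRpos (by exact_mod_cast hn0.ne') g5 hsgn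
    (norm_fderiv_le_of_variesWithRate hB' hx₀m hRν)
    (norm_fderiv_le_of_variesWithRate hV' hx₀m hRν) (g1.trans (heη j)) (g2.trans (heη j))
    (g3.trans (heη j))
  refine ⟨j, u, hu, hus, ?_⟩
  have hl : 2 * n * b + V x₀ = l := by
    rw [div_eq_iff (by positivity)] at hn
    linarith
  rwa [hl] at hlt

end PathScales

theorem theorem3
    -- standing assumptions: regularity, `B = curl A`, lower bound on `V`
    (A : Plane → Plane) (B V : Plane → ℝ)
    (hA : ContDiff ℝ 2 A) (hB : ContDiff ℝ 1 B) (hV : ContDiff ℝ 1 V)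
    (hcurl : ∀ x, B x = curl A x)
    (hgrowth : ∃ c d : ℝ, 0 < c ∧ ∀ x : Plane, -c * ‖x‖ ^ 2 + d ≤ V x)
    -- the path, a function on `(0, ∞)`
    (γ : ℝ → Plane) (hγ : ContinuousOn γ (Set.Ioi 0))
    (hγ_inf : Tendsto (fun t => ‖γ t‖) atTop atTop)
    (ε ν : ℝ) (hε : 0 < ε) (hν : ν ∈ Set.Icc (0 : ℝ) 1)
    (hVvar : VariesWithRate (fun x => ‖gradient V x‖) ν (γ '' Set.Ioi 0))
    (hBvar : VariesWithRate (fun x => ‖gradient B x‖) ν (γ '' Set.Ioi 0))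
    (h1 : Tendsto (fun t => V (γ t) / (2 * |B (γ t)|)) atTop atBot)
    (h2 : Tendsto (fun t =>
        (‖gradient B (γ t)‖ / |B (γ t)| + ‖gradient V (γ t)‖ / |V (γ t)|) *
          (|V (γ t)| ^ 3 / B (γ t) ^ 2) ^ ((1 + ε) / 2)) atTop (𝓝 0))
    (h3 : Tendsto (fun t =>
        1 / ‖γ t‖ ^ (2 * ν) * (|V (γ t)| / B (γ t) ^ 2) ^ (1 + ε)) atTop (𝓝 0))
    (α κ B₀ : ℝ) (hα : 0 < α) (hκ : 0 < κ) (hB₀ : 0 < B₀)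
    (h4 : ∀ t : ℝ, 0 < t →
      B₀ ≤ |B (γ t)| ∧ |B (γ t)| ≤ α * Real.exp (κ * |V (γ t) / B (γ t)|)) :
    unboundedEssentialSpectrum
        (pauliOperator A V (hA.of_le one_le_two) hV.continuous) =
      Set.range ((↑) : ℝ → ℂ) := by
  -- The two inclusions are independent: the growth bound excludes nonreal points, and the
  -- assumptions along the path produce every real one.
  refine unboundedEssentialSpectrum_eq_range_ofReal (Set.Subset.antisymm
    (unboundedSpectrum_pauliOperator_subset (hA.of_le one_le_two) hV.continuous hgrowth) ?_)
  rintro _ ⟨l, rfl⟩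
  exact mem_spectrum_of_path (hA.of_le one_le_two) hB hV hcurl hγ hγ_inf hε hν.1 hVvar hBvar h1 h2
    h3 hα hκ hB₀ h4 l
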